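/- Let $K$ be an algebraically closed field, let $d\ge 1$ and $n\ge d+2$, and let $\mathbb{P}^N$, $N=\binom{n+d}{d}-1$, be the projective space of degree $d$ hypersurfaces in $\mathbb{P}^n$ over $K$. For a hypersurface $X=V(f)$, a point $p\in X$ is called singular if all partial derivatives of $f$ vanish at $p$, and smooth otherwise. A point $p\in X$ is called $1$-level if the space of lines in $X$ through $p$ (a closed subset of the $\mathbb{P}^{n-1}$ of lines in $\mathbb{P}^n$ through $p$) has dimension at most $n-d-1$ when $p$ is a smooth point of $X$, and at most $n-d$ when $p$ is a singular point of $X$. The hypersurface $X$ is called $1$-level if no line is contained in its singular locus and every point of $X$ is $1$-level; otherwise $X$ is called $1$-sharp. Let $S_1\subset\mathbb{P}^N$ be the Zariski closure of the set of $1$-sharp hypersurfaces. Then the codimension of $S_1$ in $\mathbb{P}^N$ satisfies $$\operatorname{codim} S_1\ \ge\ \min\left\{\,n(d-2)+3,\ \binom n2-n+1\right\},$$ where the empty set has codimension $+\infty$. -/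

import Mathlib

open scoped LinearAlgebra.Projectivization

noncomputable section

namespace OneLevel

/-! ### The Zariski topology on a projective space -/

section Zariski

variable (K : Type*) [Field K] (V : Type*) [AddCommGroup V] [Module K V]

/-- Polynomial expressions over `K` in the linear forms on `V`. -/
abbrev PolyOn := MvPolynomial (Module.Dual K V) K

variable {K V}

/-- The value at the vector `v` of a polynomial in the linear forms on `V`. -/
def PolyOn.value (q : PolyOn K V) (v : V) : K :=
  MvPolynomial.eval (fun φ : Module.Dual K V => φ v) q

/-- The common zero locus in `ℙ K V` of a set of polynomials. It is used for homogeneous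
polynomials only, whose vanishing at a point does not depend on the representative. -/
def zeroLocus (T : Set (PolyOn K V)) : Set (ℙ K V) :=
  {x | ∀ q ∈ T, q.value x.rep = 0}

variable (K V)

/-- The Zariski closed subsets of `ℙ K V`: the zero loci of sets of homogeneous polynomials. -/
def zariskiClosedSets : Set (Set (ℙ K V)) :=
  {Z | ∃ T : Set (PolyOn K V),
    (∀ q ∈ T, ∃ k : ℕ, MvPolynomial.IsHomogeneous q k) ∧ Z = zeroLocus T}

/-- The Zariski topology on `ℙ K V`. -/
instance zariskiTopology : TopologicalSpace (ℙ K V) :=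
  TopologicalSpace.ofClosed (zariskiClosedSets K V)
    (by
      refine ⟨{1}, ?_, ?_⟩
      · rintro q rfl
        exact ⟨0, MvPolynomial.isHomogeneous_one _ _⟩
      · ext x
        simp [zeroLocus, PolyOn.value])
    (by
      intro A hA
      refine ⟨{q | (∃ k : ℕ, MvPolynomial.IsHomogeneous q k) ∧
        ∃ Z ∈ A, ∀ x ∈ Z, q.value x.rep = 0}, fun q hq => hq.1, ?_⟩
      ext x
      constructor
      · rintro hx q ⟨_, Z, hZ, hq⟩
        exact hq x (hx Z hZ)
      · intro hx Z hZ
        obtain ⟨T, hT, rfl⟩ := hA hZ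
        exact fun q hq => hx q ⟨hT q hq, _, hZ, fun y hy => hy q hq⟩)
    (by
      rintro _ ⟨T₁, h₁, rfl⟩ _ ⟨T₂, h₂, rfl⟩
      refine ⟨{q | ∃ a ∈ T₁, ∃ b ∈ T₂, q = a * b}, ?_, ?_⟩
      · rintro _ ⟨a, ha, b, hb, rfl⟩
        obtain ⟨k, hk⟩ := h₁ a ha
        obtain ⟨l, hl⟩ := h₂ b hb
        exact ⟨k + l, hk.mul hl⟩
      · ext x
        constructor
        · rintro (hx | hx) _ ⟨a, ha, b, hb, rfl⟩
          · have := hx a ha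
            simp only [PolyOn.value] at this
            simp [PolyOn.value, this]
          · have := hx b hb
            simp only [PolyOn.value] at this
            simp [PolyOn.value, this]
        · intro hx
          by_contra hcon
          simp only [Set.mem_union, not_or, zeroLocus, Set.mem_ofPred_eq, not_forall] at hcon
          obtain ⟨⟨a, ha, ha'⟩, b, hb, hb'⟩ := hcon
          have := hx (a * b) ⟨a, ha, b, hb, rfl⟩
          simp only [PolyOn.value, map_mul] at this
          exact (mul_ne_zero ha' hb') this)

end Zariski

/-- The codimension of a closed subset `S` of a topological space `X`: the infimum, over the
irreducible closed subsets `Z` of `S`, of the supremum of the lengths `k` of chains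
`Z = Z₀ ⊂ Z₁ ⊂ ⋯ ⊂ Z_k` of irreducible closed subsets of `X`. The empty set has
codimension `⊤`. -/
def codim {X : Type*} [TopologicalSpace X] (S : Set X) : ℕ∞ :=
  ⨅ (Z : TopologicalSpace.IrreducibleCloseds X) (_ : (Z : Set X) ⊆ S), Order.coheight Z

/-! ### Hypersurfaces and the lines in them -/

section Hypersurfaces

/-- The projective space `ℙ^N`, `N = (n+d choose d) - 1`, of degree `d` hypersurfaces in `ℙ^n`:
nonzero homogeneous polynomials of degree `d` in `n + 1` variables, up to scalars. -/
abbrev Hypersurface (K : Type*) [Field K] (n d : ℕ) : Type _ :=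
  ℙ K (MvPolynomial.homogeneousSubmodule (Fin (n + 1)) K d)

variable {K : Type*} [Field K] {n d : ℕ}

/-- An equation of the hypersurface `X`. -/
def Hypersurface.eqn (X : Hypersurface K n d) : MvPolynomial (Fin (n + 1)) K :=
  (X.rep : MvPolynomial.homogeneousSubmodule (Fin (n + 1)) K d)

/-- The vector `v` lies on the affine cone over `X`. -/
def Hypersurface.Vanishes (X : Hypersurface K n d) (v : Fin (n + 1) → K) : Prop :=
  MvPolynomial.eval v X.eqn = 0

/-- `v` lies on the affine cone over `X`, and all partial derivatives of the equation of `X`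
vanish at `v`. -/
def Hypersurface.SingularAtVec (X : Hypersurface K n d) (v : Fin (n + 1) → K) : Prop :=
  X.Vanishes v ∧ ∀ i, MvPolynomial.eval v (MvPolynomial.pderiv i X.eqn) = 0

/-- The point `p` of `ℙ^n` lies on `X`. -/
def Hypersurface.HasPoint (X : Hypersurface K n d) (p : ℙ K (Fin (n + 1) → K)) : Prop :=
  X.Vanishes p.rep

/-- `p` is a singular point of `X`. -/
def Hypersurface.SingularAt (X : Hypersurface K n d) (p : ℙ K (Fin (n + 1) → K)) : Prop :=
  X.SingularAtVec p.rep

/-- The space of lines in `X` through `p`. Lines in `ℙ^n = ℙ(V)` through `p` are the points of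
`ℙ(V ⧸ p) ≅ ℙ^{n-1}`: the point `ℓ` is the line swept out by the vectors of `V` whose class
modulo `p` lies in `ℓ`. -/
def Hypersurface.linesThrough (X : Hypersurface K n d) (p : ℙ K (Fin (n + 1) → K)) :
    Set (ℙ K ((Fin (n + 1) → K) ⧸ p.submodule)) :=
  {ℓ | ∀ v : Fin (n + 1) → K, p.submodule.mkQ v ∈ ℓ.submodule → X.Vanishes v}

/-- The point `p` of `X` is `1`-level: the space of lines in `X` through `p` has dimension at most
`n - d - 1` if `p` is a smooth point of `X`, and at most `n - d` if `p` is a singular point. -/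
def Hypersurface.LevelPoint (X : Hypersurface K n d) (p : ℙ K (Fin (n + 1) → K)) : Prop :=
  (¬ X.SingularAt p ∧ topologicalKrullDim (X.linesThrough p) + (d + 1 : ℕ) ≤ (n : ℕ)) ∨
  (X.SingularAt p ∧ topologicalKrullDim (X.linesThrough p) + (d : ℕ) ≤ (n : ℕ))

/-- `X` is singular at every point of some line of `ℙ^n`. -/
def Hypersurface.SingularAlongLine (X : Hypersurface K n d) : Prop :=
  ∃ L : Submodule K (Fin (n + 1) → K), Module.finrank K L = 2 ∧ ∀ v ∈ L, v ≠ 0 → X.SingularAtVec v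

/-- `X` is `1`-level: no line is contained in its singular locus, and all its points are
`1`-level. -/
def Hypersurface.Level (X : Hypersurface K n d) : Prop :=
  ¬ X.SingularAlongLine ∧ ∀ p, X.HasPoint p → X.LevelPoint p

/-- `X` is `1`-sharp if it is not `1`-level. -/
def Hypersurface.Sharp (X : Hypersurface K n d) : Prop := ¬ X.Level

variable (K n d)

/-- `S₁`: the Zariski closure in `ℙ^N` of the set of `1`-sharp hypersurfaces. -/
def sharpLocus : Set (Hypersurface K n d) := closure {X | X.Sharp}

end Hypersurfaces

end OneLevel

end

/-! A sharp hypersurface `f` is singular along a line or has a point that is not level, and each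
case is a dimension count in the affine space of forms of degree `d`. Singular along a line: for a
fixed line, the vanishing of `f` and of its `n - 1` normal derivatives on the line amounts to `(d +
1) + (n - 1) d` independent linear conditions, and lines depend on `2 (n - 1)` parameters. The
difference is `n (d - 2) + 3` (`sizeLE_singularAlongLine`). A point `p` that is not level: at the
cost of `n` parameters, `p` is a coordinate point, and `f = ∑ x_j ^ (d - k) F_k` with `F_0 = 0`. The
lines in `X` through `p` are the common zeros of `F_1, …, F_d` in `ℙ^{n-1}`. Since there are too
many, there is a first degree `i ≥ 2` at which the dimension does not drop: with `t = 0` for a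
smooth and `t = 1` for a singular point and `s = n - i + t`, the zeros of `F_1, …, F_{i-1}` have
affine dimension at most `s + 1`, those of `F_1, …, F_i` have dimension more than `s`. A linear
projection, finite on the former, maps the latter onto `K^{s+1}`. A nonzero form in `s + 1`
variables, pulled back along it, cannot vanish on the zeros, so `F_i` satisfies at least as many
conditions as there are monomials of degree `i` in `s + 1` variables: `(n + t choose i) ≥ (n choose
2)`, as `2 ≤ i ≤ n - 2`. Adding `1` for `F_0 = 0` and subtracting `n` for the point gives `(n choose
2) - n + 1` (`sizeLE_badForms`, `sizeLE_excessForms`). Dimension is measured by growth: `SizeLE K S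
e` says that the algebra of functions on `S` generated by the linear forms has growth of degree at
most `e`. Such bounds survive images, finite unions, localization, integral extensions and Zariski
closure, so parameter spaces may be arbitrary sets. Two results lead back to topology:
`le_codim_of_sizeLE`, which builds chains of irreducible closed sets by joining with points, and
`topologicalKrullDim_add_one_le`, which bounds the dimension of a closed set by a finite linear
projection. -/

noncomputable section

namespace OneLevel

open Module

/-! ### Growth of algebras of functions -/

section Growth

variable {K : Type*} [Field K] {A A' : Type*} [CommRing A] [Algebra K A] [CommRing A'] [Algebra K A']

/-- The Gelfand-Kirillov dimension of the subalgebra `B` is at most `e`, with explicit growth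
constants. -/
def GrowthLE (B : Subalgebra K A) (e : ℕ) : Prop :=
  ∀ G : Submodule K A, G.FG → G ≤ Subalgebra.toSubmodule B →
    ∃ C : ℕ, ∀ t : ℕ, finrank K (G ^ t : Submodule K A) ≤ C * (t + 1) ^ e

theorem finrank_map_le_of_fg (f : A →ₗ[K] A') {G : Submodule K A} (hG : G.FG) :
    finrank K (G.map f) ≤ finrank K G := by
  have : FiniteDimensional K G := Module.Finite.iff_fg.mpr hG
  exact Submodule.finrank_map_le f G

theorem finrank_mono_of_fg {G H : Submodule K A} (hH : H.FG) (h : G ≤ H) :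
    finrank K G ≤ finrank K H := by
  have : FiniteDimensional K H := Module.Finite.iff_fg.mpr hH
  exact Submodule.finrank_mono h

theorem finrank_mul_le {G H : Submodule K A} (hG : G.FG) (hH : H.FG) :
    finrank K (G * H : Submodule K A) ≤ finrank K G * finrank K H := by
  have : FiniteDimensional K G := Module.Finite.iff_fg.mpr hG
  have : FiniteDimensional K H := Module.Finite.iff_fg.mpr hH
  have h : LinearMap.range (Submodule.mulMap G H) = G * H := Submodule.mulMap_range G H
  rw [← h, ← Module.finrank_tensorProduct (R := K) (S := K)]
  exact LinearMap.finrank_range_le _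

theorem GrowthLE.mono {B B' : Subalgebra K A} {e : ℕ} (h : GrowthLE B' e) (hB : B ≤ B') :
    GrowthLE B e :=
  fun G hG hGB => h G hG (hGB.trans hB)

theorem GrowthLE.mono_right {B : Subalgebra K A} {e e' : ℕ} (h : GrowthLE B e) (he : e ≤ e') :
    GrowthLE B e' := by
  intro G hG hGB
  obtain ⟨C, hC⟩ := h G hG hGB
  exact ⟨C, fun t => (hC t).trans
    (Nat.mul_le_mul_left _ (Nat.pow_le_pow_right (Nat.succ_pos t) he))⟩

theorem exists_fg_map_eq (φ : A →ₐ[K] A') {B : Subalgebra K A} {G : Submodule K A'} (hG : G.FG)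
    (h : G ≤ Subalgebra.toSubmodule (B.map φ)) :
    ∃ G₀ : Submodule K A, G₀.FG ∧ G₀ ≤ Subalgebra.toSubmodule B ∧ G₀.map φ.toLinearMap = G := by
  obtain ⟨s, rfl⟩ := hG
  have hs : ∀ x : s, ∃ y ∈ B, φ y = x := fun x => h (Submodule.subset_span x.2)
  choose y hyB hy using hs
  refine ⟨Submodule.span K (Set.range y), Submodule.fg_span (Set.finite_range y), ?_, ?_⟩
  · rw [Submodule.span_le]
    rintro _ ⟨x, rfl⟩
    exact hyB x
  · rw [Submodule.map_span, ← Set.range_comp]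
    congr 1
    ext z
    constructor
    · rintro ⟨x, rfl⟩
      simp [hy]
    · intro hz
      exact ⟨⟨z, hz⟩, by simp [hy]⟩

theorem GrowthLE.map {B : Subalgebra K A} {e : ℕ} (h : GrowthLE B e) (φ : A →ₐ[K] A') :
    GrowthLE (B.map φ) e := by
  intro G hG hGB
  obtain ⟨G₀, hG₀, hB, rfl⟩ := exists_fg_map_eq φ hG hGB
  obtain ⟨C, hC⟩ := h G₀ hG₀ hB
  refine ⟨C, fun t => le_trans ?_ (hC t)⟩
  rw [← Submodule.map_pow]
  exact finrank_map_le_of_fg _ (hG₀.pow t)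

theorem finrank_map_le_finrank_map {V V₁ V₂ : Type*} [AddCommGroup V] [Module K V]
    [AddCommGroup V₁] [Module K V₁] [AddCommGroup V₂] [Module K V₂]
    (f : V →ₗ[K] V₁) (g : V →ₗ[K] V₂) (h : LinearMap.ker f ≤ LinearMap.ker g)
    {G : Submodule K V} (hG : G.FG) : finrank K (G.map g) ≤ finrank K (G.map f) := by
  have : FiniteDimensional K G := Module.Finite.iff_fg.mpr hG
  have h1 := LinearMap.finrank_range_add_finrank_ker (f.domRestrict G)
  have h2 := LinearMap.finrank_range_add_finrank_ker (g.domRestrict G)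
  rw [LinearMap.range_domRestrict] at h1 h2
  have h3 : finrank K (LinearMap.ker (f.domRestrict G)) ≤
      finrank K (LinearMap.ker (g.domRestrict G)) := by
    apply Submodule.finrank_mono
    intro x hx
    simp only [LinearMap.mem_ker, LinearMap.domRestrict_apply] at hx ⊢
    exact h hx
  omega

/-- Both ranges are quotients of `P`, and the one by the larger kernel is smaller. This is what
makes size insensitive to Zariski closure. -/
theorem GrowthLE.of_ker_le {P : Type*} [CommRing P] [Algebra K P] (φ : P →ₐ[K] A)
    (ψ : P →ₐ[K] A') (hker : ∀ p, φ p = 0 → ψ p = 0) {e : ℕ} (h : GrowthLE φ.range e) :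
    GrowthLE ψ.range e := by
  intro G hG hGB
  rw [← Algebra.map_top] at hGB
  obtain ⟨G₀, hG₀, -, rfl⟩ := exists_fg_map_eq ψ hG hGB
  obtain ⟨C, hC⟩ := h (G₀.map φ.toLinearMap) (hG₀.map _) (by
    rintro _ ⟨x, -, rfl⟩
    exact ⟨x, rfl⟩)
  refine ⟨C, fun t => le_trans ?_ (hC t)⟩
  rw [← Submodule.map_pow, ← Submodule.map_pow]
  exact finrank_map_le_finrank_map _ _ (fun p hp => LinearMap.mem_ker.2 (hker p (LinearMap.mem_ker.1 hp))) (hG₀.pow t)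

open scoped Pointwise in
theorem exists_fg_le_mul {P Q G : Submodule K A} (hG : G.FG) (h : G ≤ P * Q) :
    ∃ P₁ Q₁ : Submodule K A, P₁.FG ∧ Q₁.FG ∧ P₁ ≤ P ∧ Q₁ ≤ Q ∧ G ≤ P₁ * Q₁ := by
  obtain ⟨s, rfl⟩ := hG
  have hs : ∀ x : s, ∃ T T' : Finset A, (T : Set A) ⊆ P ∧ (T' : Set A) ⊆ Q ∧
      (x : A) ∈ Submodule.span K ((T : Set A) * (T' : Set A)) := fun x =>
    Submodule.mem_span_mul_finite_of_mem_mul (h (Submodule.subset_span x.2))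
  choose T T' hT hT' hx using hs
  refine ⟨⨆ x, Submodule.span K (T x : Set A), ⨆ x, Submodule.span K (T' x : Set A),
    Submodule.fg_iSup _ fun x => Submodule.fg_span (T x).finite_toSet,
    Submodule.fg_iSup _ fun x => Submodule.fg_span (T' x).finite_toSet,
    iSup_le fun x => Submodule.span_le.2 (hT x), iSup_le fun x => Submodule.span_le.2 (hT' x), ?_⟩
  rw [Submodule.span_le]
  intro z hz
  have h1 := hx ⟨z, hz⟩
  rw [← Submodule.span_mul_span] at h1
  exact mul_le_mul' (le_iSup (fun x => Submodule.span K (T x : Set A)) ⟨z, hz⟩)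
    (le_iSup (fun x => Submodule.span K (T' x : Set A)) ⟨z, hz⟩) h1

theorem GrowthLE.sup {B₁ B₂ : Subalgebra K A} {e₁ e₂ : ℕ} (h₁ : GrowthLE B₁ e₁)
    (h₂ : GrowthLE B₂ e₂) : GrowthLE (B₁ ⊔ B₂) (e₁ + e₂) := by
  intro G hG hGB
  rw [← Subalgebra.mul_toSubmodule] at hGB
  obtain ⟨P, Q, hP, hQ, hPB, hQB, hGPQ⟩ := exists_fg_le_mul hG hGB
  obtain ⟨C₁, hC₁⟩ := h₁ P hP hPB
  obtain ⟨C₂, hC₂⟩ := h₂ Q hQ hQB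
  refine ⟨C₁ * C₂, fun t => ?_⟩
  calc finrank K (G ^ t : Submodule K A) ≤ finrank K (P ^ t * Q ^ t : Submodule K A) := by
        refine finrank_mono_of_fg ((hP.pow t).mul (hQ.pow t)) ?_
        rw [← mul_pow]
        exact pow_le_pow_left' hGPQ t
    _ ≤ finrank K (P ^ t : Submodule K A) * finrank K (Q ^ t : Submodule K A) :=
        finrank_mul_le (hP.pow t) (hQ.pow t)
    _ ≤ (C₁ * (t + 1) ^ e₁) * (C₂ * (t + 1) ^ e₂) := Nat.mul_le_mul (hC₁ t) (hC₂ t)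
    _ = C₁ * C₂ * (t + 1) ^ (e₁ + e₂) := by ring

theorem growthLE_bot : GrowthLE (⊥ : Subalgebra K A) 0 := by
  intro G hG hGB
  refine ⟨1, fun t => ?_⟩
  have h1 : G ^ t ≤ (1 : Submodule K A) := by
    calc G ^ t ≤ (1 : Submodule K A) ^ t := pow_le_pow_left' (by rwa [Algebra.toSubmodule_bot] at hGB) t
      _ = 1 := one_pow t
  have hfg : (1 : Submodule K A).FG := by
    rw [Submodule.one_eq_span]; exact Submodule.fg_span_singleton _
  refine (finrank_mono_of_fg hfg h1).trans ?_
  rw [Submodule.one_eq_span]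
  simpa using finrank_span_le_card ({1} : Set A) (R := K)

theorem growthLE_adjoin_singleton (x : A) : GrowthLE (Algebra.adjoin K {x}) 1 := by
  intro G hG hGB
  have key : ∀ y ∈ Algebra.adjoin K {x}, ∃ D : ℕ,
      y ∈ (Submodule.span K {1, x}) ^ D := by
    intro y hy
    induction hy using Algebra.adjoin_induction with
    | mem y hy =>
      rw [Set.mem_singleton_iff] at hy
      exact ⟨1, by rw [pow_one, hy]; exact Submodule.subset_span (by simp)⟩
    | algebraMap r => exact ⟨0, by rw [pow_zero]; exact Submodule.algebraMap_mem r⟩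
    | add y z _ _ hy hz =>
      obtain ⟨D, hD⟩ := hy
      obtain ⟨E, hE⟩ := hz
      have h1 : (1 : Submodule K A) ≤ Submodule.span K {1, x} :=
        Submodule.one_le.2 (Submodule.subset_span (by simp))
      exact ⟨max D E, add_mem (pow_le_pow_right' h1 (le_max_left D E) hD)
        (pow_le_pow_right' h1 (le_max_right D E) hE)⟩
    | mul y z _ _ hy hz =>
      obtain ⟨D, hD⟩ := hy
      obtain ⟨E, hE⟩ := hz
      exact ⟨D + E, by rw [pow_add]; exact Submodule.mul_mem_mul hD hE⟩
  have h1 : (1 : Submodule K A) ≤ Submodule.span K {1, x} :=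
    Submodule.one_le.2 (Submodule.subset_span (by simp))
  obtain ⟨s, rfl⟩ := hG
  have hs : ∀ y : s, ∃ D : ℕ, (y : A) ∈ (Submodule.span K {1, x}) ^ D := fun y =>
    key y (hGB (Submodule.subset_span y.2))
  choose D hD using hs
  have hle : Submodule.span K (s : Set A) ≤
      (Submodule.span K {1, x}) ^ (Finset.univ.sup D) := by
    rw [Submodule.span_le]
    intro y hy
    exact pow_le_pow_right' h1 (Finset.le_sup (f := D) (Finset.mem_univ ⟨y, hy⟩)) (hD ⟨y, hy⟩)
  set E := Finset.univ.sup D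
  have hpow : ∀ m : ℕ, (Submodule.span K {1, x}) ^ m ≤
      Submodule.span K (Set.range fun i : Fin (m + 1) => x ^ (i : ℕ)) := by
    intro m
    induction m with
    | zero =>
      rw [pow_zero, Submodule.one_le]
      exact Submodule.subset_span ⟨0, by simp⟩
    | succ m ih =>
      rw [pow_succ]
      refine (mul_le_mul_left ih _).trans ?_
      rw [Submodule.span_mul_span, Submodule.span_le]
      rintro _ ⟨_, ⟨i, rfl⟩, z, hz, rfl⟩
      rcases hz with rfl | rfl
      · exact Submodule.subset_span ⟨i.castSucc, by simp⟩
      · exact Submodule.subset_span ⟨i.succ, by simp [pow_succ]⟩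
  refine ⟨E + 1, fun t => ?_⟩
  calc finrank K ((Submodule.span K (s : Set A)) ^ t : Submodule K A)
      ≤ finrank K (Submodule.span K (Set.range fun i : Fin (E * t + 1) => x ^ (i : ℕ))) := by
        refine finrank_mono_of_fg (Submodule.fg_span (Set.finite_range _)) ?_
        refine (pow_le_pow_left' hle t).trans ?_
        rw [← pow_mul]
        exact hpow _
    _ ≤ E * t + 1 := by
        simpa [Set.finrank] using finrank_range_le_card (R := K) (fun i : Fin (E * t + 1) => x ^ (i : ℕ))
    _ ≤ (E + 1) * (t + 1) ^ 1 := by nlinarith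

/-- A finite-dimensional `G` in `B₁` generates a finite `B₀`-module, spanned by some
finite-dimensional `M`. Then `G * M ≤ P * M` with `P` finite-dimensional in `B₀`, and by iteration
`G ^ t ≤ P ^ (t + 1) * M`, so the exponent does not change. -/
theorem GrowthLE.of_isIntegral {B₀ B₁ : Subalgebra K A} {e : ℕ} (h : GrowthLE B₀ e)
    (hB : ∀ x ∈ B₁, IsIntegral B₀ x) : GrowthLE B₁ e := by
  intro G hG hGB
  obtain ⟨s, rfl⟩ := hG
  have hfin : (Subalgebra.toSubmodule (Algebra.adjoin B₀ (s : Set A))).FG :=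
    fg_adjoin_of_finite s.finite_toSet fun x hx => hB x (hGB (Submodule.subset_span hx))
  obtain ⟨m, hm⟩ := hfin
  set M : Submodule K A := Submodule.span K (m : Set A)
  have hMfg : M.FG := Submodule.fg_span m.finite_toSet
  have hprod : ∀ x ∈ Algebra.adjoin B₀ (s : Set A), x ∈ Subalgebra.toSubmodule B₀ * M := by
    intro x hx
    have hx' : x ∈ Submodule.span B₀ (m : Set A) := by rw [hm]; exact hx
    induction hx' using Submodule.span_induction with
    | mem y hy =>
      rw [← one_mul y]
      exact Submodule.mul_mem_mul (one_mem B₀) (Submodule.subset_span hy)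
    | zero => exact zero_mem _
    | add y z hy hz ihy ihz =>
      rw [hm] at hy hz
      exact add_mem (ihy hy) (ihz hz)
    | smul b y hy ih =>
      rw [hm] at hy
      have h1 := ih hy
      have h2 : (b : A) * y ∈ Subalgebra.toSubmodule B₀ * (Subalgebra.toSubmodule B₀ * M) :=
        Submodule.mul_mem_mul b.2 h1
      rw [← mul_assoc, (Subalgebra.isIdempotentElem_toSubmodule B₀).eq] at h2
      exact h2
  have hmA : ∀ y ∈ m, y ∈ Algebra.adjoin B₀ (s : Set A) := by
    intro y hy
    have : y ∈ Submodule.span B₀ (m : Set A) := Submodule.subset_span hy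
    rwa [hm] at this
  have hGM : 1 ⊔ Submodule.span K (s : Set A) * M ≤ Subalgebra.toSubmodule B₀ * M := by
    refine sup_le (Submodule.one_le.2 (hprod _ (one_mem _))) ?_
    rw [Submodule.span_mul_span, Submodule.span_le]
    rintro _ ⟨y, hy, z, hz, rfl⟩
    exact hprod _ (mul_mem (Algebra.subset_adjoin hy) (hmA z hz))
  have hfg : (1 ⊔ Submodule.span K (s : Set A) * M).FG := by
    refine Submodule.FG.sup ?_ ((Submodule.fg_span s.finite_toSet).mul hMfg)
    rw [Submodule.one_eq_span]; exact Submodule.fg_span_singleton _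
  obtain ⟨P, Q, hP, -, hPB, hQM, hle⟩ := exists_fg_le_mul hfg hGM
  replace hle := hle.trans (mul_le_mul_right hQM _)
  have h1 : (1 : Submodule K A) ≤ P * M := le_sup_left.trans hle
  have h2 : Submodule.span K (s : Set A) * M ≤ P * M := le_sup_right.trans hle
  have hpow : ∀ t : ℕ, (Submodule.span K (s : Set A)) ^ t ≤ P ^ (t + 1) * M := by
    intro t
    induction t with
    | zero => simpa using h1
    | succ t ih =>
      rw [pow_succ']
      refine (mul_le_mul_right ih _).trans ?_
      rw [mul_left_comm]
      refine (mul_le_mul_right h2 _).trans ?_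
      rw [← mul_assoc, ← pow_succ]
  obtain ⟨C, hC⟩ := h P hP hPB
  refine ⟨C * 2 ^ e * finrank K M, fun t => ?_⟩
  calc finrank K ((Submodule.span K (s : Set A)) ^ t : Submodule K A)
      ≤ finrank K (P ^ (t + 1) * M : Submodule K A) :=
        finrank_mono_of_fg ((hP.pow _).mul hMfg) (hpow t)
    _ ≤ finrank K (P ^ (t + 1) : Submodule K A) * finrank K M := finrank_mul_le (hP.pow _) hMfg
    _ ≤ (C * (t + 1 + 1) ^ e) * finrank K M := Nat.mul_le_mul_right _ (hC _)
    _ ≤ (C * (2 * (t + 1)) ^ e) * finrank K M := by gcongr; omega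
    _ = C * 2 ^ e * finrank K M * (t + 1) ^ e := by rw [mul_pow]; ring

/-- A common power `δ ^ E` clears the denominators of `G`, and multiplication by `δ ^ (E * t)`
embeds `G ^ t` into the `t`-th power of a subspace of `B`. -/
theorem GrowthLE.adjoin_inverse {B : Subalgebra K A} {e : ℕ} (h : GrowthLE B e) {δ δ' : A}
    (hδ : δ ∈ B) (hδ' : δ * δ' = 1) : GrowthLE (B ⊔ Algebra.adjoin K {δ'}) e := by
  intro G hG hGB
  have hunit : IsUnit δ := IsUnit.of_mul_eq_one _ hδ'
  have key : ∀ y ∈ B ⊔ Algebra.adjoin K {δ'}, ∃ D : ℕ, ∀ E, D ≤ E → δ ^ E * y ∈ B := by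
    have hsup : B ⊔ Algebra.adjoin K {δ'} = Algebra.adjoin K ((B : Set A) ∪ {δ'}) := by
      rw [Algebra.adjoin_union, Algebra.adjoin_eq]
    intro y hy
    rw [hsup] at hy
    induction hy using Algebra.adjoin_induction with
    | mem y hy =>
      rcases hy with hy | hy
      · exact ⟨0, fun E _ => mul_mem (pow_mem hδ E) hy⟩
      · rw [Set.mem_singleton_iff] at hy
        refine ⟨1, fun E hE => ?_⟩
        obtain ⟨k, rfl⟩ := Nat.exists_eq_add_of_le hE
        rw [hy, pow_add, pow_one, mul_right_comm, hδ', one_mul]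
        exact pow_mem hδ k
    | algebraMap r => exact ⟨0, fun E _ => mul_mem (pow_mem hδ E) (B.algebraMap_mem r)⟩
    | add y z _ _ hy hz =>
      obtain ⟨D, hD⟩ := hy
      obtain ⟨D', hD'⟩ := hz
      refine ⟨max D D', fun E hE => ?_⟩
      rw [mul_add]
      exact add_mem (hD E (le_of_max_le_left hE)) (hD' E (le_of_max_le_right hE))
    | mul y z _ _ hy hz =>
      obtain ⟨D, hD⟩ := hy
      obtain ⟨D', hD'⟩ := hz
      refine ⟨D + D', fun E hE => ?_⟩
      obtain ⟨k, rfl⟩ := Nat.exists_eq_add_of_le hE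
      have : δ ^ (D + D' + k) * (y * z) = δ ^ D * y * (δ ^ (D' + k) * z) := by ring
      rw [this]
      exact mul_mem (hD D le_rfl) (hD' _ (Nat.le_add_right _ _))
  obtain ⟨s, rfl⟩ := hG
  have hs : ∀ y : s, ∃ D : ℕ, ∀ E, D ≤ E → δ ^ E * (y : A) ∈ B := fun y =>
    key y (hGB (Submodule.subset_span y.2))
  choose D hD using hs
  set E := Finset.univ.sup D
  have hEs : ∀ y ∈ Submodule.span K (s : Set A), δ ^ E * y ∈ B := by
    intro y hy
    induction hy using Submodule.span_induction with
    | mem y hy => exact hD ⟨y, hy⟩ E (Finset.le_sup (f := D) (Finset.mem_univ _))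
    | zero => rw [mul_zero]; exact zero_mem _
    | add y z _ _ hy hz => rw [mul_add]; exact add_mem hy hz
    | smul c y _ hy => rw [mul_smul_comm]; exact B.smul_mem hy c
  have hGfg : (Submodule.span K (s : Set A)).FG := Submodule.fg_span s.finite_toSet
  set P := Submodule.span K {δ ^ E} * Submodule.span K (s : Set A)
  have hPfg : P.FG := (Submodule.fg_span_singleton _).mul hGfg
  have hPB : P ≤ Subalgebra.toSubmodule B := by
    refine Submodule.mul_le.2 fun a ha b hb => ?_
    obtain ⟨c, rfl⟩ := Submodule.mem_span_singleton.1 ha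
    rw [smul_mul_assoc]
    exact B.smul_mem (hEs b hb) c
  obtain ⟨C, hC⟩ := h P hPfg hPB
  refine ⟨C, fun t => le_trans ?_ (hC t)⟩
  have hinj : Function.Injective (LinearMap.mulLeft K (δ ^ (E * t))) := by
    intro a b hab
    exact (hunit.pow _).mul_left_cancel hab
  rw [(Submodule.equivMapOfInjective (LinearMap.mulLeft K (δ ^ (E * t))) hinj _).finrank_eq]
  refine finrank_mono_of_fg (hPfg.pow t) ?_
  rintro _ ⟨y, hy, rfl⟩
  rw [mul_pow]
  refine Submodule.mul_mem_mul ?_ hy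
  rw [pow_mul]
  exact Submodule.pow_mem_pow _ (Submodule.mem_span_singleton_self _) t

theorem GrowthLE.of_cover {ι : Type*} [Finite ι] {A' : ι → Type*} [∀ i, CommRing (A' i)]
    [∀ i, Algebra K (A' i)] (φ : ∀ i, A →ₐ[K] A' i) (hφ : ∀ a, (∀ i, φ i a = 0) → a = 0)
    {B : Subalgebra K A} {e : ℕ} (h : ∀ i, GrowthLE (B.map (φ i)) e) : GrowthLE B e := by
  cases nonempty_fintype ι
  intro G hG hGB
  have := fun i => h i (G.map (φ i).toLinearMap) (hG.map _) (by
    rintro _ ⟨x, hx, rfl⟩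
    exact ⟨x, hGB hx, rfl⟩)
  choose C hC using this
  refine ⟨∑ i, C i, fun t => ?_⟩
  have : FiniteDimensional K (G ^ t : Submodule K A) := Module.Finite.iff_fg.mpr (hG.pow t)
  have : ∀ i, FiniteDimensional K ((G ^ t).map (φ i).toLinearMap) := fun i =>
    Module.Finite.iff_fg.mpr ((hG.pow t).map _)
  let ψ : (G ^ t : Submodule K A) →ₗ[K] (∀ i, (G ^ t).map (φ i).toLinearMap) :=
    LinearMap.pi fun i => (φ i).toLinearMap.submoduleMap (G ^ t)
  have hψ : Function.Injective ψ := by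
    rw [← LinearMap.ker_eq_bot, LinearMap.ker_eq_bot']
    intro m hm
    apply Subtype.ext
    apply hφ
    intro i
    exact congrArg Subtype.val (congrFun hm i)
  calc finrank K (G ^ t : Submodule K A)
      ≤ finrank K (∀ i, (G ^ t).map (φ i).toLinearMap) := LinearMap.finrank_le_finrank_of_injective hψ
    _ = ∑ i, finrank K ((G ^ t).map (φ i).toLinearMap) := Module.finrank_pi_fintype K
    _ ≤ ∑ i, C i * (t + 1) ^ e := Finset.sum_le_sum fun i _ => by
        rw [Submodule.map_pow]; exact hC i t
    _ = (∑ i, C i) * (t + 1) ^ e := by rw [Finset.sum_mul]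

end Growth

/-! ### The size of a subset of a vector space -/

section CoordinateAlgebra

variable (K : Type*) [Field K] {V W : Type*} [AddCommGroup V] [Module K V] [AddCommGroup W]
  [Module K W] {X Y : Type*}

/-- The algebra of functions on `X` generated by the coordinates of the vector valued function
`v`. -/
def coordAlg (v : X → V) : Subalgebra K (X → K) :=
  Algebra.adjoin K (Set.range fun (ℓ : Dual K V) (x : X) => ℓ (v x))

/-- The Zariski closure of `S` has dimension at most `e`. -/
def SizeLE (S : Set V) (e : ℕ) : Prop := GrowthLE (coordAlg K (Subtype.val : S → V)) e

/-- Pulling functions back along a map. -/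
def pullback (f : X → Y) : (Y → K) →ₐ[K] (X → K) :=
  AlgHom.pi fun x => Pi.evalAlgHom K _ (f x)

variable {K}

@[simp] theorem pullback_apply (f : X → Y) (g : Y → K) (x : X) : pullback K f g x = g (f x) := rfl

theorem coordAlg_le_iff {v : X → V} {B : Subalgebra K (X → K)} :
    coordAlg K v ≤ B ↔ ∀ ℓ : Dual K V, (fun x => ℓ (v x)) ∈ B := by
  rw [coordAlg, Algebra.adjoin_le_iff, Set.range_subset_iff]
  rfl

theorem mem_coordAlg (v : X → V) (ℓ : Dual K V) : (fun x => ℓ (v x)) ∈ coordAlg K v :=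
  coordAlg_le_iff.1 le_rfl ℓ

theorem coordAlg_le_of_basis {ι : Type*} [Finite ι] (b : Basis ι K V) {v : X → V}
    {B : Subalgebra K (X → K)} (h : ∀ i, (fun x => b.coord i (v x)) ∈ B) : coordAlg K v ≤ B := by
  cases nonempty_fintype ι
  rw [coordAlg_le_iff]
  intro ℓ
  have : (fun x => ℓ (v x)) = ∑ i, ℓ (b i) • fun x => b.coord i (v x) := by
    ext x
    conv_lhs => rw [← b.sum_repr (v x)]
    simp only [map_sum, map_smul, smul_eq_mul, Finset.sum_apply, Pi.smul_apply, Basis.coord_apply]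
    exact Finset.sum_congr rfl fun i _ => mul_comm _ _
  rw [this]
  exact sum_mem fun i _ => B.smul_mem (h i) _

theorem coordAlg_comp (v : Y → V) (f : X → Y) :
    coordAlg K (fun x => v (f x)) = (coordAlg K v).map (pullback K f) := by
  rw [coordAlg, coordAlg, AlgHom.map_adjoin, ← Set.range_comp]
  rfl

theorem coordAlg_linear_le (v : X → V) (T : V →ₗ[K] W) :
    coordAlg K (fun x => T (v x)) ≤ coordAlg K v :=
  coordAlg_le_iff.2 fun ℓ => mem_coordAlg v (ℓ ∘ₗ T)

theorem growthLE_adjoin_finset {A : Type*} [CommRing A] [Algebra K A] (s : Finset A) :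
    GrowthLE (Algebra.adjoin K (s : Set A)) s.card := by
  classical
  induction s using Finset.induction_on with
  | empty => simpa using growthLE_bot
  | insert a s ha ih =>
    rw [Finset.card_insert_of_notMem ha, Finset.coe_insert, Set.insert_eq, Algebra.adjoin_union,
      add_comm]
    exact (growthLE_adjoin_singleton a).sup ih

theorem growthLE_coordAlg [FiniteDimensional K V] (v : X → V) :
    GrowthLE (coordAlg K v) (finrank K V) := by
  classical
  let b := finBasis K V
  have h := growthLE_adjoin_finset (K := K)
    (Finset.univ.image fun (i : Fin (finrank K V)) (x : X) => b.coord i (v x))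
  refine (h.mono ?_).mono_right (Finset.card_image_le.trans (by simp))
  exact coordAlg_le_of_basis b fun i => Algebra.subset_adjoin (by simp)

/-- Any set-theoretic section will do: pulling functions back along an arbitrary map is an algebra
homomorphism. -/
theorem SizeLE.of_subset_range {S : Set V} {v : X → V} {e : ℕ} (h : GrowthLE (coordAlg K v) e)
    (hS : S ⊆ Set.range v) : SizeLE K S e := by
  choose σ hσ using fun s : S => hS s.2
  have : coordAlg K (Subtype.val : S → V) = (coordAlg K v).map (pullback K σ) := by
    rw [← coordAlg_comp]
    simp [hσ]
  rw [SizeLE, this]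
  exact h.map _

theorem SizeLE.mono {S T : Set V} {e : ℕ} (h : SizeLE K T e) (hST : S ⊆ T) : SizeLE K S e :=
  SizeLE.of_subset_range h (by simpa using hST)

theorem SizeLE.of_le_growth {S : Set V} {e : ℕ} {v : X → V} {B : Subalgebra K (X → K)}
    (h : GrowthLE B e) (hv : ∀ ℓ : Dual K V, (fun x => ℓ (v x)) ∈ B) (hS : S ⊆ Set.range v) :
    SizeLE K S e :=
  SizeLE.of_subset_range (h.mono (coordAlg_le_iff.2 hv)) hS

theorem SizeLE.iUnion {ι : Type*} [Finite ι] {S : ι → Set V} {e : ℕ}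
    (h : ∀ i, SizeLE K (S i) e) : SizeLE K (⋃ i, S i) e := by
  refine GrowthLE.of_cover
    (fun i => pullback K (Set.inclusion (Set.subset_iUnion S i))) (fun a ha => ?_) fun i => ?_
  · ext ⟨x, hx⟩
    obtain ⟨i, hi⟩ := Set.mem_iUnion.1 hx
    exact congrFun (ha i) ⟨x, hi⟩
  · rw [← coordAlg_comp]
    exact h i

theorem SizeLE.union {S T : Set V} {e : ℕ} (hS : SizeLE K S e) (hT : SizeLE K T e) :
    SizeLE K (S ∪ T) e := by
  rw [Set.union_eq_iUnion]
  exact SizeLE.iUnion (by rintro (_ | _); exacts [hT, hS])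

theorem sizeLE_submodule [FiniteDimensional K V] (U : Submodule K V) :
    SizeLE K (U : Set V) (finrank K U) := by
  refine SizeLE.of_subset_range (X := U) (v := fun u => U.subtype u)
    ((growthLE_coordAlg (fun u : U => u)).mono ?_) (by simp)
  exact coordAlg_linear_le (fun u : U => u) U.subtype

theorem SizeLE.mono_right {S : Set V} {e e' : ℕ} (h : SizeLE K S e) (he : e ≤ e') :
    SizeLE K S e' := GrowthLE.mono_right h he

theorem coordAlg_isNoetherianRing [FiniteDimensional K V] (v : X → V) :
    IsNoetherianRing (coordAlg K v) := by
  classical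
  let b := finBasis K V
  have : coordAlg K v =
      Algebra.adjoin K (Set.range fun (i : Fin (finrank K V)) (x : X) => b.coord i (v x)) := by
    apply le_antisymm
    · exact coordAlg_le_of_basis b fun i => Algebra.subset_adjoin ⟨i, rfl⟩
    · rw [Algebra.adjoin_le_iff]
      rintro _ ⟨i, rfl⟩
      exact mem_coordAlg v (b.coord i)
  rw [this]
  exact isNoetherianRing_of_fg (Subalgebra.fg_def.2 ⟨_, Set.finite_range _, rfl⟩)

/-- The size of a set is a local notion. -/
theorem sizeLE_of_local [FiniteDimensional K V] {S : Set V} {e : ℕ}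
    (h : ∀ s ∈ S, ∃ δ ∈ coordAlg K (id : V → V), δ s ≠ 0 ∧ SizeLE K (S ∩ {x | δ x ≠ 0}) e) :
    SizeLE K S e := by
  classical
  choose δ hδ hne hsize using fun s : S => h s s.2
  have := coordAlg_isNoetherianRing (K := K) (id : V → V)
  let g : S → coordAlg K (id : V → V) := fun s => ⟨δ s, hδ s⟩
  -- Finitely many of the `δ s` generate the ideal of all of them. At a point of `S` where these
  -- vanish, its own `δ s` would vanish too, so they already cover `S`.
  obtain ⟨t, htsub, ht⟩ := (Submodule.fg_span_iff_fg_span_finset_subset (R := coordAlg K (id : V → V)) (Set.range g)).1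
    (IsNoetherian.noetherian _)
  have hcov : S ⊆ ⋃ a : {a : S // g a ∈ t}, S ∩ {x | δ a x ≠ 0} := by
    intro s hs
    by_contra hcon
    simp only [Set.mem_iUnion, not_exists, Set.mem_inter_iff, hs, true_and, Set.mem_ofPred_eq,
      not_not] at hcon
    have hle : Ideal.span (Set.range g) ≤
        RingHom.ker ((Pi.evalAlgHom K (fun _ : V => K) s).comp (coordAlg K (id : V → V)).val) := by
      change Submodule.span _ _ ≤ _
      rw [ht]
      refine Ideal.span_le.2 fun y hy => ?_
      obtain ⟨a, rfl⟩ := htsub hy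
      exact hcon ⟨a, hy⟩
    exact hne ⟨s, hs⟩ (hle (Ideal.subset_span ⟨⟨s, hs⟩, rfl⟩))
  have hfin : Finite {y // y ∈ t} := inferInstance
  let pick : {y // y ∈ t} → S := fun y => (htsub y.2).choose
  have hpick : ∀ y : {y // y ∈ t}, g (pick y) = y := fun y => (htsub y.2).choose_spec
  refine (SizeLE.iUnion (S := fun y : {y // y ∈ t} => S ∩ {x | δ (pick y) x ≠ 0})
    fun y => hsize _).mono (hcov.trans ?_)
  refine Set.iUnion_subset fun a => ?_
  refine Set.Subset.trans ?_ (Set.subset_iUnion _ ⟨g a.1, a.2⟩)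
  have h1 : δ (pick ⟨g a.1, a.2⟩) = δ a := congrArg Subtype.val (hpick ⟨g a.1, a.2⟩)
  rw [h1]

/-- Restricting polynomials along a vector valued function. -/
def valueHom (v : X → V) : PolyOn K V →ₐ[K] (X → K) :=
  MvPolynomial.aeval fun (φ : Dual K V) (x : X) => φ (v x)

theorem valueHom_apply (v : X → V) (q : PolyOn K V) (x : X) : valueHom v q x = q.value (v x) := by
  have : (Pi.evalAlgHom K (fun _ : X => K) x).comp (valueHom v) =
      MvPolynomial.aeval fun φ : Dual K V => φ (v x) := by
    ext φ
    simp [valueHom]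
  exact DFunLike.congr_fun this q

theorem coordAlg_eq_range (v : X → V) : coordAlg K v = (valueHom v).range :=
  Algebra.adjoin_range_eq_range_aeval K _

theorem SizeLE.of_vanishing {C C' : Set V} {e : ℕ} (h : SizeLE K C e)
    (hC : ∀ q : PolyOn K V, (∀ v ∈ C, q.value v = 0) → ∀ v ∈ C', q.value v = 0) :
    SizeLE K C' e := by
  rw [SizeLE, coordAlg_eq_range] at h ⊢
  refine h.of_ker_le _ _ fun p hp => ?_
  ext ⟨x, hx⟩
  rw [valueHom_apply]
  exact hC p (fun v hv => by rw [← valueHom_apply (Subtype.val : C → V) p ⟨v, hv⟩, hp]; rfl) x hx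

/-- Over an infinite field monomials are independent functions, so the polynomial functions on a
space of dimension `s` have growth at least of degree `s`. -/
theorem finrank_le_of_sizeLE_univ [Infinite K] [FiniteDimensional K V] {e : ℕ}
    (h : SizeLE K (Set.univ : Set V) e) : finrank K V ≤ e := by
  classical
  have h' : GrowthLE (coordAlg K (id : V → V)) e := by
    have : coordAlg K (id : V → V) = (coordAlg K (Subtype.val : ↥(Set.univ : Set V) → V)).map
        (pullback K fun v : V => (⟨v, trivial⟩ : ↥(Set.univ : Set V))) := by
      rw [← coordAlg_comp]; rfl
    rw [this]
    exact GrowthLE.map h _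
  by_contra hlt
  push Not at hlt
  set s := finrank K V
  let b : Basis (Fin s) K V := finBasis K V
  let x : Fin s → V → K := fun i v => b.coord i v
  let Φ : MvPolynomial (Fin s) K →ₐ[K] (V → K) := MvPolynomial.aeval x
  have hΦ : ∀ q v, Φ q v = MvPolynomial.eval (fun i => b.coord i v) q := by
    intro q v
    have : (Pi.evalAlgHom K (fun _ : V => K) v).comp Φ =
        MvPolynomial.aeval fun i => b.coord i v := by
      ext i
      simp [Φ, x]
    exact DFunLike.congr_fun this q
  have hinj : Function.Injective Φ := by
    rw [injective_iff_map_eq_zero]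
    intro q hq
    refine MvPolynomial.funext fun z => ?_
    have h1 := congrFun hq (b.equivFun.symm z)
    rw [hΦ] at h1
    have h2 : (fun i => b.coord i (b.equivFun.symm z)) = z := by
      ext i
      rw [Basis.coord_apply, ← b.equivFun_apply, LinearEquiv.apply_symm_apply]
    rw [h2] at h1
    rw [h1, map_zero]
    rfl
  let G : Submodule K (V → K) := Submodule.span K (insert 1 (Set.range x))
  have hG : G.FG := Submodule.fg_span ((Set.finite_range x).insert 1)
  have hGB : G ≤ Subalgebra.toSubmodule (coordAlg K (id : V → V)) := by
    rw [Submodule.span_le]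
    rintro _ (rfl | ⟨i, rfl⟩)
    · exact one_mem (coordAlg K (id : V → V))
    · exact mem_coordAlg id (b.coord i)
  have h1G : (1 : Submodule K (V → K)) ≤ G := Submodule.one_le.2 (Submodule.subset_span (by simp))
  obtain ⟨C, hC⟩ := h' G hG hGB
  have hlow : ∀ t : ℕ, (t + 1) ^ s ≤ finrank K (G ^ (s * t) : Submodule K (V → K)) := by
    intro t
    let m : (Fin s → Fin (t + 1)) → (V → K) := fun α =>
      Φ (MvPolynomial.monomial (Finsupp.equivFunOnFinite.symm fun i => (α i : ℕ)) 1)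
    have hm : ∀ α, m α ∈ G ^ (s * t) := by
      intro α
      have h2 : m α = ∏ i, x i ^ (α i : ℕ) := by
        simp only [m, Φ, MvPolynomial.aeval_monomial, map_one, one_mul]
        rw [Finsupp.prod_fintype _ _ (fun i => pow_zero _)]
        rfl
      have h3 : ∀ T : Finset (Fin s), ∏ i ∈ T, x i ^ (α i : ℕ) ∈ (G ^ t) ^ T.card := by
        intro T
        induction T using Finset.induction_on with
        | empty => simp
        | insert a T ha ih =>
          rw [Finset.prod_insert ha, Finset.card_insert_of_notMem ha, pow_succ']
          refine Submodule.mul_mem_mul (pow_le_pow_right' h1G (Nat.lt_succ_iff.1 (α a).2) ?_) ih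
          exact Submodule.pow_mem_pow _
            (Submodule.subset_span (Set.mem_insert_of_mem _ (Set.mem_range_self a))) _
      rw [h2, mul_comm s t, pow_mul]
      simpa using h3 Finset.univ
    have hli : LinearIndependent K m := by
      have h3 := (MvPolynomial.basisMonomials (Fin s) K).linearIndependent
      have h4 : LinearIndependent K fun α : Fin s → Fin (t + 1) =>
          MvPolynomial.basisMonomials (Fin s) K
            (Finsupp.equivFunOnFinite.symm fun i => (α i : ℕ)) := by
        refine h3.comp _ fun α β hαβ => ?_
        have h5 := Finsupp.equivFunOnFinite.symm.injective hαβ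
        ext i
        exact congrFun h5 i
      have h5 := h4.map' Φ.toLinearMap (LinearMap.ker_eq_bot.2 hinj)
      exact h5
    have : FiniteDimensional K (G ^ (s * t) : Submodule K (V → K)) :=
      Module.Finite.iff_fg.mpr (hG.pow _)
    have h6 : LinearIndependent K fun α : Fin s → Fin (t + 1) => (⟨m α, hm α⟩ : ↥(G ^ (s * t))) :=
      LinearIndependent.of_comp (Submodule.subtype _) (by exact hli)
    have h7 := h6.fintype_card_le_finrank
    simpa using h7
  -- At `t = D` the two growth estimates give `(D + 1) ^ (e + 1) ≤ D * (D + 1) ^ e`, which is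
  -- absurd.
  set D := C * (s + 1) ^ e
  have h1 := (hlow D).trans (hC (s * D))
  have h2 : (s * D + 1) ^ e ≤ ((s + 1) * (D + 1)) ^ e := Nat.pow_le_pow_left (by nlinarith) e
  have h3 : (D + 1) ^ (e + 1) ≤ (D + 1) ^ s := Nat.pow_le_pow_right (Nat.succ_pos _) hlt
  have h4 : (D + 1) ^ (e + 1) ≤ D * (D + 1) ^ e :=
    calc (D + 1) ^ (e + 1) ≤ C * ((s + 1) * (D + 1)) ^ e :=
          h3.trans (h1.trans (Nat.mul_le_mul_left C h2))
      _ = D * (D + 1) ^ e := by rw [mul_pow, ← mul_assoc]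
  rw [pow_succ'] at h4
  have h5 : D + 1 ≤ D := Nat.le_of_mul_le_mul_right h4 (by positivity)
  omega

end CoordinateAlgebra

open MvPolynomial

/-! ### Cones over projective sets, and codimension -/

section Cones

theorem _root_.MvPolynomial.IsHomogeneous.eval_const_smul {R σ : Type*} [CommSemiring R]
    {q : MvPolynomial σ R} {k : ℕ} (hq : q.IsHomogeneous k) (c : R) (x : σ → R) :
    eval (c • x) q = c ^ k * eval x q := by
  rw [eval_eq, eval_eq, Finset.mul_sum]
  refine Finset.sum_congr rfl fun m hm => ?_
  have hdeg : ∑ i ∈ m.support, m i = k := hq.degree_eq_sum_deg_support hm |>.symm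
  simp only [Pi.smul_apply, smul_eq_mul, mul_pow, Finset.prod_mul_distrib, Finset.prod_pow_eq_pow_sum,
    hdeg]
  ring

variable {K : Type*} [Field K] {V : Type*} [AddCommGroup V] [Module K V]

theorem value_smul {q : PolyOn K V} {k : ℕ} (hq : q.IsHomogeneous k) (c : K) (v : V) :
    q.value (c • v) = c ^ k * q.value v := by
  rw [PolyOn.value, PolyOn.value, ← hq.eval_const_smul]
  exact congrArg (fun f => eval f q) (funext fun φ => map_smul φ c v)

theorem value_rep_mk {q : PolyOn K V} {k : ℕ} (hq : q.IsHomogeneous k) {v : V} (hv : v ≠ 0) :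
    q.value (Projectivization.mk K v hv).rep = 0 ↔ q.value v = 0 := by
  obtain ⟨a, ha⟩ := Projectivization.exists_smul_eq_mk_rep K v hv
  rw [← ha, Units.smul_def, value_smul hq]
  simp

/-- The nonzero vectors on the lines belonging to `Z`. -/
def cone (Z : Set (ℙ K V)) : Set V := {v | ∃ h : v ≠ 0, Projectivization.mk K v h ∈ Z}

theorem rep_mem_cone {Z : Set (ℙ K V)} {x : ℙ K V} : x.rep ∈ cone Z ↔ x ∈ Z := by
  constructor
  · rintro ⟨h, hx⟩
    rwa [Projectivization.mk_rep] at hx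
  · intro hx
    exact ⟨x.rep_nonzero, by rwa [Projectivization.mk_rep]⟩

theorem smul_mem_cone {Z : Set (ℙ K V)} {v : V} (hv : v ∈ cone Z) {c : K} (hc : c ≠ 0) :
    c • v ∈ cone Z := by
  obtain ⟨h, hx⟩ := hv
  refine ⟨smul_ne_zero hc h, ?_⟩
  rwa [(Projectivization.mk_eq_mk_iff' K _ _ (smul_ne_zero hc h) h).2 ⟨c, rfl⟩]

theorem isClosed_iff_zeroLocus {Z : Set (ℙ K V)} : IsClosed Z ↔
    ∃ T : Set (PolyOn K V), (∀ q ∈ T, ∃ k : ℕ, q.IsHomogeneous k) ∧ Z = zeroLocus T := by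
  rw [← isOpen_compl_iff]
  change Zᶜᶜ ∈ zariskiClosedSets K V ↔ _
  rw [compl_compl]
  rfl

theorem mem_cone_zeroLocus {T : Set (PolyOn K V)} (hT : ∀ q ∈ T, ∃ k : ℕ, q.IsHomogeneous k)
    {v : V} : v ∈ cone (zeroLocus T) ↔ v ≠ 0 ∧ ∀ q ∈ T, q.value v = 0 := by
  constructor
  · rintro ⟨h, hv⟩
    refine ⟨h, fun q hq => ?_⟩
    obtain ⟨k, hk⟩ := hT q hq
    exact (value_rep_mk hk h).1 (hv q hq)
  · rintro ⟨h, hv⟩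
    refine ⟨h, fun q hq => ?_⟩
    obtain ⟨k, hk⟩ := hT q hq
    exact (value_rep_mk hk h).2 (hv q hq)

theorem mem_closure_iff_value {Z : Set (ℙ K V)} {x : ℙ K V} : x ∈ closure Z ↔
    ∀ q : PolyOn K V, (∃ k : ℕ, q.IsHomogeneous k) → (∀ v ∈ cone Z, q.value v = 0) →
      q.value x.rep = 0 := by
  constructor
  · intro hx q hq hZ
    have hcl : IsClosed (zeroLocus {q}) :=
      isClosed_iff_zeroLocus.2 ⟨{q}, by rintro _ rfl; exact hq, rfl⟩
    have hsub : Z ⊆ zeroLocus {q} := by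
      rintro y hy _ rfl
      exact hZ _ (rep_mem_cone.2 hy)
    exact closure_minimal hsub hcl hx q rfl
  · intro h
    obtain ⟨T, hT, hcl⟩ := isClosed_iff_zeroLocus.1 (isClosed_closure (s := Z))
    rw [hcl]
    intro q hq
    refine h q (hT q hq) fun v hv => ?_
    have h1 : v ∈ cone (closure Z) := ⟨hv.1, subset_closure hv.2⟩
    rw [hcl] at h1
    exact ((mem_cone_zeroLocus hT).1 h1).2 q hq

/-- The ideal of polynomials vanishing on `C`. -/
def vanishingOn (C : Set V) : Ideal (PolyOn K V) where
  carrier := {q | ∀ v ∈ C, q.value v = 0}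
  add_mem' := by
    intro a b ha hb v hv
    have h1 := ha v hv
    have h2 := hb v hv
    simp only [PolyOn.value] at h1 h2 ⊢
    rw [map_add, h1, h2, add_zero]
  zero_mem' := fun v _ => map_zero _
  smul_mem' := by
    intro c a ha v hv
    have h1 := ha v hv
    simp only [PolyOn.value] at h1 ⊢
    rw [smul_eq_mul, map_mul, h1, mul_zero]

theorem mem_vanishingOn {C : Set V} {q : PolyOn K V} :
    q ∈ vanishingOn C ↔ ∀ v ∈ C, q.value v = 0 := Iff.rfl

/-- The restriction of a polynomial to an affine line is a polynomial in one variable. -/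
theorem exists_polynomial_on_line (q : PolyOn K V) (v w : V) :
    ∃ p : Polynomial K, ∀ t, p.eval t = q.value (v + t • w) := by
  refine ⟨aeval (fun φ : Dual K V => Polynomial.C (φ v) + Polynomial.C (φ w) * Polynomial.X) q,
    fun t => ?_⟩
  have : (Polynomial.aeval t).comp
      (aeval fun φ : Dual K V => Polynomial.C (φ v) + Polynomial.C (φ w) * Polynomial.X) =
      aeval (R := K) fun φ : Dual K V => φ (v + t • w) := by
    refine algHom_ext fun φ => ?_
    rw [AlgHom.comp_apply, aeval_X, aeval_X, Polynomial.coe_aeval_eq_eval]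
    simp only [Polynomial.eval_add, Polynomial.eval_mul, Polynomial.eval_C, Polynomial.eval_X,
      map_add, map_smul, smul_eq_mul, mul_comm]
  have h := DFunLike.congr_fun this q
  rw [AlgHom.comp_apply, Polynomial.coe_aeval_eq_eval] at h
  rw [h]
  rfl

/-- As a polynomial in `c`, `q (c x)` has the values of the components at `x` as coefficients, and
it has infinitely many roots. -/
theorem eval_homogeneousComponent_eq_zero [Infinite K] {σ : Type*} {q : MvPolynomial σ K} {x : σ → K}
    (h : ∀ c : K, c ≠ 0 → eval (c • x) q = 0) (k : ℕ) :
    eval x (homogeneousComponent k q) = 0 := by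
  let p : Polynomial K := ∑ i ∈ Finset.range (q.totalDegree + 1),
    Polynomial.monomial i (eval x (homogeneousComponent i q))
  have hp : ∀ c, p.eval c = eval (c • x) q := by
    intro c
    conv_rhs => rw [← sum_homogeneousComponent q]
    rw [map_sum, Polynomial.eval_finsetSum]
    refine Finset.sum_congr rfl fun i _ => ?_
    rw [Polynomial.eval_monomial, mul_comm]
    exact ((homogeneousComponent_isHomogeneous i q).eval_const_smul c x).symm
  have hp0 : p = 0 := by
    refine Polynomial.eq_zero_of_infinite_isRoot p ((Set.Infinite.mono ?_)
      (Set.Finite.infinite_compl (Set.finite_singleton (0 : K))))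
    intro c hc
    exact (hp c).trans (h c hc)
  by_cases hk : k < q.totalDegree + 1
  · have h1 := congrArg (fun r => Polynomial.coeff r k) hp0
    simpa [p, Polynomial.finsetSum_coeff, Polynomial.coeff_monomial, hk] using h1
  · rw [homogeneousComponent_eq_zero k q (by omega)]
    exact map_zero _

theorem homogeneousComponent_value_eq_zero [Infinite K] {q : PolyOn K V} {v : V}
    (h : ∀ c : K, c ≠ 0 → q.value (c • v) = 0) (k : ℕ) :
    PolyOn.value (homogeneousComponent k q) v = 0 := by
  refine eval_homogeneousComponent_eq_zero (fun c hc => ?_) k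
  refine (congrArg (fun f => eval f q) (funext fun φ => ?_)).trans (h c hc)
  exact (map_smul φ c v).symm

attribute [local instance] MvPolynomial.gradedAlgebra

theorem vanishingOn_isHomogeneous [Infinite K] {C : Set V} (hC : ∀ v ∈ C, ∀ c : K, c ≠ 0 → c • v ∈ C) :
    (vanishingOn (K := K) C).IsHomogeneous (homogeneousSubmodule (Dual K V) K) := by
  intro i q hq
  have : ((DirectSum.decompose (homogeneousSubmodule (Dual K V) K) q i :
      homogeneousSubmodule (Dual K V) K i) : PolyOn K V) = homogeneousComponent i q :=
    decomposition.decompose'_apply q i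
  rw [this]
  exact fun v hv => homogeneousComponent_value_eq_zero (fun c hc => hq _ (hC v hv c hc)) i

theorem SizeLE.of_homogeneous_vanishing [Infinite K] {C C' : Set V} {e : ℕ} (h : SizeLE K C e)
    (hC : ∀ v ∈ C, ∀ c : K, c ≠ 0 → c • v ∈ C)
    (hCC' : ∀ q : PolyOn K V, (∃ k : ℕ, q.IsHomogeneous k) → (∀ v ∈ C, q.value v = 0) →
      ∀ v ∈ C', q.value v = 0) : SizeLE K C' e := by
  refine h.of_vanishing fun q hq v hv => ?_
  rw [PolyOn.value, ← sum_homogeneousComponent q, map_sum]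
  refine Finset.sum_eq_zero fun i _ => ?_
  refine hCC' _ ⟨i, homogeneousComponent_isHomogeneous i q⟩ (fun w hw => ?_) v hv
  exact homogeneousComponent_value_eq_zero (fun c hc => hq _ (hC w hw c hc)) i

theorem SizeLE.cone_closure [Infinite K] {Z : Set (ℙ K V)} {e : ℕ} (h : SizeLE K (cone Z) e) :
    SizeLE K (cone (closure Z)) e := by
  refine h.of_homogeneous_vanishing (fun v hv c hc => smul_mem_cone hv hc) ?_
  rintro q ⟨k, hk⟩ hq v ⟨hv, hvZ⟩
  exact (value_rep_mk hk hv).1 (mem_closure_iff_value.1 hvZ q ⟨k, hk⟩ hq)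

/-- The ideal of a cone is homogeneous, so primality may be tested on homogeneous elements, whose
zero loci are closed sets to which irreducibility applies. -/
theorem vanishingOn_isPrime [Infinite K] {Z : Set (ℙ K V)} (hZ : IsIrreducible Z) :
    (vanishingOn (K := K) (cone Z)).IsPrime := by
  refine (vanishingOn_isHomogeneous fun v hv c hc =>
    smul_mem_cone hv hc).isPrime_of_homogeneous_mem_or_mem ?_ ?_
  · obtain ⟨x, hx⟩ := hZ.nonempty
    intro htop
    have h1 : (1 : PolyOn K V) ∈ vanishingOn (K := K) (cone Z) := by rw [htop]; trivial
    have h2 := h1 x.rep (rep_mem_cone.2 hx)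
    simp [PolyOn.value] at h2
  · rintro a b ⟨k, hk⟩ ⟨l, hl⟩ hab
    have hcl : ∀ q : PolyOn K V, (∃ k : ℕ, q.IsHomogeneous k) → IsClosed (zeroLocus {q}) :=
      fun q hq => isClosed_iff_zeroLocus.2 ⟨{q}, by rintro _ rfl; exact hq, rfl⟩
    have hsub : Z ⊆ zeroLocus {a} ∪ zeroLocus {b} := by
      intro x hx
      have h1 := hab x.rep (rep_mem_cone.2 hx)
      rw [PolyOn.value, map_mul, mul_eq_zero] at h1
      rcases h1 with h1 | h1
      · left; rintro _ rfl; exact h1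
      · right; rintro _ rfl; exact h1
    rcases isPreirreducible_iff_isClosed_union_isClosed.1 hZ.2 _ _ (hcl a ⟨k, hk⟩)
      (hcl b ⟨l, hl⟩) hsub with h1 | h1
    · left
      rintro v ⟨hv, hvZ⟩
      exact (value_rep_mk hk hv).1 (h1 hvZ a rfl)
    · right
      rintro v ⟨hv, hvZ⟩
      exact (value_rep_mk hl hv).1 (h1 hvZ b rfl)

/-- The projective closed set cut out by the homogeneous polynomials vanishing on `C`. -/
def projClosure (C : Set V) : Set (ℙ K V) :=
  zeroLocus {q | (∃ k : ℕ, q.IsHomogeneous k) ∧ q ∈ vanishingOn (K := K) C}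

theorem isClosed_projClosure (C : Set V) : IsClosed (projClosure (K := K) C) :=
  isClosed_iff_zeroLocus.2 ⟨_, fun _ hq => hq.1, rfl⟩

theorem mk_mem_projClosure {C : Set V} {v : V} (hv : v ∈ C) (h0 : v ≠ 0) :
    Projectivization.mk K v h0 ∈ projClosure (K := K) C := by
  rintro q ⟨⟨k, hk⟩, hq⟩
  exact (value_rep_mk hk h0).2 (hq v hv)

theorem isPreirreducible_projClosure {C : Set V} (hC : (vanishingOn (K := K) C).IsPrime)
    (hC0 : ∀ v ∈ C, v ≠ 0) :
    IsPreirreducible (projClosure (K := K) C) := by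
  have key : ∀ T : Set (PolyOn K V), (∀ q ∈ T, ∃ k : ℕ, q.IsHomogeneous k) →
      ¬ projClosure (K := K) C ⊆ zeroLocus T → ∃ q ∈ T, q ∉ vanishingOn (K := K) C := by
    intro T hT hsub
    by_contra! hcon
    exact hsub fun x hx q hq => hx q ⟨hT q hq, hcon q hq⟩
  rw [isPreirreducible_iff_isClosed_union_isClosed]
  intro Z₁ Z₂ h₁ h₂ hsub
  obtain ⟨T₁, hT₁, rfl⟩ := isClosed_iff_zeroLocus.1 h₁
  obtain ⟨T₂, hT₂, rfl⟩ := isClosed_iff_zeroLocus.1 h₂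
  by_contra! hcon
  obtain ⟨a, ha, haC⟩ := key T₁ hT₁ hcon.1
  obtain ⟨b, hb, hbC⟩ := key T₂ hT₂ hcon.2
  have hab : a * b ∈ vanishingOn (K := K) C := by
    intro v hv
    have h0 := hC0 v hv
    rw [PolyOn.value, map_mul]
    rcases hsub (mk_mem_projClosure hv h0) with h | h
    · obtain ⟨k, hk⟩ := hT₁ a ha
      exact mul_eq_zero_of_left ((value_rep_mk hk h0).1 (h a ha)) _
    · obtain ⟨k, hk⟩ := hT₂ b hb
      exact mul_eq_zero_of_right _ ((value_rep_mk hk h0).1 (h b hb))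
  rcases hC.mem_or_mem hab with h | h
  · exact haC h
  · exact hbC h

/-- The cone spanned by `C` and the vector `w`. -/
def joinVec (C : Set V) (w : V) : Set V := {v | ∃ z ∈ C, ∃ s : K, v = z + s • w}

/-- The join is the union of the translates `C + s w`, each with prime ideal. A polynomial not
vanishing on the join vanishes on only finitely many translates, so two of them share a translate on
which neither vanishes. -/
theorem vanishingOn_joinVec_isPrime [Infinite K] {C : Set V} (hC : (vanishingOn (K := K) C).IsPrime)
    (w : V) : (vanishingOn (K := K) (joinVec (K := K) C w)).IsPrime := by
  have key : ∀ q : PolyOn K V, q ∉ vanishingOn (K := K) (joinVec (K := K) C w) →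
      {s : K | ∀ z ∈ C, q.value (z + s • w) = 0}.Finite := by
    intro q hq
    simp only [mem_vanishingOn, not_forall] at hq
    obtain ⟨_, ⟨z, hz, s, rfl⟩, hne⟩ := hq
    obtain ⟨p, hp⟩ := exists_polynomial_on_line q z w
    have hp0 : p ≠ 0 := by
      rintro rfl
      exact hne (by rw [← hp, Polynomial.eval_zero])
    refine (Polynomial.finite_setOfPred_isRoot hp0).subset fun t ht => ?_
    exact (hp t).trans (ht z hz)
  have shift : ∀ (q : PolyOn K V) (s : K), ∃ q' : PolyOn K V, ∀ z, q'.value z = q.value (z + s • w) := by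
    intro q s
    refine ⟨aeval (fun φ : Dual K V => X φ + MvPolynomial.C (φ (s • w))) q, fun z => ?_⟩
    have : (aeval fun φ : Dual K V => φ z).comp
        (aeval fun φ : Dual K V => (X φ + MvPolynomial.C (φ (s • w)) : PolyOn K V)) =
        aeval (R := K) fun φ : Dual K V => φ (z + s • w) := by
      refine algHom_ext fun φ => ?_
      rw [AlgHom.comp_apply, aeval_X, aeval_X, map_add, aeval_X, map_add]
      simp
    exact DFunLike.congr_fun this q
  refine Ideal.IsPrime.mk ?_ ?_
  · intro htop
    refine hC.ne_top ((Ideal.eq_top_iff_one _).2 fun v hv => ?_)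
    have h1 : (1 : PolyOn K V) ∈ vanishingOn (K := K) (joinVec (K := K) C w) := by
      rw [htop]; trivial
    exact h1 v ⟨v, hv, 0, by simp⟩
  · intro a b hab
    by_contra! hcon
    obtain ⟨s, hs⟩ := ((key a hcon.1).union (key b hcon.2)).exists_notMem
    simp only [Set.mem_union, Set.mem_ofPred_eq, not_or] at hs
    obtain ⟨a', ha'⟩ := shift a s
    obtain ⟨b', hb'⟩ := shift b s
    have hmem : a' * b' ∈ vanishingOn (K := K) C := by
      intro z hz
      have h1 := hab _ ⟨z, hz, s, rfl⟩
      rw [PolyOn.value, map_mul] at h1 ⊢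
      have h2 := ha' z
      have h3 := hb' z
      rw [PolyOn.value] at h2 h3
      rw [h2, h3]
      exact h1
    rcases hC.mem_or_mem hmem with h | h
    · exact hs.1 fun z hz => (ha' z).symm.trans (h z hz)
    · exact hs.2 fun z hz => (hb' z).symm.trans (h z hz)

theorem SizeLE.joinVec {C : Set V} {e : ℕ} (h : SizeLE K C e) (w : V) :
    SizeLE K (joinVec (K := K) C w) (e + 1) := by
  let B : Subalgebra K (C × K → K) := (coordAlg K (Subtype.val : C → V)).map (pullback K Prod.fst) ⊔
    Algebra.adjoin K {fun x => x.2}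
  have hB : GrowthLE B (e + 1) := (GrowthLE.map h _).sup (growthLE_adjoin_singleton _)
  refine SizeLE.of_le_growth hB (v := fun x : C × K => (x.1 : V) + x.2 • w) (fun ℓ => ?_) ?_
  · have h1 : (fun x : C × K => ℓ ((x.1 : V) + x.2 • w)) =
        pullback K Prod.fst (fun z : C => ℓ z) + ℓ w • fun x : C × K => x.2 := by
      ext x
      simp [mul_comm]
    rw [h1]
    refine add_mem (le_sup_left (a := (coordAlg K (Subtype.val : C → V)).map (pullback K Prod.fst))
      ⟨_, mem_coordAlg _ ℓ, rfl⟩) (Subalgebra.smul_mem _ ?_ _)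
    exact le_sup_right (a := (coordAlg K (Subtype.val : C → V)).map (pullback K Prod.fst))
      (Algebra.self_mem_adjoin_singleton K _)
  · rintro _ ⟨z, hz, s, rfl⟩
    exact ⟨(⟨z, hz⟩, s), rfl⟩

theorem finrank_le_of_sizeLE_cone_univ [Infinite K] [FiniteDimensional K V] {e : ℕ}
    (h : SizeLE K (cone (Set.univ : Set (ℙ K V))) e) : finrank K V ≤ e := by
  rcases subsingleton_or_nontrivial V with hV | hV
  · rw [finrank_zero_of_subsingleton]
    exact Nat.zero_le _
  refine finrank_le_of_sizeLE_univ (h.of_vanishing fun q hq v _ => ?_)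
  by_cases hv : v = 0
  · obtain ⟨w, hw⟩ := exists_ne (0 : V)
    obtain ⟨p, hp⟩ := exists_polynomial_on_line q v w
    have hp0 : p = 0 := by
      refine Polynomial.eq_zero_of_infinite_isRoot p ((Set.Infinite.mono ?_)
        (Set.Finite.infinite_compl (Set.finite_singleton (0 : K))))
      intro c hc
      refine (hp c).trans (hq _ ?_)
      rw [hv, zero_add]
      exact ⟨smul_ne_zero hc hw, trivial⟩
    have h1 := hp 0
    rwa [hp0, Polynomial.eval_zero, zero_smul, add_zero, eq_comm] at h1
  · exact hq v ⟨hv, trivial⟩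

/-- As long as the size is below the dimension of `V`, `Z` misses a point `p`. The join of `Z` with
`p` is irreducible, strictly larger and of size at most `e + 1`, which is one step of a chain. -/
theorem le_coheight_of_sizeLE [Infinite K] [FiniteDimensional K V] (c : ℕ) :
    ∀ (e : ℕ) (Z : TopologicalSpace.IrreducibleCloseds (ℙ K V)),
      SizeLE K (cone (Z : Set (ℙ K V))) e → e + c ≤ finrank K V → (c : ℕ∞) ≤ Order.coheight Z := by
  induction c with
  | zero => intro e Z _ _; simp
  | succ c ih =>
    intro e Z hZ hec
    have hne : (Z : Set (ℙ K V)) ≠ Set.univ := by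
      intro huniv
      rw [huniv] at hZ
      have := finrank_le_of_sizeLE_cone_univ hZ
      omega
    obtain ⟨p, hp⟩ := (Set.ne_univ_iff_exists_notMem _).1 hne
    set C := joinVec (K := K) (cone (Z : Set (ℙ K V))) p.rep with hCdef
    have hprime : (vanishingOn (K := K) C).IsPrime :=
      vanishingOn_joinVec_isPrime (vanishingOn_isPrime Z.isIrreducible') _
    have hC0 : ∀ v ∈ C, v ≠ 0 := by
      rintro _ ⟨z, hz, s, rfl⟩ h0
      have hs : s ≠ 0 := by
        rintro rfl
        rw [zero_smul, add_zero] at h0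
        exact hz.1 h0
      apply hp
      rw [← rep_mem_cone]
      have h1 : p.rep = (-s⁻¹) • z := by
        rw [eq_neg_of_add_eq_zero_left h0, smul_neg, neg_smul, neg_neg, smul_smul,
          inv_mul_cancel₀ hs, one_smul]
      rw [h1]
      exact smul_mem_cone hz (neg_ne_zero.2 (inv_ne_zero hs))
    have hZC : (Z : Set (ℙ K V)) ⊆ projClosure (K := K) C := by
      intro x hx
      have h1 : x.rep ∈ C := ⟨x.rep, rep_mem_cone.2 hx, 0, by simp⟩
      have h2 := mk_mem_projClosure (K := K) h1 x.rep_nonzero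
      rwa [Projectivization.mk_rep] at h2
    -- The vector `p.rep` need not be in `C`, as `cone` omits zero. It is reached as the value at `c
    -- = 0` of `p + c x` with `x` in `Z`.
    have hpC : p ∈ projClosure (K := K) C := by
      rintro q ⟨⟨k, hk⟩, hq⟩
      obtain ⟨x, hx⟩ := Z.isIrreducible'.nonempty
      obtain ⟨r, hr⟩ := exists_polynomial_on_line q p.rep x.rep
      have hr0 : r = 0 := by
        refine Polynomial.eq_zero_of_infinite_isRoot r ((Set.Infinite.mono ?_)
          (Set.Finite.infinite_compl (Set.finite_singleton (0 : K))))
        intro c hc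
        refine (hr c).trans (hq _ ⟨c • x.rep, smul_mem_cone (rep_mem_cone.2 hx) hc, 1, ?_⟩)
        rw [one_smul, add_comm]
      have h1 := hr 0
      rwa [hr0, Polynomial.eval_zero, zero_smul, add_zero, eq_comm] at h1
    let Z' : TopologicalSpace.IrreducibleCloseds (ℙ K V) :=
      ⟨projClosure (K := K) C, ⟨⟨p, hpC⟩, isPreirreducible_projClosure hprime hC0⟩,
        isClosed_projClosure C⟩
    have hlt : Z < Z' := by
      refine lt_of_le_of_ne hZC fun h => hp ?_
      rw [h]
      exact hpC
    have hsize : SizeLE K (cone (Z' : Set (ℙ K V))) (e + 1) := by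
      refine (SizeLE.joinVec hZ p.rep).of_homogeneous_vanishing ?_ ?_
      · rintro _ ⟨z, hz, s, rfl⟩ c hc
        exact ⟨c • z, smul_mem_cone hz hc, c * s, by rw [smul_add, smul_smul]⟩
      · rintro q ⟨k, hk⟩ hq v ⟨hv, hvZ⟩
        exact (value_rep_mk hk hv).1 (hvZ q ⟨⟨k, hk⟩, hq⟩)
    have h1 := ih (e + 1) Z' hsize (by omega)
    calc ((c + 1 : ℕ) : ℕ∞) = (c : ℕ∞) + 1 := by push_cast; rfl
      _ ≤ Order.coheight Z' + 1 := by gcongr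
      _ ≤ Order.coheight Z := Order.coheight_add_one_le hlt

theorem le_codim_of_sizeLE [Infinite K] [FiniteDimensional K V] {S : Set (ℙ K V)} {e c : ℕ}
    (h : SizeLE K (cone S) e) (hec : e + c ≤ finrank K V) : (c : ℕ∞) ≤ codim (closure S) := by
  refine le_iInf fun Z => le_iInf fun hZ => le_coheight_of_sizeLE c e Z ?_ hec
  exact h.cone_closure.mono fun v hv => ⟨hv.1, hZ hv.2⟩

end Cones

/-! ### Integrality from the Nullstellensatz -/

section Integrality

/-- The finite module spanned by the monomials of degree below `D` is stable under multiplication by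
each `x i`, hence it is all of `B[x]`. -/
theorem isIntegral_of_prod_mem_span {B A : Type*} [CommRing B] [CommRing A] [Algebra B A]
    {σ : Type*} [Finite σ] (x : σ → A) (D : ℕ)
    (h : ∀ α : σ →₀ ℕ, α.degree = D → (α.prod fun i k => x i ^ k) ∈
      Submodule.span B {y | ∃ β : σ →₀ ℕ, β.degree < D ∧ y = β.prod fun i k => x i ^ k})
    (a : σ) : IsIntegral B (x a) := by
  classical
  set N := Submodule.span B {y | ∃ β : σ →₀ ℕ, β.degree < D ∧ y = β.prod fun i k => x i ^ k}
  have hfin : N.FG := by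
    have hf : {β : σ →₀ ℕ | β.degree < D}.Finite := by
      cases nonempty_fintype σ
      refine (Finset.finite_toSet ((Finset.range D).biUnion fun m =>
        Finset.finsuppAntidiag Finset.univ m)).subset fun β hβ => ?_
      simp only [Finset.coe_biUnion, Set.mem_iUnion, Finset.mem_coe, Finset.mem_finsuppAntidiag]
      refine ⟨β.degree, Finset.mem_range.2 hβ, ?_, Finset.subset_univ _⟩
      exact (Finsupp.degree_eq_sum β).symm
    refine Submodule.fg_span ((hf.image fun β => β.prod fun i k => x i ^ k).subset ?_)
    rintro _ ⟨β, hβ, rfl⟩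
    exact ⟨β, hβ, rfl⟩
  have hmem : ∀ β : σ →₀ ℕ, β.degree ≤ D → (β.prod fun i k => x i ^ k) ∈ N := by
    intro β hβ
    rcases hβ.lt_or_eq with hlt | heq
    · exact Submodule.subset_span ⟨β, hlt, rfl⟩
    · exact h β heq
  have hmul : ∀ s ∈ Algebra.adjoin B (Set.range x), ∀ n ∈ N, s * n ∈ N := by
    intro s hs
    induction hs using Algebra.adjoin_induction with
    | mem y hy =>
      obtain ⟨i, rfl⟩ := hy
      intro n hn
      induction hn using Submodule.span_induction with
      | mem n hn =>
        obtain ⟨β, hβ, rfl⟩ := hn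
        have : x i * (β.prod fun i k => x i ^ k) =
            (Finsupp.single i 1 + β).prod fun i k => x i ^ k := by
          rw [Finsupp.prod_add_index' (by simp) (by intros; rw [pow_add]),
            Finsupp.prod_single_index (by simp), pow_one]
        rw [this]
        refine hmem _ ?_
        rw [map_add, Finsupp.degree_single]
        omega
      | zero => rw [mul_zero]; exact zero_mem _
      | add n m _ _ h1 h2 => rw [mul_add]; exact add_mem h1 h2
      | smul b n _ h1 => rw [mul_smul_comm]; exact N.smul_mem b h1
    | algebraMap b =>
      intro n hn
      rw [← Algebra.smul_def]
      exact N.smul_mem b hn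
    | add s t _ _ h1 h2 => intro n hn; rw [add_mul]; exact add_mem (h1 n hn) (h2 n hn)
    | mul s t _ _ h1 h2 => intro n hn; rw [mul_assoc]; exact h1 _ (h2 n hn)
  have h1 : (1 : A) ∈ N := by
    have := hmem 0 (by simp)
    simpa using this
  have hN : Subalgebra.toSubmodule (Algebra.adjoin B (Set.range x)) = N := by
    apply le_antisymm
    · intro s hs
      rw [← mul_one s]
      exact hmul s hs 1 h1
    · rw [Submodule.span_le]
      rintro _ ⟨β, -, rfl⟩
      exact Subalgebra.prod_mem _ fun i _ =>
        Subalgebra.pow_mem _ (Algebra.subset_adjoin (Set.mem_range_self i)) _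
  exact IsIntegral.of_mem_of_fg (Algebra.adjoin B (Set.range x)) (hN ▸ hfin) _
    (Algebra.subset_adjoin ⟨a, rfl⟩)

attribute [local instance] MvPolynomial.gradedAlgebra

theorem homogeneousComponent_mul_of_isHomogeneous {R σ : Type*} [CommRing R]
    {p : MvPolynomial σ R} {d : ℕ} (hp : p.IsHomogeneous d) (q : MvPolynomial σ R) (D : ℕ) :
    homogeneousComponent D (p * q) = if d ≤ D then p * homogeneousComponent (D - d) q else 0 := by
  have hdec : ∀ (r : MvPolynomial σ R) (i : ℕ),
      ((DirectSum.decompose (homogeneousSubmodule σ R) r i : homogeneousSubmodule σ R i) :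
        MvPolynomial σ R) = homogeneousComponent i r :=
    fun r i => decomposition.decompose'_apply r i
  rw [← hdec, ← hdec]
  split_ifs with h
  · exact DirectSum.coe_decompose_mul_of_left_mem_of_le (homogeneousSubmodule σ R) hp h
  · exact DirectSum.coe_decompose_mul_of_left_mem_of_not_le (homogeneousSubmodule σ R) hp h

variable {K : Type*} [Field K] [IsAlgClosed K]

/-- A homogeneous form of the Nullstellensatz: forms without a nontrivial common zero generate all
monomials of large degree. -/
theorem exists_monomial_combination {σ ι : Type*} [Finite σ] [Fintype ι]
    (f : ι → MvPolynomial σ K) (d : ι → ℕ) (hf : ∀ l, (f l).IsHomogeneous (d l))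
    (J : Ideal (MvPolynomial σ K)) (hJ : ∀ q ∈ J, ∀ k, homogeneousComponent k q ∈ J)
    (hzero : ∀ x : σ → K, (∀ l, eval x (f l) = 0) → (∀ q ∈ J, eval x q = 0) → x = 0) :
    ∃ D₀ : ℕ, ∀ D, D₀ ≤ D → ∀ α : σ →₀ ℕ, α.degree = D →
      ∃ g : ι → MvPolynomial σ K, (∀ l, (g l).IsHomogeneous (D - d l)) ∧
        (∀ l, D < d l → g l = 0) ∧ monomial α 1 - ∑ l, f l * g l ∈ J := by
  classical
  set I := J ⊔ Ideal.span (Set.range f)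
  -- The only common zero is the origin, so by the Nullstellensatz a power of the ideal of the
  -- variables lies in `I`. Taking degree `D` components then makes the coefficients homogeneous.
  have hrad : idealOfVars σ K ≤ I.radical := by
    rw [← vanishingIdeal_zeroLocus_eq_radical (K := K) I, idealOfVars, Ideal.span_le]
    rintro _ ⟨i, rfl⟩
    rw [SetLike.mem_coe, mem_vanishingIdeal_iff]
    intro x hx
    have hx' : ∀ q ∈ I, eval x q = 0 := fun q hq => by
      have := (mem_zeroLocus_iff.1 hx) q hq
      simpa [aeval_eq_eval] using this
    have h0 : x = 0 := hzero x
      (fun l => hx' _ (Ideal.mem_sup_right (Ideal.subset_span ⟨l, rfl⟩)))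
      fun q hq => hx' q (Ideal.mem_sup_left hq)
    simp [h0]
  obtain ⟨D₀, hD₀⟩ := Ideal.exists_pow_le_of_le_radical_of_fg hrad (idealOfVars_fg σ K)
  refine ⟨D₀, fun D hD α hα => ?_⟩
  have hmem : monomial α (1 : K) ∈ I := by
    refine hD₀ (Ideal.pow_le_pow_right hD ?_)
    rw [← hα]
    exact monomial_mem_pow_idealOfVars_iff _ _ one_ne_zero |>.2 le_rfl
  obtain ⟨q, hq, r, hr, hqr⟩ := Submodule.mem_sup.1 hmem
  obtain ⟨c, hc⟩ := (Submodule.mem_span_range_iff_exists_fun _).1 hr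
  -- For `D < d l` the truncated difference would pick out the constant term of `c l`, which does
  -- not contribute in degree `D`.
  refine ⟨fun l => if d l ≤ D then homogeneousComponent (D - d l) (c l) else 0, fun l => ?_,
    fun l hl => if_neg (not_le.2 hl), ?_⟩
  · dsimp only
    split_ifs
    · exact homogeneousComponent_isHomogeneous _ _
    · exact isHomogeneous_zero _ _ _
  · have h1 := congrArg (homogeneousComponent D) hqr
    rw [map_add, homogeneousComponent_eq_self (isHomogeneous_monomial (1 : K) hα), ← hc, map_sum]
      at h1
    have h2 : ∀ l, homogeneousComponent D (c l • f l) =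
        f l * if d l ≤ D then homogeneousComponent (D - d l) (c l) else 0 := by
      intro l
      rw [smul_eq_mul, mul_comm, homogeneousComponent_mul_of_isHomogeneous (hf l), mul_ite, mul_zero]
    rw [Finset.sum_congr rfl fun l _ => h2 l] at h1
    rw [← h1, add_sub_cancel_right]
    exact hJ q hq D

end Integrality

/-! ### Krull dimension of a closed set via a finite linear projection -/

section KrullDimension

variable {K : Type*} [Field K] [IsAlgClosed K] {U : Type*} [AddCommGroup U] [Module K U]

/-- The ideal of functions in the coordinate algebra of a cone vanishing at the points of `Z`. -/
def coneIdeal (Y Z : Set (ℙ K U)) : Ideal (coordAlg K (Subtype.val : cone Y → U)) where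
  carrier := {a | ∀ u : cone Y, (u : U) ∈ cone Z → a.1 u = 0}
  add_mem' := by
    intro a b ha hb u hu
    change a.1 u + b.1 u = 0
    rw [ha u hu, hb u hu, add_zero]
  zero_mem' := fun _ _ => rfl
  smul_mem' := by
    intro c a ha u hu
    change c.1 u * a.1 u = 0
    rw [ha u hu, mul_zero]

omit [IsAlgClosed K] in
theorem exists_polyOn_eq {Y : Set (ℙ K U)} (a : coordAlg K (Subtype.val : cone Y → U)) :
    ∃ q : PolyOn K U, ∀ u : cone Y, a.1 u = q.value (u : U) := by
  have h : a.1 ∈ (valueHom (K := K) (Subtype.val : cone Y → U)).range := by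
    rw [← coordAlg_eq_range]; exact a.2
  obtain ⟨q, hq⟩ := h
  exact ⟨q, fun u => by rw [← hq]; exact valueHom_apply _ q u⟩

theorem coneIdeal_isPrime {Y Z : Set (ℙ K U)} (hZY : Z ⊆ Y) (hZ : IsIrreducible Z) :
    (coneIdeal Y Z).IsPrime := by
  have hp := vanishingOn_isPrime hZ
  have hmem : ∀ (a : coordAlg K (Subtype.val : cone Y → U)) (q : PolyOn K U),
      (∀ u : cone Y, a.1 u = q.value (u : U)) →
        (a ∈ coneIdeal Y Z ↔ q ∈ vanishingOn (K := K) (cone Z)) := by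
    intro a q hq
    constructor
    · intro ha u hu
      have h1 := ha ⟨u, hu.1, hZY hu.2⟩ hu
      rwa [hq] at h1
    · intro ha u hu
      rw [hq]
      exact ha u hu
  refine Ideal.IsPrime.mk ?_ ?_
  · intro htop
    apply hp.ne_top
    rw [Ideal.eq_top_iff_one]
    refine (hmem 1 1 fun u => ?_).1 (by rw [htop]; trivial)
    simp [PolyOn.value]
  · intro a b hab
    obtain ⟨q, hq⟩ := exists_polyOn_eq a
    obtain ⟨r, hr⟩ := exists_polyOn_eq b
    rw [hmem a q hq, hmem b r hr]
    refine hp.mem_or_mem ((hmem (a * b) (q * r) fun u => ?_).1 hab)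
    change a.1 u * b.1 u = _
    rw [hq, hr, PolyOn.value, PolyOn.value, PolyOn.value, map_mul]

/-- The linear form `u ↦ π u j` as a function on a cone. -/
def coneCoord (Y : Set (ℙ K U)) {k : ℕ} (π : U →ₗ[K] (Fin k → K)) (j : Fin k) :
    coordAlg K (Subtype.val : cone Y → U) :=
  ⟨fun u => π u j, mem_coordAlg (K := K) (Subtype.val : cone Y → U) (LinearMap.proj j ∘ₗ π)⟩

/-- Projecting a closed cone from a linear subspace that meets it only in zero is a finite map. -/
theorem coneCoord_isIntegral [FiniteDimensional K U] {Y : Set (ℙ K U)} (hY : IsClosed Y) {k : ℕ}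
    (π : U →ₗ[K] (Fin k → K)) (hπ : ∀ u ∈ cone Y, π u ≠ 0) :
    (aeval (R := K) (coneCoord Y π)).toRingHom.IsIntegral := by
  classical
  let B := MvPolynomial (Fin k) K
  let A := coordAlg K (Subtype.val : cone Y → U)
  let φ : B →ₐ[K] A := aeval (coneCoord Y π)
  let : Algebra B A := φ.toRingHom.toAlgebra
  have : IsScalarTower K B A := IsScalarTower.of_algebraMap_eq fun c => (φ.commutes c).symm
  let b := finBasis K U
  let x : Fin (finrank K U) → A := fun i => ⟨fun u => b.coord i u, mem_coordAlg _ (b.coord i)⟩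
  let E : MvPolynomial (Fin (finrank K U)) K →ₐ[K] A := aeval x
  have hE : ∀ q (u : cone Y), (E q).1 u = eval (b.equivFun u) q := by
    intro q u
    have : ((Pi.evalAlgHom K (fun _ : cone Y => K) u).comp A.val).comp E =
        aeval (b.equivFun u) := by
      refine algHom_ext fun i => ?_
      simp [E, x]
    exact DFunLike.congr_fun this q
  let lin : Fin k → MvPolynomial (Fin (finrank K U)) K := fun j => ∑ i, C (π (b i) j) * X i
  have hlin : ∀ j z, eval z (lin j) = π (b.equivFun.symm z) j := by
    intro j z
    simp only [lin, map_sum, map_mul, eval_C, eval_X, Basis.equivFun_symm_apply, map_smul,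
      Finset.sum_apply, Pi.smul_apply, smul_eq_mul]
    exact Finset.sum_congr rfl fun i _ => mul_comm _ _
  let J := vanishingIdeal K (b.equivFun '' cone Y)
  have hJ : ∀ q, q ∈ J ↔ ∀ u ∈ cone Y, eval (b.equivFun u) q = 0 := by
    intro q
    rw [mem_vanishingIdeal_iff]
    simp [aeval_eq_eval]
  -- The coordinates of `π` and the equations of `Y` have only the origin in common; closedness of
  -- `Y` ensures that the zeros of its equations are in the cone.
  obtain ⟨D₀, hD₀⟩ := exists_monomial_combination lin (fun _ => 1)
    (fun j => IsHomogeneous.sum _ _ _ fun i _ => isHomogeneous_C_mul_X _ _) J (by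
      intro q hq k
      rw [hJ] at hq ⊢
      intro u hu
      refine eval_homogeneousComponent_eq_zero (fun c hc => ?_) k
      rw [← map_smul]
      exact hq _ (smul_mem_cone hu hc)) (by
      intro z hz hzJ
      by_contra hne
      set u := b.equivFun.symm z with hu
      have hu0 : u ≠ 0 := fun h => hne (b.equivFun.symm.map_eq_zero_iff.1 h)
      have huY : u ∈ cone Y := by
        refine ⟨hu0, ?_⟩
        rw [← hY.closure_eq, mem_closure_iff_value]
        rintro q ⟨m, hm⟩ hq
        rw [value_rep_mk hm]
        let η : PolyOn K U →ₐ[K] MvPolynomial (Fin (finrank K U)) K :=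
          aeval fun φ => ∑ i, C (φ (b i)) * X i
        have hη : ∀ q w, eval (b.equivFun w) (η q) = q.value w := by
          intro q w
          have : (aeval (b.equivFun w)).comp η = aeval (R := K) fun φ : Dual K U => φ w := by
            refine algHom_ext fun φ => ?_
            rw [AlgHom.comp_apply, aeval_X, aeval_X]
            conv_rhs => rw [← b.sum_equivFun w]
            simp only [map_sum, map_mul, aeval_X, aeval_C, map_smul, smul_eq_mul,
              Algebra.algebraMap_self, RingHom.id_apply]
            exact Finset.sum_congr rfl fun i _ => mul_comm _ _
          exact DFunLike.congr_fun this q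
        rw [← hη, hu, LinearEquiv.apply_symm_apply]
        refine hzJ _ ((hJ _).2 fun w hw => ?_)
        rw [hη]
        exact hq w hw
      refine hπ u huY (funext fun j => ?_)
      rw [hu, ← hlin]
      exact hz j)
  have hx : ∀ i, IsIntegral B (x i) := by
    -- The linear forms of `π` act as the scalars `X j` of `B`, and their cofactors have degree
    -- `D₀`, one less than the monomial.
    refine isIntegral_of_prod_mem_span x (D₀ + 1) fun α hα => ?_
    obtain ⟨g, hg, -, hgJ⟩ := hD₀ (D₀ + 1) (Nat.le_succ _) α hα
    have h1 : E (monomial α 1) = ∑ j, (X j : B) • E (g j) := by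
      rw [hJ] at hgJ
      apply Subtype.ext
      funext u
      have h2 := hgJ u u.2
      rw [map_sub, sub_eq_zero] at h2
      rw [hE, h2, map_sum, AddSubmonoidClass.coe_finsetSum, Finset.sum_apply]
      refine Finset.sum_congr rfl fun j _ => ?_
      rw [map_mul, hlin, LinearEquiv.symm_apply_apply, ← hE (g j)]
      have h3 : (X j : B) • E (g j) = coneCoord Y π j * E (g j) := by
        rw [Algebra.smul_def]
        congr 1
        exact aeval_X _ j
      rw [h3]
      rfl
    have h2 : E (monomial α 1) = α.prod fun i k => x i ^ k := by
      simp [E, aeval_monomial]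
    rw [← h2, h1]
    refine Submodule.sum_mem _ fun j _ => Submodule.smul_mem _ _ ?_
    rw [← support_sum_monomial_coeff (g j), map_sum]
    refine Submodule.sum_mem _ fun β hβ => ?_
    have h3 : E (monomial β (coeff β (g j))) =
        (C (coeff β (g j)) : B) • β.prod fun i k => x i ^ k := by
      simp only [E, aeval_monomial]
      rw [Algebra.smul_def]
      congr 1
      exact (φ.commutes _).symm
    rw [h3]
    refine Submodule.smul_mem _ _ (Submodule.subset_span ⟨β, ?_, rfl⟩)
    have h4 := (hg j).degree_eq_sum_deg_support hβ
    change β.degree < D₀ + 1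
    have h5 : β.degree = D₀ + 1 - 1 := h4.symm
    omega
  intro z
  have htop : (⊤ : Subalgebra K A) ≤ (integralClosure B A).restrictScalars K := by
    refine (Algebra.adjoin_adjoin_coe_preimage (R := K) (s := Set.range fun (ℓ : Dual K U)
      (u : cone Y) => ℓ (u : U))).symm.le.trans (Algebra.adjoin_le_iff.2 ?_)
    rintro y ⟨ℓ, hℓ⟩
    have h1 : y = ∑ i, algebraMap K A (ℓ (b i)) * x i := by
      apply Subtype.ext
      rw [← hℓ]
      funext u
      rw [AddSubmonoidClass.coe_finsetSum, Finset.sum_apply]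
      change ℓ (u : U) = _
      conv_lhs => rw [← b.sum_equivFun (u : U)]
      rw [map_sum]
      refine Finset.sum_congr rfl fun i _ => ?_
      rw [map_smul, smul_eq_mul, mul_comm]
      rfl
    rw [h1]
    refine IsIntegral.sum _ fun i _ => IsIntegral.mul ?_ (hx i)
    rw [IsScalarTower.algebraMap_apply K B A]
    exact isIntegral_algebraMap
  exact htop (Algebra.mem_top (x := z))

/-- Irreducible closed subsets of `Y` give homogeneous primes of its cone. Contraction along the
integral map from the polynomial ring in `k` variables preserves strict inclusions. -/
theorem topologicalKrullDim_add_one_le [FiniteDimensional K U] {Y : Set (ℙ K U)} (hY : IsClosed Y)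
    {k : ℕ} (π : U →ₗ[K] (Fin k → K)) (hπ : ∀ u ∈ cone Y, π u ≠ 0) :
    topologicalKrullDim Y + 1 ≤ k := by
  classical
  let A := coordAlg K (Subtype.val : cone Y → U)
  let B := MvPolynomial (Fin k) K
  let φ : B →ₐ[K] A := aeval (coneCoord Y π)
  let : Algebra B A := φ.toRingHom.toAlgebra
  have : Algebra.IsIntegral B A := ⟨fun z => coneCoord_isIntegral hY π hπ z⟩
  let img : TopologicalSpace.IrreducibleCloseds Y → Set (ℙ K U) := fun W => Subtype.val '' (W : Set Y)
  have himg : ∀ W, IsIrreducible (img W) := fun W =>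
    W.isIrreducible'.image _ continuous_subtype_val.continuousOn
  have hsub : ∀ W, img W ⊆ Y := by
    rintro W _ ⟨y, -, rfl⟩
    exact y.2
  have hlt : ∀ W W' : TopologicalSpace.IrreducibleCloseds Y, W < W' →
      coneIdeal Y (img W') < coneIdeal Y (img W) := by
    intro W W' h
    have hle : (W : Set Y) ⊆ W' := h.le
    refine lt_of_le_not_ge ?_ ?_
    · rintro a ha u ⟨hu, w, hw, hwu⟩
      exact ha u ⟨hu, w, hle hw, hwu⟩
    · intro hcon
      refine h.not_ge ?_
      obtain ⟨Z, hZ, hZW⟩ := isClosed_induced_iff.1 W.isClosed'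
      obtain ⟨T, hT, rfl⟩ := isClosed_iff_zeroLocus.1 hZ
      intro y hy
      change y ∈ W.carrier
      rw [← hZW]
      intro q hq
      let a : A := ⟨valueHom (Subtype.val : cone Y → U) q, by
        change _ ∈ coordAlg K (Subtype.val : cone Y → U)
        rw [coordAlg_eq_range]; exact ⟨q, rfl⟩⟩
      have ha : a ∈ coneIdeal Y (img W) := by
        rintro u ⟨hu, w, hw, hwu⟩
        change valueHom (Subtype.val : cone Y → U) q u = 0
        rw [valueHom_apply]
        obtain ⟨m, hm⟩ := hT q hq
        rw [← value_rep_mk hm hu, ← hwu]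
        have hw' : w ∈ Subtype.val ⁻¹' zeroLocus T := by rw [hZW]; exact hw
        exact hw' q hq
      have h1 := hcon ha ⟨(y : ℙ K U).rep, rep_mem_cone.2 y.2⟩ (rep_mem_cone.2 ⟨y, hy, rfl⟩)
      change valueHom (Subtype.val : cone Y → U) q _ = 0 at h1
      rwa [valueHom_apply] at h1
  rcases isEmpty_or_nonempty (TopologicalSpace.IrreducibleCloseds Y) with hemp | hne
  · rw [topologicalKrullDim, Order.krullDim_eq_bot]
    exact bot_le
  let P : TopologicalSpace.IrreducibleCloseds Y → PrimeSpectrum A := fun W =>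
    ⟨coneIdeal Y (img W), coneIdeal_isPrime (hsub W) (himg W)⟩
  let Q : PrimeSpectrum A → PrimeSpectrum B := PrimeSpectrum.comap (algebraMap B A)
  have hQ : StrictMono Q := by
    intro p p' hp
    exact Ideal.IsIntegral.comap_lt_comap (R := B) (A := A) hp
  -- The ideal of the origin lies strictly above all primes coming from `Y`; this extra step, the
  -- `⊤` in `F`, is the `+ 1`.
  let M : PrimeSpectrum B := ⟨RingHom.ker (constantCoeff (σ := Fin k) (R := K)), RingHom.ker_isPrime _⟩
  have hPM : ∀ W, Q (P W) < M := by
    intro W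
    obtain ⟨y, hy⟩ := (himg W).nonempty
    have hyc : y.rep ∈ cone Y := rep_mem_cone.2 (hsub W hy)
    have hval : ∀ q : B, ∀ u : cone Y, (φ q).1 u = eval (π (u : U)) q := by
      intro q u
      have : ((Pi.evalAlgHom K (fun _ : cone Y => K) u).comp A.val).comp φ =
          aeval (π (u : U)) := by
        refine algHom_ext fun i => ?_
        simp [φ, coneCoord]
      exact DFunLike.congr_fun this q
    refine lt_of_le_not_ge ?_ ?_
    · intro q hq
      change constantCoeff q = 0
      have h1 : ∀ c : K, c ≠ 0 → eval (c • π y.rep) q = 0 := by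
        intro c hc
        have h2 := hq ⟨c • y.rep, smul_mem_cone hyc hc⟩ (smul_mem_cone (rep_mem_cone.2 hy) hc)
        have h3 := hval q ⟨c • y.rep, smul_mem_cone hyc hc⟩
        rw [map_smul] at h3
        rw [← h3]
        exact h2
      have h2 := eval_homogeneousComponent_eq_zero h1 0
      rwa [homogeneousComponent_zero, eval_C] at h2
    · intro hle
      refine hπ _ hyc (funext fun j => ?_)
      have h1 : (X j : B) ∈ M.asIdeal := by
        change constantCoeff (X j) = 0
        simp
      have h2 := hle h1 ⟨y.rep, hyc⟩ (rep_mem_cone.2 hy)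
      have h3 := hval (X j) ⟨y.rep, hyc⟩
      rw [eval_X] at h3
      exact h3.symm.trans h2
  let F : WithTop (TopologicalSpace.IrreducibleCloseds Y)ᵒᵈ → PrimeSpectrum B := fun W =>
    WithTop.recTopCoe M (fun W => Q (P (OrderDual.ofDual W))) W
  have hF : StrictMono F := by
    intro a b hab
    induction b using WithTop.recTopCoe with
    | top =>
      induction a using WithTop.recTopCoe with
      | top => exact absurd hab (lt_irrefl _)
      | coe a => exact hPM _
    | coe b =>
      induction a using WithTop.recTopCoe with
      | top => exact absurd hab (not_lt_of_ge le_top)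
      | coe a =>
        have hab' : a < b := WithTop.coe_lt_coe.1 hab
        exact hQ (hlt _ _ hab')
  have h1 := Order.krullDim_le_of_strictMono F hF
  rw [Order.krullDim_WithTop, Order.krullDim_orderDual] at h1
  have h2 : Order.krullDim (PrimeSpectrum B) = k := by
    have h3 : ringKrullDim B = ringKrullDim K + Nat.card (Fin k) :=
      MvPolynomial.ringKrullDim_of_isNoetherianRing
    rw [ringKrullDim_eq_zero_of_field, zero_add, Nat.card_fin] at h3
    exact h3
  rw [h2] at h1
  exact h1

end KrullDimension

/-! ### Tuples of forms and their common zeros -/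

section Forms

instance finite_homogeneousSubmodule {K σ : Type*} [CommSemiring K] [Finite σ] (k : ℕ) :
    Module.Finite K (homogeneousSubmodule σ K k) :=
  Module.Finite.iff_fg.mpr (homogeneousSubmodule_fg σ K k)

instance finite_exponents {σ : Type*} [Finite σ] (D : ℕ) : Finite {α : σ →₀ ℕ // α.degree = D} :=
  (Finsupp.finite_of_degree_eq D).to_subtype

/-- Functionals that separate the vectors span the dual space. -/
theorem span_range_eq_top_of_separating {K : Type*} [Field K] {E P : Type*} [AddCommGroup E]
    [Module K E] [FiniteDimensional K E] (ev : P → Dual K E)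
    (hev : ∀ f, (∀ p, ev p f = 0) → f = 0) : Submodule.span K (Set.range ev) = ⊤ := by
  rw [← Subspace.dualCoannihilator_dualAnnihilator_eq (W := Submodule.span K (Set.range ev))]
  have : (Submodule.span K (Set.range ev)).dualCoannihilator = ⊥ := by
    rw [eq_bot_iff]
    intro f hf
    rw [Submodule.mem_dualCoannihilator] at hf
    exact hev f fun p => hf _ (Submodule.subset_span ⟨p, rfl⟩)
  rw [this, Submodule.dualAnnihilator_bot]

/-- Enough evaluations are independent on a space of functions. -/
theorem exists_dual_evaluations {K : Type*} [Field K] {E P : Type*} [AddCommGroup E] [Module K E]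
    [FiniteDimensional K E] (ev : P → Dual K E) (hev : ∀ f, (∀ p, ev p f = 0) → f = 0) {q : ℕ}
    (hq : q ≤ finrank K E) :
    ∃ (y : Fin q → P) (g : Fin q → E), ∀ a b, ev (y a) (g b) = if a = b then 1 else 0 := by
  classical
  have hspan := span_range_eq_top_of_separating ev hev
  obtain ⟨b, hb, hbspan, hli⟩ := exists_linearIndependent K (Set.range ev)
  have hfin : Finite b := hli.finite
  cases nonempty_fintype b
  let B : Basis b K (Dual K E) := Basis.mk hli (by
    rw [Subtype.range_coe_subtype]
    exact (hbspan.trans hspan).ge)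
  have hcard : Fintype.card b = finrank K E := by
    rw [← Module.finrank_eq_card_basis B, Subspace.dual_finrank_eq]
  have hle : Fintype.card (Fin q) ≤ Fintype.card b := by rw [hcard, Fintype.card_fin]; exact hq
  obtain ⟨emb⟩ := Function.Embedding.nonempty_of_card_le hle
  have hy : ∀ a, ∃ p, ev p = (emb a : Dual K E) := fun a => hb (emb a).2
  choose y hy using hy
  refine ⟨y, fun a => (evalEquiv K E).symm (B.dualBasis (emb a)), fun a c => ?_⟩
  rw [← Module.Dual.eval_apply K E, ← Module.evalEquiv_toLinearMap, LinearEquiv.coe_coe,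
    LinearEquiv.apply_symm_apply, hy]
  have : (emb a : Dual K E) = B (emb a) := by simp [B]
  rw [this, Basis.dualBasis_apply_self]
  simp [emb.injective.eq_iff]

variable {K : Type*} [Field K] {σ : Type*} [Fintype σ]

/-- A linear subspace of codimension at most `r` meets `W` in zero only. -/
def AvoidsLE (W : Set (σ → K)) (r : ℕ) : Prop :=
  ∃ π : (σ → K) →ₗ[K] (Fin r → K), ∀ w ∈ W, π w = 0 → w = 0

-- This replaces the surjectivity of a finite map between varieties of equal dimension: if `y` were
-- missed, no nonzero vector of the cone `W` would map to the line `K y`, and `π` followed by the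
-- quotient by that line would be a projection to `K ^ s` with trivial kernel on `W`.
omit [Fintype σ] in
theorem surjOn_of_not_avoidsLE {W : Set (σ → K)} (hW0 : (0 : σ → K) ∈ W)
    (hW : ∀ w ∈ W, ∀ c : K, c • w ∈ W) {s : ℕ} (π : (σ → K) →ₗ[K] (Fin (s + 1) → K))
    (hπ : ∀ w ∈ W, π w = 0 → w = 0) (hs : ¬ AvoidsLE W s) (y : Fin (s + 1) → K) :
    ∃ w ∈ W, π w = y := by
  by_cases hy : y = 0
  · exact ⟨0, hW0, by rw [map_zero, hy]⟩
  by_contra! hcon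
  apply hs
  have hfr : finrank K ((Fin (s + 1) → K) ⧸ (K ∙ y)) = finrank K (Fin s → K) := by
    have h1 := Submodule.finrank_quotient_add_finrank (K ∙ y)
    rw [finrank_span_singleton hy] at h1
    simp only [finrank_fin_fun] at h1 ⊢
    omega
  let e := LinearEquiv.ofFinrankEq _ _ hfr
  refine ⟨(e : _ →ₗ[K] _) ∘ₗ (K ∙ y).mkQ ∘ₗ π, fun w hw h0 => ?_⟩
  have h1 : π w ∈ K ∙ y := by
    simpa using h0
  obtain ⟨c, hc⟩ := Submodule.mem_span_singleton.1 h1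
  by_cases hc0 : c = 0
  · exact hπ w hw (by rw [← hc, hc0, zero_smul])
  · exact absurd (by rw [map_smul, ← hc, smul_smul, inv_mul_cancel₀ hc0, one_smul])
      (hcon _ (hW w hw c⁻¹))

variable (K σ) in
/-- Tuples of forms of the degrees `0, …, d`. -/
abbrev FormTuple (d : ℕ) : Type _ := ∀ k : Fin (d + 1), homogeneousSubmodule σ K (k : ℕ)

/-- The common zeros of the forms of degrees `1, …, i`. -/
def FormTuple.zeros {d : ℕ} (F : FormTuple K σ d) (i : ℕ) : Set (σ → K) :=
  {w | ∀ k : Fin (d + 1), 1 ≤ (k : ℕ) → (k : ℕ) ≤ i → eval w (F k : MvPolynomial σ K) = 0}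

omit [Fintype σ] in
theorem FormTuple.smul_mem_zeros {d : ℕ} (F : FormTuple K σ d) {i : ℕ} {w : σ → K}
    (hw : w ∈ F.zeros i) (c : K) : c • w ∈ F.zeros i := by
  intro k h1 hk
  rw [IsHomogeneous.eval_const_smul (F k).2, hw k h1 hk, mul_zero]

omit [Fintype σ] in
theorem FormTuple.zero_mem_zeros {d : ℕ} (F : FormTuple K σ d) (i : ℕ) :
    (0 : σ → K) ∈ F.zeros i := by
  intro k h1 _
  have h := IsHomogeneous.eval_const_smul (F k).2 (0 : K) (0 : σ → K)
  rwa [zero_smul, zero_pow (by omega), zero_mul] at h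

/-- The linear forms `w ↦ π w j`. -/
def linForm {r : ℕ} (π : (σ → K) →ₗ[K] (Fin r → K)) (j : Fin r) : MvPolynomial σ K :=
  open Classical in ∑ a, C (π (Pi.single a 1) j) * X a

theorem linForm_isHomogeneous {r : ℕ} (π : (σ → K) →ₗ[K] (Fin r → K)) (j : Fin r) :
    (linForm π j).IsHomogeneous 1 :=
  IsHomogeneous.sum _ _ _ fun _ _ => isHomogeneous_C_mul_X _ _

theorem eval_linForm {r : ℕ} (π : (σ → K) →ₗ[K] (Fin r → K)) (j : Fin r) (w : σ → K) :
    eval w (linForm π j) = π w j := by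
  classical
  conv_rhs => rw [pi_eq_sum_univ' w, map_sum]
  simp only [linForm, map_sum, map_mul, eval_C, eval_X, map_smul, Finset.sum_apply, Pi.smul_apply,
    smul_eq_mul]
  refine Finset.sum_congr rfl fun a _ => ?_
  rw [mul_comm]

omit [Fintype σ] in
theorem eval_eq_sum_coeff_of_isHomogeneous {D : ℕ} [Fintype {α : σ →₀ ℕ // α.degree = D}]
    {p : MvPolynomial σ K} (hp : p.IsHomogeneous D) (w : σ → K) :
    eval w p = ∑ α : {α : σ →₀ ℕ // α.degree = D}, coeff α.1 p * α.1.prod fun i k => w i ^ k := by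
  classical
  rw [eval_eq]
  have h : ∀ α ∈ p.support, α.degree = D := fun α hα => (hp.degree_eq_sum_deg_support hα).symm
  refine (Finset.sum_subtype_of_mem (p := fun α : σ →₀ ℕ => α.degree = D)
    (fun α : σ →₀ ℕ => coeff α p * α.prod fun i k => w i ^ k) h).symm.trans ?_
  refine Finset.sum_subset (Finset.subset_univ _) fun α _ hα => ?_
  rw [Finset.mem_subtype, MvPolynomial.notMem_support_iff] at hα
  rw [hα, zero_mul]

/-- The components other than those of degrees `0` and `i`. -/
abbrev OtherDegrees (d i : ℕ) : Type := {k : Fin (d + 1) // (k : ℕ) ≠ 0 ∧ (k : ℕ) ≠ i}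

variable (K σ) in
/-- Forgetting the components of degrees `0` and `i`. -/
def otherComponents (d i : ℕ) :
    FormTuple K σ d →ₗ[K] (∀ k : OtherDegrees d i, homogeneousSubmodule σ K ((k : Fin (d + 1)) : ℕ)) :=
  LinearMap.pi fun k => LinearMap.proj (k : Fin (d + 1))

variable [IsAlgClosed K]

/-- If `π` is finite on the zeros of `F₀`, all monomials of some degree can be eliminated, by a
matrix that depends polynomially on `F` and is the identity at `F₀`. -/
theorem exists_elimination_matrix {d i r : ℕ} (F₀ : FormTuple K σ d)
    (π : (σ → K) →ₗ[K] (Fin r → K)) (hπ : ∀ w ∈ F₀.zeros (i - 1), π w = 0 → w = 0) :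
    ∃ (D : ℕ) (N : {α : σ →₀ ℕ // α.degree = D + 1} → {α : σ →₀ ℕ // α.degree = D + 1} →
        FormTuple K σ d → K) (ρ : {α : σ →₀ ℕ // α.degree = D + 1} → Fin r → MvPolynomial σ K),
      (∀ α β, ∃ (c : K) (ℓ : Dual K (∀ k : OtherDegrees d i,
          homogeneousSubmodule σ K ((k : Fin (d + 1)) : ℕ))),
        ∀ F, N α β F = c + ℓ (otherComponents K σ d i F)) ∧
      (∀ α β, N α β F₀ = open Classical in if α = β then 1 else 0) ∧
      (∀ α j, (ρ α j).IsHomogeneous D) ∧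
      ∀ (_ : Fintype {α : σ →₀ ℕ // α.degree = D + 1}), ∀ F : FormTuple K σ d,
        ∀ w ∈ F.zeros (i - 1), ∀ α,
        ∑ β, N α β F * (β.1.prod fun a k => w a ^ k) = ∑ j, π w j * eval w (ρ α j) := by
  classical
  let ι := {k : Fin (d + 1) // 1 ≤ (k : ℕ) ∧ (k : ℕ) ≤ i - 1}
  let f : Fin r ⊕ ι → MvPolynomial σ K := Sum.elim (linForm π) fun k => F₀ k.1
  let deg : Fin r ⊕ ι → ℕ := Sum.elim (fun _ => 1) fun k => (k.1 : ℕ)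
  obtain ⟨D₀, hD₀⟩ := exists_monomial_combination f deg (by
      rintro (j | k)
      · exact linForm_isHomogeneous π j
      · exact (F₀ k.1).2) ⊥ (by
      intro q hq k
      rw [Ideal.mem_bot] at hq ⊢
      rw [hq, map_zero]) (by
      intro w hw _
      refine hπ w (fun k h1 hk => hw (Sum.inr ⟨k, h1, hk⟩)) (funext fun j => ?_)
      rw [← eval_linForm]
      exact hw (Sum.inl j))
  have hD := fun α : {α : σ →₀ ℕ // α.degree = D₀ + 1} => hD₀ (D₀ + 1) (Nat.le_succ _) α.1 α.2
  choose g hg hg0 hgα using hD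
  -- The cofactors `g` found for `F₀` are kept while its forms are replaced by those of `F`. The
  -- result is the monomial at `F₀`, and on the zeros of `F` only the multiples of the coordinates
  -- of `π` survive.
  let h : {α : σ →₀ ℕ // α.degree = D₀ + 1} → FormTuple K σ d → MvPolynomial σ K := fun α F =>
    ∑ j, linForm π j * g α (Sum.inl j) + ∑ k : ι, (F k.1 : MvPolynomial σ K) * g α (Sum.inr k)
  have hmul : ∀ α l (p : MvPolynomial σ K), p.IsHomogeneous (deg l) →
      (p * g α l).IsHomogeneous (D₀ + 1) := by
    intro α l p hp
    by_cases hl : D₀ + 1 < deg l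
    · rw [hg0 α l hl, mul_zero]
      exact isHomogeneous_zero _ _ _
    · have := hp.mul (hg α l)
      rwa [Nat.add_sub_cancel' (not_lt.1 hl)] at this
  have hh : ∀ α F, (h α F).IsHomogeneous (D₀ + 1) := by
    intro α F
    refine IsHomogeneous.add (IsHomogeneous.sum _ _ _ fun j _ => ?_)
      (IsHomogeneous.sum _ _ _ fun k _ => ?_)
    · exact hmul α (Sum.inl j) _ (linForm_isHomogeneous π j)
    · exact hmul α (Sum.inr k) _ (F k.1).2
  -- Only degrees `1, …, i - 1` enter the matrix, so its entries do not involve the form of degree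
  -- `i`, whose conditions are to be counted.
  have hmem : ∀ k : ι, (k.1 : ℕ) ≠ 0 ∧ (k.1 : ℕ) ≠ i := fun k => by
    have := k.2
    omega
  refine ⟨D₀, fun α β F => coeff β.1 (h α F), fun α j => g α (Sum.inl j), ?_, ?_, ?_, ?_⟩
  · intro α β
    refine ⟨coeff β.1 (∑ j, linForm π j * g α (Sum.inl j)),
      ∑ k : ι, lcoeff K β.1 ∘ₗ LinearMap.mulRight K (g α (Sum.inr k)) ∘ₗ
        (homogeneousSubmodule σ K (k.1 : ℕ)).subtype ∘ₗ
        LinearMap.proj (R := K) (φ := fun k : OtherDegrees d i =>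
          homogeneousSubmodule σ K ((k : Fin (d + 1)) : ℕ)) ⟨k.1, hmem k⟩, fun F => ?_⟩
    simp only [h, coeff_add]
    congr 1
    rw [coeff_sum, LinearMap.sum_apply]
    rfl
  · intro α β
    have h1 : h α F₀ = monomial α.1 1 := by
      have h2 := hgα α
      rw [Ideal.mem_bot, sub_eq_zero, Fintype.sum_sum_type] at h2
      exact h2.symm
    simp only [h1, coeff_monomial, Subtype.ext_iff]
  · intro α j
    exact hg α (Sum.inl j)
  · intro _ F w hw α
    rw [← eval_eq_sum_coeff_of_isHomogeneous (hh α F) w]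
    simp only [h, map_add, map_sum, map_mul, eval_linForm]
    rw [add_eq_left]
    refine Finset.sum_eq_zero fun k _ => ?_
    rw [hw k.1 k.2.1 k.2.2, zero_mul]

end Forms

/-! ### Membership of determinants and polynomial expressions in algebras of functions -/

section FunctionAlgebras

variable {K : Type*} [Field K] {X V : Type*} [AddCommGroup V] [Module K V]

theorem affine_mem {v : X → V} {B : Subalgebra K (X → K)} (h : coordAlg K v ≤ B) {f : X → K}
    (hf : ∃ (c : K) (ℓ : Dual K V), ∀ x, f x = c + ℓ (v x)) : f ∈ B := by
  obtain ⟨c, ℓ, hf⟩ := hf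
  have : f = algebraMap K (X → K) c + fun x => ℓ (v x) := funext hf
  rw [this]
  exact add_mem (B.algebraMap_mem c) (h (mem_coordAlg v ℓ))

theorem det_mem {n : Type*} [Fintype n] [DecidableEq n] {B : Subalgebra K (X → K)}
    (M : n → n → X → K) (h : ∀ i j, M i j ∈ B) :
    (fun x => Matrix.det (Matrix.of fun i j => M i j x)) ∈ B := by
  have : (fun x => Matrix.det (Matrix.of fun i j => M i j x)) =
      ∑ σ : Equiv.Perm n, Equiv.Perm.sign σ • ∏ i, M (σ i) i := by
    ext x
    rw [Matrix.det_apply, Finset.sum_apply]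
    refine Finset.sum_congr rfl fun σ _ => ?_
    simp [Finset.prod_apply]
  rw [this]
  refine sum_mem fun σ _ => ?_
  rw [Units.smul_def]
  exact zsmul_mem (prod_mem fun i _ => h _ _) _

theorem adjugate_mem {n : Type*} [Fintype n] [DecidableEq n] {B : Subalgebra K (X → K)}
    (M : n → n → X → K) (h : ∀ i j, M i j ∈ B) (a b : n) :
    (fun x => Matrix.adjugate (Matrix.of fun i j => M i j x) a b) ∈ B := by
  have h1 := det_mem (B := B) (fun i j => if i = b then algebraMap K (X → K)
      ((Pi.single a (1 : K) : n → K) j)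
    else M i j) (fun i j => by
      split_ifs
      · exact B.algebraMap_mem _
      · exact h i j)
  convert h1 using 1
  ext x
  rw [Matrix.adjugate_apply]
  congr 1
  ext i j
  rw [Matrix.updateRow_apply, Matrix.of_apply, Matrix.of_apply]
  split_ifs <;> rfl

theorem aeval_fun_apply {σ : Type*} (w : σ → X → K) (p : MvPolynomial σ K) (x : X) :
    aeval w p x = eval (fun a => w a x) p := by
  have : (Pi.evalAlgHom K (fun _ : X => K) x).comp (aeval w) = aeval fun a => w a x := by
    ext a
    simp
  exact DFunLike.congr_fun this p

theorem aeval_mem {σ A : Type*} [CommRing A] [Algebra K A] {B : Subalgebra K A} {x : σ → A}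
    (h : ∀ a, x a ∈ B) (p : MvPolynomial σ K) : aeval x p ∈ B := by
  have : aeval x p ∈ (aeval (R := K) x).range := ⟨p, rfl⟩
  rw [← Algebra.adjoin_range_eq_range_aeval] at this
  exact Algebra.adjoin_le (Set.range_subset_iff.2 h) this

theorem aeval_mem_span_of_isHomogeneous {B A σ : Type*} [CommRing B] [CommRing A] [Algebra K B]
    [Algebra K A] [Algebra B A] [IsScalarTower K B A] (x : σ → A) {p : MvPolynomial σ K} {D : ℕ}
    (hp : p.IsHomogeneous D) : aeval x p ∈
      Submodule.span B {y | ∃ β : σ →₀ ℕ, β.degree < D + 1 ∧ y = β.prod fun i k => x i ^ k} := by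
  rw [← support_sum_monomial_coeff p, map_sum]
  refine Submodule.sum_mem _ fun β hβ => ?_
  rw [aeval_monomial, ← Algebra.smul_def, ← algebraMap_smul B]
  refine Submodule.smul_mem _ _ (Submodule.subset_span ⟨β, ?_, rfl⟩)
  have h1 : β.degree = D := (hp.degree_eq_sum_deg_support hβ).symm
  omega

end FunctionAlgebras

/-! ### Forms that fail to lower the dimension of the common zeros -/

section BadForms

variable {K : Type*} [Field K] [IsAlgClosed K] {σ : Type*} [Fintype σ]

/-- The form `g ∘ π`. -/
def compForm {r : ℕ} (π : (σ → K) →ₗ[K] (Fin r → K)) {i : ℕ}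
    (g : homogeneousSubmodule (Fin r) K i) : homogeneousSubmodule σ K i :=
  ⟨aeval (linForm π) (g : MvPolynomial (Fin r) K), by
    have := IsHomogeneous.aeval g.2 (linForm π) (linForm_isHomogeneous π)
    rwa [one_mul] at this⟩

omit [IsAlgClosed K] in
theorem eval_aeval_linForm {r : ℕ} (π : (σ → K) →ₗ[K] (Fin r → K)) (g : MvPolynomial (Fin r) K)
    (w : σ → K) : eval w (aeval (linForm π) g) = eval (π w) g := by
  have : (aeval (R := K) w).comp (aeval (linForm π)) = aeval (π w) := by
    refine algHom_ext fun j => ?_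
    rw [AlgHom.comp_apply, aeval_X, aeval_X]
    exact eval_linForm π j w
  exact DFunLike.congr_fun this g

omit [IsAlgClosed K] in
theorem eval_compForm {r : ℕ} (π : (σ → K) →ₗ[K] (Fin r → K)) {i : ℕ}
    (g : homogeneousSubmodule (Fin r) K i) (w : σ → K) :
    eval w (compForm π g : MvPolynomial σ K) = eval (π w) (g : MvPolynomial (Fin r) K) :=
  eval_aeval_linForm π g w

variable (K) in
/-- Evaluation of forms at a point. -/
def evalForm (i : ℕ) (w : σ → K) : homogeneousSubmodule σ K i →ₗ[K] K :=
  (aeval (R := K) w).toLinearMap ∘ₗ (homogeneousSubmodule σ K i).subtype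

omit [IsAlgClosed K] [Fintype σ] in
@[simp] theorem evalForm_apply (i : ℕ) (w : σ → K) (f : homogeneousSubmodule σ K i) :
    evalForm K i w f = eval w (f : MvPolynomial σ K) := rfl

-- `E` is the direct sum of the kernel of `c` and the span of the `G a`; `P` and `b` are coordinates
-- and a basis for the kernel.
omit [IsAlgClosed K] [Fintype σ] in
theorem exists_complementary_coordinates {E : Type*} [AddCommGroup E] [Module K E]
    [FiniteDimensional K E] {q : ℕ} (c : E →ₗ[K] (Fin q → K)) (G : Fin q → E)
    (hcG : ∀ z : Fin q → K, c (∑ b, z b • G b) = z) :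
    ∃ (m : ℕ) (P : E →ₗ[K] (Fin m → K)) (b : Fin m → E), m + q = finrank K E ∧
      ∀ f, f = ∑ j, P f j • b j + ∑ a, c f a • G a := by
  have hker : finrank K (LinearMap.ker c) + q = finrank K E := by
    have h1 := LinearMap.finrank_range_add_finrank_ker c
    rw [LinearMap.range_eq_top.2 fun z => ⟨_, hcG z⟩, finrank_top, finrank_fin_fun] at h1
    omega
  let R : E →ₗ[K] E := LinearMap.id - ∑ a, (LinearMap.proj a ∘ₗ c).smulRight (G a)
  have hR : ∀ f, R f = f - ∑ a, c f a • G a := fun f => by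
    simp [R, LinearMap.sum_apply]
  let b := finBasis K (LinearMap.ker c)
  let P₀ : E →ₗ[K] LinearMap.ker c := R.codRestrict (LinearMap.ker c) fun f => by
    rw [LinearMap.mem_ker, hR, map_sub, hcG, sub_self]
  refine ⟨_, b.equivFun.toLinearMap ∘ₗ P₀, fun j => b j, hker, fun f => ?_⟩
  have h1 : ∑ j, b.equivFun (P₀ f) j • (b j : E) = R f := by
    have h2 := congrArg (LinearMap.ker c).subtype (b.sum_equivFun (P₀ f))
    rw [map_sum] at h2
    exact h2
  change f = ∑ j, b.equivFun (P₀ f) j • (b j : E) + _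
  rw [h1, hR, sub_add_cancel]

-- The summand `1` is a lower bound for the degree `0` component; it becomes the condition `F 0 =
-- 0`.
omit [IsAlgClosed K] in
theorem finrank_formTuple {d i : ℕ} (hi : 1 ≤ i) (hid : i ≤ d) :
    1 + finrank K (homogeneousSubmodule σ K i) +
      finrank K (∀ k : OtherDegrees d i, homogeneousSubmodule σ K ((k : Fin (d + 1)) : ℕ)) ≤
      finrank K (FormTuple K σ d) := by
  classical
  let ki : Fin (d + 1) := ⟨i, by omega⟩
  have h1 : finrank K (FormTuple K σ d) =
      ∑ k : Fin (d + 1), finrank K (homogeneousSubmodule σ K (k : ℕ)) :=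
    Module.finrank_pi_fintype K
  have h2 : finrank K (∀ k : OtherDegrees d i, homogeneousSubmodule σ K ((k : Fin (d + 1)) : ℕ)) =
      ∑ k : OtherDegrees d i, finrank K (homogeneousSubmodule σ K ((k : Fin (d + 1)) : ℕ)) :=
    Module.finrank_pi_fintype K
  have hne : Nontrivial (homogeneousSubmodule σ K ((0 : Fin (d + 1)) : ℕ)) :=
    ⟨⟨⟨1, isHomogeneous_one σ K⟩, 0, fun h => one_ne_zero (congrArg Subtype.val h)⟩⟩
  have h3 : 0 < finrank K (homogeneousSubmodule σ K ((0 : Fin (d + 1)) : ℕ)) := Module.finrank_pos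
  have hk : ki ∈ Finset.univ.erase (0 : Fin (d + 1)) :=
    Finset.mem_erase.2 ⟨fun h => by
      have : i = 0 := congrArg Fin.val h
      omega, Finset.mem_univ _⟩
  have h4 : ∑ k ∈ (Finset.univ.erase (0 : Fin (d + 1))).erase ki,
      finrank K (homogeneousSubmodule σ K (k : ℕ)) =
      ∑ k : OtherDegrees d i, finrank K (homogeneousSubmodule σ K ((k : Fin (d + 1)) : ℕ)) := by
    refine Finset.sum_subtype _ (fun k => ?_) (fun k : Fin (d + 1) =>
      finrank K (homogeneousSubmodule σ K (k : ℕ)))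
    simp only [Finset.mem_erase, Finset.mem_univ, and_true, ne_eq, Fin.ext_iff, ki, Fin.val_zero]
    tauto
  rw [h1, h2, ← Finset.add_sum_erase _ _ (Finset.mem_univ (0 : Fin (d + 1))),
    ← Finset.add_sum_erase _ _ hk, h4]
  change _ ≤ _ + (finrank K (homogeneousSubmodule σ K i) + _)
  omega

/-- If the zeros of the forms of degree less than `i` have the expected dimension but those of
degree at most `i` do not, then the form of degree `i` satisfies as many independent conditions as
there are forms of degree `i` in `s + 1` variables. -/
theorem sizeLE_badForms {d i s q e : ℕ} (hi : 1 ≤ i) (hid : i ≤ d)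
    (hq : q ≤ finrank K (homogeneousSubmodule (Fin (s + 1)) K i))
    (he : finrank K (FormTuple K σ d) ≤ e + 1 + q) :
    SizeLE K {F : FormTuple K σ d | F 0 = 0 ∧ AvoidsLE (F.zeros (i - 1)) (s + 1) ∧
      ¬ AvoidsLE (F.zeros i) s} e := by
  classical
  refine sizeLE_of_local fun F₀ hF₀ => ?_
  obtain ⟨-, ⟨π, hπ⟩, hnot₀⟩ := hF₀
  obtain ⟨D, N, ρ, hN, hN1, hρ, hNw⟩ := exists_elimination_matrix (i := i) F₀ π hπ
  cases nonempty_fintype {α : σ →₀ ℕ // α.degree = D + 1}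
  -- Where `δ` is nonzero the elimination found at `F₀` can still be solved, so the one projection
  -- `π` works for all `F` near `F₀`.
  let δ : FormTuple K σ d → K := fun F => Matrix.det (Matrix.of fun α β => N α β F)
  have hsub : ∀ F : FormTuple K σ d, F.zeros i ⊆ F.zeros (i - 1) :=
    fun F w hw k h1 hk => hw k h1 (by omega)
  have hadj : ∀ F : FormTuple K σ d, ∀ w ∈ F.zeros (i - 1), ∀ α,
      δ F * (α.1.prod fun a k => w a ^ k) =
        ∑ β, Matrix.adjugate (Matrix.of fun α β => N α β F) α β *
          ∑ j, π w j * eval w (ρ β j) := by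
    intro F w hw α
    have h1 : (Matrix.of fun α β => N α β F).mulVec (fun β => β.1.prod fun a k => w a ^ k) =
        fun β => ∑ j, π w j * eval w (ρ β j) := by
      ext β
      exact hNw _ F w hw β
    have h2 : (Matrix.adjugate (Matrix.of fun α β => N α β F)).mulVec
        ((Matrix.of fun α β => N α β F).mulVec (fun β => β.1.prod fun a k => w a ^ k)) =
        δ F • fun β => β.1.prod fun a k => w a ^ k := by
      rw [Matrix.mulVec_mulVec, Matrix.adjugate_mul, Matrix.smul_mulVec, Matrix.one_mulVec]
    rw [h1] at h2
    exact (congrFun h2 α).symm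
  have hπF : ∀ F : FormTuple K σ d, δ F ≠ 0 → ∀ w ∈ F.zeros (i - 1), π w = 0 → w = 0 := by
    intro F hF w hw hw0
    ext a
    -- For the pure power this reads `δ F * w a ^ (D + 1) = 0` when `π w = 0`.
    have h1 := hadj F w hw ⟨Finsupp.single a (D + 1), Finsupp.degree_single _ _⟩
    rw [hw0] at h1
    simp only [Pi.zero_apply, zero_mul, Finset.sum_const_zero, mul_zero, mul_eq_zero, hF,
      false_or] at h1
    rw [Finsupp.prod_single_index (h := fun a k => w a ^ k) (pow_zero _)] at h1
    exact (pow_eq_zero_iff (Nat.succ_ne_zero D)).1 h1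
  have hsurj : ∀ F : FormTuple K σ d, δ F ≠ 0 → ¬ AvoidsLE (F.zeros i) s → ∀ y,
      ∃ w ∈ F.zeros i, π w = y := fun F hF hs y =>
    surjOn_of_not_avoidsLE (F.zero_mem_zeros i) (fun w hw c => F.smul_mem_zeros hw c) π
      (fun w hw => hπF F hF w (hsub F hw)) hs y
  have hδ₀ : δ F₀ = 1 := by
    have : (Matrix.of fun α β => N α β F₀) = 1 := by
      ext α β
      rw [Matrix.of_apply, hN1, Matrix.one_apply]
    simp only [δ, this, Matrix.det_one]
  refine ⟨δ, ?_, by rw [hδ₀]; exact one_ne_zero, ?_⟩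
  · refine det_mem N fun α β => affine_mem ?_ (hN α β)
    exact coordAlg_linear_le id (otherComponents K σ d i)
  -- These `q` points of `K ^ (s + 1)` with dual forms carry the `q` conditions: whatever zero `w`
  -- is chosen above `y a`, the form `g b ∘ π` takes the value `1` or `0` there.
  obtain ⟨y, g, hyg⟩ := exists_dual_evaluations
    (fun z : Fin (s + 1) → K => evalForm K i z) (fun f hf => by
      apply Subtype.ext
      exact MvPolynomial.funext fun z => by rw [ZeroMemClass.coe_zero, map_zero]; exact hf z) hq
  choose w₀ _ hw₀ using fun a => hsurj F₀ (by rw [hδ₀]; exact one_ne_zero) hnot₀ (y a)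
  let ki : Fin (d + 1) := ⟨i, by omega⟩
  let c : homogeneousSubmodule σ K i →ₗ[K] (Fin q → K) := LinearMap.pi fun a => evalForm K i (w₀ a)
  let G : Fin q → homogeneousSubmodule σ K i := fun a => compForm π (g a)
  have hG : ∀ (w : σ → K) a b, π w = y a →
      eval w (G b : MvPolynomial σ K) = if a = b then 1 else 0 := by
    intro w a b hw
    rw [eval_compForm, hw]
    exact hyg a b
  have hcG : ∀ z : Fin q → K, c (∑ b, z b • G b) = z := by
    intro z
    ext a
    simp only [c, LinearMap.pi_apply, map_sum, map_smul, evalForm_apply, hG _ _ _ (hw₀ a)]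
    simp
  obtain ⟨m, P, b, hm, hP⟩ := exists_complementary_coordinates c G hcG
  let S : Set (FormTuple K σ d) := {F | F 0 = 0 ∧ AvoidsLE (F.zeros (i - 1)) (s + 1) ∧
      ¬ AvoidsLE (F.zeros i) s} ∩ {F | δ F ≠ 0}
  -- The incidence set records, besides `F`, a common zero above each `y a`. It maps onto `S` by
  -- `hsurj`.
  let X := {x : FormTuple K σ d × (Fin q → σ → K) // x.1 ∈ S ∧
    ∀ a, x.2 a ∈ x.1.zeros i ∧ π (x.2 a) = y a}
  let B₁ : Subalgebra K (X → K) := coordAlg K fun x : X => otherComponents K σ d i x.1.1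
  have hB₁ : GrowthLE B₁ _ := growthLE_coordAlg _
  have hδB : (fun x : X => δ x.1.1) ∈ B₁ :=
    det_mem (fun α β (x : X) => N α β x.1.1) fun α β => affine_mem le_rfl (by
      obtain ⟨c, ℓ, h⟩ := hN α β
      exact ⟨c, ℓ, fun x => h _⟩)
  let B₂ := B₁ ⊔ Algebra.adjoin K {fun x : X => (δ x.1.1)⁻¹}
  have hB₂ : GrowthLE B₂ _ := hB₁.adjoin_inverse hδB (by
    ext x
    exact mul_inv_cancel₀ x.2.1.2)
  have h12 : B₁ ≤ B₂ := le_sup_left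
  let wf : Fin q → σ → X → K := fun a b x => x.1.2 a b
  -- As `π` of the zero is the constant `y a`, elimination expresses its monomials of degree `D + 1`
  -- by those of degree `D`, with coefficients in `B₂`. The zeros therefore add nothing to the
  -- growth.
  have hwint : ∀ a b, IsIntegral B₂ (wf a b) := by
    intro a
    refine isIntegral_of_prod_mem_span (wf a) (D + 1) fun α hα => ?_
    have hadjB : ∀ β, (fun x : X => (δ x.1.1)⁻¹ *
        Matrix.adjugate (Matrix.of fun α β => N α β x.1.1) ⟨α, hα⟩ β) ∈ B₂ := by
      intro β
      refine mul_mem (a := fun x : X => (δ x.1.1)⁻¹)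
        ((le_sup_right : _ ≤ B₂) (Algebra.self_mem_adjoin_singleton K _)) (h12 ?_)
      exact adjugate_mem (fun α β (x : X) => N α β x.1.1) (fun α β => affine_mem le_rfl (by
        obtain ⟨c, ℓ, h⟩ := hN α β
        exact ⟨c, ℓ, fun x => h _⟩)) _ _
    have h1 : (α.prod fun b k => wf a b ^ k) = ∑ β, (⟨_, hadjB β⟩ : B₂) •
        ∑ j, y a j • aeval (wf a) (ρ β j) := by
      ext x
      have h2 := hadj x.1.1 (x.1.2 a) (hsub _ (x.2.2 a).1) ⟨α, hα⟩
      have h3 : (α.prod fun b k => wf a b ^ k) x = α.prod fun b k => x.1.2 a b ^ k := by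
        simp only [Finsupp.prod, Finset.prod_apply, Pi.pow_apply]
        rfl
      rw [h3, ← mul_right_inj' x.2.1.2, h2, Finset.sum_apply, Finset.mul_sum]
      refine Finset.sum_congr rfl fun β _ => ?_
      rw [(x.2.2 a).2]
      simp only [Algebra.smul_def, Pi.mul_apply, Finset.sum_apply, aeval_fun_apply]
      change _ = δ x.1.1 * (((δ x.1.1)⁻¹ *
        Matrix.adjugate (Matrix.of fun α β => N α β x.1.1) ⟨α, hα⟩ β) * _)
      rw [← mul_assoc, ← mul_assoc, mul_inv_cancel₀ x.2.1.2, one_mul]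
      rfl
    rw [h1]
    refine Submodule.sum_mem _ fun β _ => Submodule.smul_mem _ _ (Submodule.sum_mem _ fun j _ => ?_)
    rw [← algebraMap_smul B₂]
    exact Submodule.smul_mem _ _ (aeval_mem_span_of_isHomogeneous (wf a) (hρ β j))
  let B₃ := B₂ ⊔ Algebra.adjoin K (Set.range fun p : Fin q × σ => wf p.1 p.2)
  have hB₃ : GrowthLE B₃ _ := hB₂.of_isIntegral (B₁ := B₃) (by
    have hle : B₃ ≤ (integralClosure B₂ (X → K)).restrictScalars K := by
      refine sup_le (fun z hz => ?_) (Algebra.adjoin_le_iff.2 ?_)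
      · exact isIntegral_algebraMap (R := B₂) (x := ⟨z, hz⟩)
      · rintro _ ⟨p, rfl⟩
        exact hwint p.1 p.2
    exact fun z hz => hle hz)
  have hwB : ∀ a (p : MvPolynomial σ K), aeval (wf a) p ∈ B₃ := by
    intro a p
    exact aeval_mem (fun b => (le_sup_right : _ ≤ B₃) (Algebra.subset_adjoin ⟨(a, b), rfl⟩)) p
  let B₄ := B₃ ⊔ coordAlg K fun x : X => P (x.1.1 ki)
  have hB₄ : GrowthLE B₄ _ := hB₃.sup (growthLE_coordAlg _)
  have h34 : B₃ ≤ B₄ := le_sup_left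
  have hPB : coordAlg K (fun x : X => P (x.1.1 ki)) ≤ B₄ := le_sup_right
  -- Evaluating the form of degree `i` at the zero above `y a` gives `0 = c a + ∑ P m * b m (w a)`:
  -- the `q` coordinates `c a` are determined by the other data.
  have hcB : ∀ a, (fun x : X => c (x.1.1 ki) a) ∈ B₄ := by
    intro a
    have h1 : (fun x : X => c (x.1.1 ki) a) =
        -∑ m, (fun x : X => P (x.1.1 ki) m) *
          aeval (wf a) (b m : MvPolynomial σ K) := by
      ext x
      have h2 : evalForm K i (x.1.2 a) (x.1.1 ki) = 0 := (x.2.2 a).1 ki hi le_rfl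
      rw [hP (x.1.1 ki), map_add, map_sum, map_sum] at h2
      simp only [map_smul, smul_eq_mul, evalForm_apply, hG _ _ _ (x.2.2 a).2] at h2
      simp only [mul_ite, mul_one, mul_zero, Finset.sum_ite_eq, Finset.mem_univ, if_true] at h2
      simp only [Pi.neg_apply, Finset.sum_apply, Pi.mul_apply, aeval_fun_apply]
      exact eq_neg_of_add_eq_zero_right h2
    rw [h1]
    exact neg_mem (sum_mem fun m _ => mul_mem
      (hPB (mem_coordAlg (fun x : X => P (x.1.1 ki)) (LinearMap.proj m))) (h34 (hwB a _)))
  refine SizeLE.of_le_growth (B := B₄) (v := fun x : X => x.1.1) (hB₄.mono_right ?_) (fun ℓ => ?_) ?_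
  · have h1 := finrank_formTuple (K := K) (σ := σ) hi hid
    rw [finrank_fin_fun]
    omega
  · have h1 : (fun x : X => ℓ x.1.1) = ∑ k, fun x : X => ℓ (LinearMap.single K _ k (x.1.1 k)) := by
      ext x
      rw [Finset.sum_apply, ← map_sum]
      congr 1
      exact (LinearMap.sum_single_apply _ _).symm
    rw [h1]
    refine sum_mem fun k _ => ?_
    by_cases hk0 : k = 0
    · have h2 : (fun x : X => ℓ (LinearMap.single K _ k (x.1.1 k))) = 0 := by
        ext x
        subst hk0
        rw [x.2.1.1.1, map_zero, map_zero]
        rfl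
      rw [h2]
      exact zero_mem _
    by_cases hki : k = ki
    · subst hki
      have h2 : (fun x : X => ℓ (LinearMap.single K _ ki (x.1.1 ki))) =
          (∑ m, ℓ (LinearMap.single K _ ki (b m)) • fun x : X => P (x.1.1 ki) m) +
          ∑ b, ℓ (LinearMap.single K _ ki (G b)) • fun x : X => c (x.1.1 ki) b := by
        ext x
        conv_lhs => rw [hP (x.1.1 ki)]
        simp only [map_add, map_sum, map_smul, Pi.add_apply, Finset.sum_apply, Pi.smul_apply,
          smul_eq_mul]
        congr 1 <;> exact Finset.sum_congr rfl fun b _ => mul_comm _ _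
      rw [h2]
      exact add_mem (sum_mem fun m _ => B₄.smul_mem
        (hPB (mem_coordAlg (fun x : X => P (x.1.1 ki)) (LinearMap.proj m))) _) (sum_mem fun b _ => B₄.smul_mem (hcB b) _)
    · have hk : (k : ℕ) ≠ 0 ∧ (k : ℕ) ≠ i :=
        ⟨fun h => hk0 (Fin.ext h), fun h => hki (Fin.ext h)⟩
      refine h34 ((le_sup_left : B₂ ≤ B₃) (h12 ?_))
      exact mem_coordAlg (fun x : X => otherComponents K σ d i x.1.1)
        (ℓ ∘ₗ LinearMap.single K _ k ∘ₗ LinearMap.proj (R := K) (φ := fun k : OtherDegrees d i =>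
          homogeneousSubmodule σ K ((k : Fin (d + 1)) : ℕ)) ⟨k, hk⟩)
  · intro F hF
    choose w hw hwy using fun a => hsurj F hF.2 hF.1.2.2 (y a)
    exact ⟨⟨(F, w), hF, fun a => ⟨hw a, hwy a⟩⟩, rfl⟩

end BadForms

/-! ### Families of forms moved by linear substitutions -/

section Orbits

variable {K : Type*} [Field K] {σ : Type*} [Fintype σ]

theorem coordAlg_le_of_eval [Infinite K] {X : Type*} {B : Subalgebra K (X → K)} {i : ℕ}
    (v : X → homogeneousSubmodule σ K i)
    (h : ∀ w, (fun x => eval w (v x : MvPolynomial σ K)) ∈ B) : coordAlg K v ≤ B := by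
  refine coordAlg_le_iff.2 fun ℓ => ?_
  have hℓ : ℓ ∈ Submodule.span K (Set.range fun w : σ → K => evalForm K i w) := by
    rw [span_range_eq_top_of_separating _ fun f hf => Subtype.ext (MvPolynomial.funext fun w => by
      rw [ZeroMemClass.coe_zero, map_zero]
      exact hf w)]
    trivial
  induction hℓ using Submodule.span_induction with
  | mem ℓ h' =>
    obtain ⟨w, rfl⟩ := h'
    exact h w
  | zero => exact B.zero_mem
  | add a b _ _ ha hb => exact B.add_mem ha hb
  | smul c a _ ha => exact B.smul_mem ha c

/-- Substituting a family of linear maps into a family of forms increases the dimension by at most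
the number of parameters. -/
theorem SizeLE.compForm [Infinite K] {r i e : ℕ} {S : Set (homogeneousSubmodule (Fin r) K i)}
    (h : SizeLE K S e) {P : Type*} [AddCommGroup P] [Module K P] [FiniteDimensional K P]
    (A : P → (σ → K) →ₗ[K] (Fin r → K))
    (hA : ∀ w j, ∃ (c : K) (ℓ : Dual K P), ∀ p, A p w j = c + ℓ p) :
    SizeLE K {f | ∃ G ∈ S, ∃ p, f = OneLevel.compForm (A p) G} (e + finrank K P) := by
  have h1 : GrowthLE (coordAlg K fun x : S × P => (x.1 : homogeneousSubmodule (Fin r) K i)) e := by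
    rw [coordAlg_comp (Y := S) Subtype.val Prod.fst]
    exact GrowthLE.map h _
  have h2 := h1.sup (growthLE_coordAlg fun x : S × P => x.2)
  refine SizeLE.of_subset_range (v := fun x : S × P => OneLevel.compForm (A x.2) x.1.1)
    (h2.mono (coordAlg_le_of_eval _ fun w => ?_)) ?_
  · let b := finBasis K (homogeneousSubmodule (Fin r) K i)
    have h3 : (fun x : S × P => eval w (OneLevel.compForm (A x.2) x.1.1 : MvPolynomial σ K)) =
        ∑ k, (fun x : S × P => b.coord k x.1.1) *
          aeval (fun j (x : S × P) => A x.2 w j) (b k : MvPolynomial (Fin r) K) := by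
      ext x
      rw [eval_compForm, ← evalForm_apply]
      conv_lhs => rw [← b.sum_repr x.1.1]
      simp only [map_sum, map_smul, smul_eq_mul, evalForm_apply, Finset.sum_apply, Pi.mul_apply,
        aeval_fun_apply, Basis.coord_apply]
    rw [h3]
    refine sum_mem fun k _ => mul_mem ((le_sup_left : coordAlg K (fun x : S × P => x.1.1) ≤ _)
      (mem_coordAlg (fun x : S × P => x.1.1) _)) (aeval_mem (fun j => affine_mem
        (v := fun x : S × P => x.2) le_sup_right ?_) _)
    obtain ⟨c, ℓ, hc⟩ := hA w j
    exact ⟨c, ℓ, fun x => hc _⟩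
  · rintro _ ⟨G, hG, p, rfl⟩
    exact ⟨(⟨G, hG⟩, p), rfl⟩

end Orbits

/-! ### Shears as parameters for linear subspaces -/

section Shears

variable {K : Type*} [Field K] {ι : Type*} {m : ℕ}

variable (K) in
/-- The vectors whose coordinates with index in the range of `y` vanish. -/
def offCoords (y : Fin m → ι) : Submodule K (ι → K) := LinearMap.ker (LinearMap.funLeft K K y)

theorem offCoords_apply {y : Fin m → ι} (h : offCoords K y) (a : Fin m) : (h : ι → K) (y a) = 0 :=
  congrFun (LinearMap.mem_ker.1 h.2) a

theorem finrank_offCoords [Fintype ι] {y : Fin m → ι} (hy : Function.Injective y) :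
    finrank K (offCoords K y) + m = Fintype.card ι := by
  have h1 := LinearMap.finrank_range_add_finrank_ker (LinearMap.funLeft K K y)
  rw [LinearMap.range_eq_top.2 (LinearMap.funLeft_surjective_of_injective K K y hy), finrank_top,
    finrank_fin_fun, Module.finrank_fintype_fun_eq_card] at h1
  rw [offCoords]
  omega

/-- The linear map that is the identity on `offCoords y` and adds `h b` to the basis vector with
index `y b`. -/
def shear (y : Fin m → ι) (h : Fin m → offCoords K y) : (ι → K) →ₗ[K] (ι → K) :=
  LinearMap.id + ∑ b, (LinearMap.proj (y b)).smulRight (h b : ι → K)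

theorem shear_apply (y : Fin m → ι) (h : Fin m → offCoords K y) (x : ι → K) :
    shear y h x = x + ∑ b, x (y b) • (h b : ι → K) := by
  simp [shear, LinearMap.sum_apply]

theorem shear_apply_apply (y : Fin m → ι) (h : Fin m → offCoords K y) (x : ι → K) (a : Fin m) :
    shear y h x (y a) = x (y a) := by
  simp [shear_apply, offCoords_apply]

theorem shear_neg_shear (y : Fin m → ι) (h : Fin m → offCoords K y) (x : ι → K) :
    shear y (-h) (shear y h x) = x := by
  rw [shear_apply]
  simp only [shear_apply_apply, Pi.neg_apply, NegMemClass.coe_neg, smul_neg, Finset.sum_neg_distrib]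
  rw [shear_apply, add_neg_cancel_right]

theorem shear_shear_neg (y : Fin m → ι) (h : Fin m → offCoords K y) (x : ι → K) :
    shear y h (shear y (-h) x) = x := by
  have := shear_neg_shear y (-h) x
  rwa [neg_neg] at this

theorem shear_eq_affine (y : Fin m → ι) (w : ι → K) (j : ι) :
    ∃ (c : K) (ℓ : Dual K (Fin m → offCoords K y)), ∀ h, shear y h w j = c + ℓ h := by
  refine ⟨w j, ∑ b, w (y b) • (LinearMap.proj j ∘ₗ (offCoords K y).subtype ∘ₗ LinearMap.proj b),
    fun h => ?_⟩
  simp [shear_apply, LinearMap.sum_apply]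

/-- Every subspace is the image of a coordinate subspace under a shear. -/
theorem exists_shear_mem [Fintype ι] (L : Submodule K (ι → K)) (hL : finrank K L = m) :
    ∃ (y : Fin m ↪ ι) (h : Fin m → offCoords K y), ∀ x : ι → K, (∀ a ∉ Set.range y, x a = 0) →
      shear y h x ∈ L := by
  classical
  -- Some `m` coordinates restrict to a basis of the dual of `L`, so `L` is a graph over their
  -- coordinate subspace; the shear carries each basis vector of that subspace to `g b`.
  obtain ⟨y, g, hyg⟩ := exists_dual_evaluations
    (fun a : ι => (LinearMap.proj a : (ι → K) →ₗ[K] K) ∘ₗ L.subtype)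
    (fun f hf => Subtype.ext (funext hf)) hL.ge
  have hyg' : ∀ a b, (g b : ι → K) (y a) = if a = b then 1 else 0 := hyg
  have hy : Function.Injective y := by
    intro a b hab
    by_contra hne
    have h1 := hyg' a b
    rw [hab, hyg', if_pos rfl, if_neg hne] at h1
    exact one_ne_zero h1
  have hmem : ∀ b, (g b : ι → K) - (Pi.single (y b) 1 : ι → K) ∈ offCoords K y := by
    refine fun b => LinearMap.mem_ker.2 (funext fun a => ?_)
    change (g b : ι → K) (y a) - (Pi.single (y b) 1 : ι → K) (y a) = 0
    rw [hyg', Pi.single_apply]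
    simp [hy.eq_iff]
  refine ⟨⟨y, hy⟩, fun b => ⟨_, hmem b⟩, fun x hx => ?_⟩
  have h1 : x = ∑ b, x (y b) • (Pi.single (y b) 1 : ι → K) := by
    ext a
    by_cases ha : a ∈ Set.range y
    · obtain ⟨a, rfl⟩ := ha
      simp [Finset.sum_apply, Pi.single_apply, hy.eq_iff]
    · rw [hx a ha, Finset.sum_apply, Finset.sum_eq_zero]
      intro b _
      rw [Pi.smul_apply, Pi.single_eq_of_ne (fun h => ha ⟨b, h.symm⟩), smul_zero]
  change shear y (fun b => ⟨_, hmem b⟩) x ∈ L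
  rw [shear_apply]
  nth_rewrite 1 [h1]
  rw [← Finset.sum_add_distrib]
  refine L.sum_mem fun b _ => ?_
  rw [← smul_add, add_sub_cancel]
  exact L.smul_mem _ (g b).2

end Shears

/-! ### Forms singular along a line -/

section LineSingular

variable {K : Type*} [Field K]

theorem finrank_homogeneousSubmodule (r k : ℕ) :
    finrank K (homogeneousSubmodule (Fin r) K k) = (r + k - 1).choose k := by
  classical
  cases nonempty_fintype {α : Fin r →₀ ℕ // α.degree = k}
  have h1 : finrank K (homogeneousSubmodule (Fin r) K k) =
      finrank K ({α : Fin r →₀ ℕ // α.degree = k} →₀ K) := by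
    rw [homogeneousSubmodule_eq_finsupp_supported]
    exact (AddMonoidAlgebra.supportedEquivFinsupp (S := K) (R := K)
      {α : Fin r →₀ ℕ | α.degree = k}).finrank_eq
  rw [h1, finrank_finsupp_self]
  have h2 := Sym.card_sym_eq_choose (α := Fin r) k
  rw [Fintype.card_fin] at h2
  rw [← h2]
  exact Fintype.card_congr ((Sym.equivNatSum (Fin r) k).trans (Equiv.subtypeEquivRight fun P => by
    rfl)).symm

theorem pderiv_aeval {σ τ : Type*} [Fintype τ] (l : τ → MvPolynomial σ K) (i : σ)
    (p : MvPolynomial τ K) :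
    pderiv i (aeval l p) = ∑ j, aeval l (pderiv j p) * pderiv i (l j) := by
  classical
  induction p using MvPolynomial.induction_on with
  | C a => simp [algebraMap_eq]
  | add p q hp hq =>
    rw [map_add, map_add, hp, hq, ← Finset.sum_add_distrib]
    exact Finset.sum_congr rfl fun j _ => by rw [map_add, map_add, add_mul]
  | mul_X p k hp =>
    rw [map_mul, aeval_X, pderiv_mul, hp]
    simp only [pderiv_mul, map_add, map_mul, aeval_X, add_mul, Finset.sum_add_distrib]
    congr 1
    · rw [Finset.sum_mul]
      exact Finset.sum_congr rfl fun j _ => by ring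
    · simp [pderiv_X, Pi.single_apply]

theorem eval_pderiv_compForm {σ : Type*} [Fintype σ] {r i : ℕ} (π : (σ → K) →ₗ[K] (Fin r → K))
    (g : homogeneousSubmodule (Fin r) K i) (w : σ → K) (a : σ)
    (h : ∀ j, eval (π w) (pderiv j (g : MvPolynomial (Fin r) K)) = 0) :
    eval w (pderiv a (compForm π g : MvPolynomial σ K)) = 0 := by
  change eval w (pderiv a (aeval (linForm π) (g : MvPolynomial (Fin r) K))) = 0
  rw [pderiv_aeval, map_sum]
  refine Finset.sum_eq_zero fun j _ => ?_
  rw [map_mul, eval_aeval_linForm, h, zero_mul]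

/-- Singularity along a line is only required at nonzero vectors, so the values at the origin must
not be needed. -/
theorem eq_zero_of_eval_eq_zero [Infinite K] {σ : Type*} {p : MvPolynomial σ K} (j : σ)
    (h : ∀ w : σ → K, w j ≠ 0 → eval w p = 0) : p = 0 := by
  have h1 : X j * p = 0 := MvPolynomial.funext fun w => by
    rw [map_mul, eval_X, map_zero]
    by_cases hw : w j = 0
    · rw [hw, zero_mul]
    · rw [h w hw, mul_zero]
  exact (mul_eq_zero.1 h1).resolve_left (X_ne_zero j)

theorem pderiv_rename_eq_zero {σ τ : Type*} {y : σ → τ} {i : τ} (hi : i ∉ Set.range y)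
    (p : MvPolynomial σ K) : pderiv i (rename y p) = 0 := by
  classical
  refine pderiv_eq_zero_of_notMem_vars fun h => hi ?_
  obtain ⟨a, -, ha⟩ := Finset.mem_image.1 (vars_rename y p h)
  exact ⟨a, ha⟩

/-- `f` and its partial derivatives vanish at `v`. -/
def SingAt {σ : Type*} (f : MvPolynomial σ K) (v : σ → K) : Prop :=
  eval v f = 0 ∧ ∀ i, eval v (pderiv i f) = 0

/-- The forms that are singular along a coordinate subspace. -/
def singularForms {σ : Type*} {m : ℕ} (y : Fin m → σ) (d : ℕ) :
    Submodule K (homogeneousSubmodule σ K d) where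
  carrier := {f | ∀ w : σ → K, (∀ a ∉ Set.range y, w a = 0) → w ≠ 0 →
    SingAt (f : MvPolynomial σ K) w}
  zero_mem' := fun w _ _ => by simp [SingAt]
  add_mem' := fun {f g} hf hg w hw h0 => by
    obtain ⟨h1, h2⟩ := hf w hw h0
    obtain ⟨h3, h4⟩ := hg w hw h0
    simp [SingAt, h1, h2, h3, h4]
  smul_mem' := fun c f hf w hw h0 => by
    obtain ⟨h1, h2⟩ := hf w hw h0
    simp [SingAt, h1, h2]

/-- The forms `A + ∑ x_i B_i`, with `A` and `B_i` binary forms in the coordinates of the line and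
`x_i` the remaining variables, are a complement to count: on the line such a form restricts to `A`
and its derivative by `x_i` to `B_i`, so only `0` is singular along it. -/
theorem finrank_singularForms_add_le [Infinite K] {n d : ℕ} (hd : 1 ≤ d) (y : Fin 2 ↪ Fin (n + 1)) :
    finrank K (singularForms (K := K) y d) + ((d + 1) + (n - 1) * d) ≤
      finrank K (homogeneousSubmodule (Fin (n + 1)) K d) := by
  classical
  let J := {i : Fin (n + 1) // i ∉ Set.range y}
  let E := homogeneousSubmodule (Fin 2) K d × (J → homogeneousSubmodule (Fin 2) K (d - 1))
  let Ξ₀ : E →ₗ[K] MvPolynomial (Fin (n + 1)) K :=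
    LinearMap.coprod ((rename y).toLinearMap ∘ₗ (homogeneousSubmodule (Fin 2) K d).subtype)
      (∑ i : J, LinearMap.mulLeft K (X (i : Fin (n + 1))) ∘ₗ (rename y).toLinearMap ∘ₗ
        (homogeneousSubmodule (Fin 2) K (d - 1)).subtype ∘ₗ LinearMap.proj i)
  have hΞ₀ : ∀ x : E, Ξ₀ x = rename y (x.1 : MvPolynomial (Fin 2) K) +
      ∑ i : J, X (i : Fin (n + 1)) * rename y (x.2 i : MvPolynomial (Fin 2) K) := fun x => by
    rw [LinearMap.coprod_apply, LinearMap.sum_apply]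
    rfl
  have hhom : ∀ x, Ξ₀ x ∈ homogeneousSubmodule (Fin (n + 1)) K d := by
    intro x
    rw [hΞ₀]
    refine Submodule.add_mem _ (x.1.2.rename_isHomogeneous) (Submodule.sum_mem _ fun i _ => ?_)
    have := (isHomogeneous_X K (i : Fin (n + 1))).mul
      ((x.2 i).2.rename_isHomogeneous (f := y))
    rwa [Nat.add_sub_cancel' hd] at this
  let Ξ := Ξ₀.codRestrict _ hhom
  have key : ∀ x, Ξ x ∈ singularForms (K := K) y d → x = 0 := by
    intro x hx
    have hz : ∀ z : Fin 2 → K, z 0 ≠ 0 → ∃ w : Fin (n + 1) → K, (∀ a ∉ Set.range y, w a = 0) ∧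
        w ∘ y = z ∧ SingAt (Ξ₀ x) w := by
      intro z hz
      have h1 : Function.extend y z (0 : Fin (n + 1) → K) ∘ y = z := funext fun a => y.injective.extend_apply z _ a
      have h2 : ∀ a ∉ Set.range y, Function.extend y z (0 : Fin (n + 1) → K) a = 0 := fun a ha =>
        Function.extend_apply' z _ a ha
      refine ⟨Function.extend y z (0 : Fin (n + 1) → K), h2, h1, hx _ h2 fun h0 => hz ?_⟩
      rw [← h1, h0]
      rfl
    have hA : x.1 = 0 := by
      refine Subtype.ext (eq_zero_of_eval_eq_zero 0 fun z hz0 => ?_)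
      obtain ⟨w, hw, rfl, hs, -⟩ := hz z hz0
      rw [hΞ₀, map_add, map_sum, eval_rename, Finset.sum_eq_zero, add_zero] at hs
      · exact hs
      · intro i _
        rw [map_mul, eval_X, hw i i.2, zero_mul]
    have hB : x.2 = 0 := by
      ext1 i
      refine Subtype.ext (eq_zero_of_eval_eq_zero 0 fun z hz0 => ?_)
      obtain ⟨w, hw, rfl, -, hs⟩ := hz z hz0
      have h1 := hs i
      rw [hΞ₀, map_add, pderiv_rename_eq_zero i.2, zero_add, map_sum, map_sum,
        Finset.sum_eq_single i] at h1
      · simpa [pderiv_rename_eq_zero i.2, eval_rename] using h1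
      · intro k _ hk
        rw [pderiv_mul, pderiv_rename_eq_zero i.2, mul_zero, add_zero,
          pderiv_X_of_ne (fun h => hk (Subtype.ext h)), zero_mul, map_zero]
      · simp
    exact Prod.ext hA hB
  have hinj : Function.Injective Ξ := (injective_iff_map_eq_zero Ξ).2 fun x hx =>
    key x (by rw [hx]; exact Submodule.zero_mem _)
  have hdis : Disjoint (singularForms (K := K) y d) (LinearMap.range Ξ) := by
    rw [Submodule.disjoint_def]
    rintro _ h ⟨x, rfl⟩
    rw [key x h, map_zero]
  have h1 := Submodule.finrank_add_finrank_le_of_disjoint hdis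
  have hJ : Fintype.card J = n - 1 := by
    have : Fintype.card (Set.range y) = 2 := by
      rw [Set.card_range_of_injective y.injective, Fintype.card_fin]
    have h2 := Fintype.card_compl_set (Set.range y)
    rw [this, Fintype.card_fin] at h2
    have h3 : Fintype.card J = Fintype.card ((Set.range y)ᶜ : Set (Fin (n + 1))) :=
      Fintype.card_congr (Equiv.refl _)
    omega
  rw [LinearMap.finrank_range_of_inj hinj] at h1
  have h4 : finrank K E = (d + 1) + (n - 1) * d := by
    rw [Module.finrank_prod, Module.finrank_pi_fintype, Finset.sum_const, Finset.card_univ, hJ,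
      finrank_homogeneousSubmodule, finrank_homogeneousSubmodule, smul_eq_mul]
    congr 1
    · rw [show 2 + d - 1 = d + 1 by omega, Nat.choose_succ_self_right]
    · rw [show 2 + (d - 1) - 1 = d - 1 + 1 by omega, Nat.choose_succ_self_right,
        Nat.sub_add_cancel hd]
  rw [h4] at h1
  exact h1

theorem compForm_shear_neg [Infinite K] {m r i : ℕ} (y : Fin m → Fin r) (h : Fin m → offCoords K y)
    (g : homogeneousSubmodule (Fin r) K i) : g = compForm (shear y (-h)) (compForm (shear y h) g) :=
  Subtype.ext (MvPolynomial.funext fun w => by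
    rw [eval_compForm, eval_compForm, shear_shear_neg])

/-- The dimension of the space of forms that are singular along a line. -/
theorem sizeLE_singularAlongLine [Infinite K] {n d e : ℕ} (hd : 1 ≤ d)
    (he : finrank K (homogeneousSubmodule (Fin (n + 1)) K d) + 2 * (n - 1) ≤
      e + ((d + 1) + (n - 1) * d)) :
    SizeLE K {f : homogeneousSubmodule (Fin (n + 1)) K d | ∃ L : Submodule K (Fin (n + 1) → K),
      finrank K L = 2 ∧ ∀ v ∈ L, v ≠ 0 → SingAt (f : MvPolynomial (Fin (n + 1)) K) v} e := by
  have h1 : ∀ y : Fin 2 ↪ Fin (n + 1), SizeLE K {f : homogeneousSubmodule (Fin (n + 1)) K d |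
      ∃ G ∈ (singularForms (K := K) y d : Set (homogeneousSubmodule (Fin (n + 1)) K d)), ∃ h,
        f = compForm (shear y h) G} e := by
    intro y
    -- The shear contributes `2 (n - 1)` parameters, the dimension of the Grassmannian of lines.
    refine ((sizeLE_submodule (singularForms (K := K) y d)).compForm
      (fun h : Fin 2 → offCoords K y => shear y h) (shear_eq_affine y)).mono_right ?_
    have h2 := finrank_singularForms_add_le (K := K) hd y
    have h3 := finrank_offCoords (K := K) y.injective
    rw [Fintype.card_fin] at h3
    rw [Module.finrank_pi_fintype, Finset.sum_const, Finset.card_univ, Fintype.card_fin,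
      smul_eq_mul, show finrank K (offCoords K y) = n - 1 by omega]
    omega
  refine (SizeLE.iUnion h1).mono ?_
  rintro f ⟨L, hL, hf⟩
  obtain ⟨y, h, hy⟩ := exists_shear_mem L hL
  refine Set.mem_iUnion.2 ⟨y, compForm (shear y h) f, fun w hw hw0 => ?_, -h,
    compForm_shear_neg y h f⟩
  have h2 := hf _ (hy w hw) fun h0 => hw0 (by
    rw [← shear_neg_shear y h w, h0, map_zero])
  exact ⟨by rw [eval_compForm]; exact h2.1, fun a => eval_pderiv_compForm _ f w a h2.2⟩

end LineSingular

/-! ### Expansion of a form at a coordinate point -/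

section Pieces

variable {K : Type*} [Field K] {n d : ℕ}

variable (K) in
/-- Substituting `1` for the variable with index `j`. -/
def dehom (j : Fin (n + 1)) : MvPolynomial (Fin (n + 1)) K →ₐ[K] MvPolynomial (Fin n) K :=
  aeval (j.insertNth (α := fun _ => MvPolynomial (Fin n) K) 1 X)

theorem eval_dehom (j : Fin (n + 1)) (p : MvPolynomial (Fin (n + 1)) K) (w : Fin n → K) :
    eval w (dehom K j p) = eval (j.insertNth (α := fun _ => K) 1 w) p := by
  have : (aeval (R := K) w).comp (dehom K j) = aeval (j.insertNth (α := fun _ => K) 1 w) := by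
    refine algHom_ext fun k => ?_
    rw [AlgHom.comp_apply, dehom, aeval_X, aeval_X]
    refine Fin.succAboveCases j ?_ (fun k => ?_) k
    · rw [Fin.insertNth_apply_same, Fin.insertNth_apply_same, map_one]
    · rw [Fin.insertNth_apply_succAbove, Fin.insertNth_apply_succAbove, aeval_X]
  exact DFunLike.congr_fun this p

theorem dehom_rename (j : Fin (n + 1)) (p : MvPolynomial (Fin n) K) :
    dehom K j (rename j.succAbove p) = p := by
  rw [dehom, aeval_rename, Fin.insertNth_comp_succAbove, aeval_X_left_apply]

variable (K d) in
/-- The coefficients of the powers of the variable with index `j`, as forms in the other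
variables. -/
def pieces (j : Fin (n + 1)) :
    homogeneousSubmodule (Fin (n + 1)) K d →ₗ[K] FormTuple K (Fin n) d :=
  LinearMap.pi fun k => (homogeneousComponent (k : ℕ) ∘ₗ (dehom K j).toLinearMap ∘ₗ
    (homogeneousSubmodule (Fin (n + 1)) K d).subtype).codRestrict _
      fun _ => homogeneousComponent_isHomogeneous _ _

theorem pieces_coe (j : Fin (n + 1)) (G : homogeneousSubmodule (Fin (n + 1)) K d)
    (k : Fin (d + 1)) : (pieces K d j G k : MvPolynomial (Fin n) K) =
      homogeneousComponent (k : ℕ) (dehom K j (G : MvPolynomial (Fin (n + 1)) K)) := rfl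

variable (K d) in
/-- The form with given coefficients of the powers of the variable with index `j`. -/
def ofPieces (j : Fin (n + 1)) :
    FormTuple K (Fin n) d →ₗ[K] homogeneousSubmodule (Fin (n + 1)) K d :=
  (∑ k : Fin (d + 1), LinearMap.mulLeft K (X j ^ (d - k : ℕ)) ∘ₗ
    (rename j.succAbove).toLinearMap ∘ₗ (homogeneousSubmodule (Fin n) K (k : ℕ)).subtype ∘ₗ
      LinearMap.proj k).codRestrict _ fun F => by
    rw [LinearMap.sum_apply]
    refine Submodule.sum_mem _ fun k _ => ?_
    have := (isHomogeneous_X_pow (R := K) j (d - k : ℕ)).mul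
      ((F k).2.rename_isHomogeneous (f := j.succAbove))
    rwa [Nat.sub_add_cancel (Nat.lt_succ_iff.1 k.2)] at this

theorem ofPieces_coe (j : Fin (n + 1)) (F : FormTuple K (Fin n) d) :
    (ofPieces K d j F : MvPolynomial (Fin (n + 1)) K) =
      ∑ k : Fin (d + 1), X j ^ (d - k : ℕ) * rename j.succAbove (F k : MvPolynomial (Fin n) K) := by
  rw [ofPieces, LinearMap.codRestrict_apply, LinearMap.sum_apply]
  rfl

theorem pieces_ofPieces (j : Fin (n + 1)) (F : FormTuple K (Fin n) d) :
    pieces K d j (ofPieces K d j F) = F := by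
  ext1 k
  apply Subtype.ext
  rw [pieces_coe, ofPieces_coe, map_sum, map_sum, Finset.sum_eq_single k]
  · rw [map_mul, map_pow, dehom_rename, dehom, aeval_X, Fin.insertNth_apply_same, one_pow, one_mul,
      homogeneousComponent_of_mem (F k).2, if_pos rfl]
  · intro l _ hl
    rw [map_mul, map_pow, dehom_rename, dehom, aeval_X, Fin.insertNth_apply_same, one_pow, one_mul,
      homogeneousComponent_of_mem (F l).2, if_neg fun h => hl (Fin.ext h.symm)]
  · simp

theorem finrank_formTuple_eq :
    finrank K (FormTuple K (Fin n) d) =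
      finrank K (homogeneousSubmodule (Fin (n + 1)) K d) := by
  have h : ∀ d : ℕ, ∑ k : Fin (d + 1), (n + (k : ℕ) - 1).choose (k : ℕ) = (n + d).choose d := by
    intro d
    induction d with
    | zero => simp
    | succ d ih =>
      rw [Fin.sum_univ_castSucc]
      simp only [Fin.val_castSucc, Fin.val_last]
      rw [ih, show n + (d + 1) - 1 = n + d by omega, ← add_assoc, Nat.choose_succ_succ]
  rw [Module.finrank_pi_fintype, finrank_homogeneousSubmodule]
  simp only [finrank_homogeneousSubmodule]
  rw [h, show n + 1 + d - 1 = n + d by omega]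

/-- `ofPieces` is injective by the other composition, and both spaces have the same dimension. -/
theorem ofPieces_pieces (j : Fin (n + 1)) (G : homogeneousSubmodule (Fin (n + 1)) K d) :
    ofPieces K d j (pieces K d j G) = G := by
  have hinj : Function.Injective (ofPieces K d j) :=
    Function.LeftInverse.injective (pieces_ofPieces j)
  obtain ⟨F, rfl⟩ :=
    (LinearMap.injective_iff_surjective_of_finrank_eq_finrank finrank_formTuple_eq).1 hinj G
  rw [pieces_ofPieces]

theorem eval_pieces_eq_zero [Infinite K] {j : Fin (n + 1)}
    {G : homogeneousSubmodule (Fin (n + 1)) K d} {w : Fin n → K}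
    (h : ∀ c : K, eval (j.insertNth (α := fun _ => K) 1 (c • w))
      (G : MvPolynomial (Fin (n + 1)) K) = 0) (k : Fin (d + 1)) :
    eval w (pieces K d j G k : MvPolynomial (Fin n) K) = 0 :=
  eval_homogeneousComponent_eq_zero (q := dehom K j (G : MvPolynomial (Fin (n + 1)) K))
    (fun c _ => by rw [eval_dehom]; exact h c) k

theorem insertNth_one_zero (j : Fin (n + 1)) :
    j.insertNth (α := fun _ => K) 1 0 = (Pi.single j 1 : Fin (n + 1) → K) := by
  refine Fin.insertNth_eq_iff.2 ⟨by rw [Pi.single_eq_same], funext fun k => ?_⟩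
  rw [Fin.removeNth, Pi.single_eq_of_ne (Fin.succAbove_ne j k)]
  rfl

theorem pieces_zero {j : Fin (n + 1)} {G : homogeneousSubmodule (Fin (n + 1)) K d}
    (h : eval (Pi.single j 1 : Fin (n + 1) → K) (G : MvPolynomial (Fin (n + 1)) K) = 0) :
    pieces K d j G 0 = 0 := by
  apply Subtype.ext
  rw [pieces_coe, Fin.val_zero, homogeneousComponent_zero, ← constantCoeff_eq,
    ← MvPolynomial.eval_zero, eval_dehom, insertNth_one_zero, h, map_zero]
  rfl

theorem eval_zero_of_isHomogeneous {σ : Type*} {p : MvPolynomial σ K} {k : ℕ}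
    (hp : p.IsHomogeneous k) (hk : 1 ≤ k) : eval (0 : σ → K) p = 0 := by
  have h := IsHomogeneous.eval_const_smul hp (0 : K) (0 : σ → K)
  rwa [zero_smul, zero_pow (by omega), zero_mul] at h

/-- The remaining pieces have degree at least two in the variables that vanish at the point, so they
vanish there together with their first derivatives. -/
theorem singAt_of_pieces_eq_zero (hd : 1 ≤ d) {j : Fin (n + 1)}
    {G : homogeneousSubmodule (Fin (n + 1)) K d} (h0 : pieces K d j G 0 = 0)
    (h1 : pieces K d j G ⟨1, by omega⟩ = 0) :
    SingAt (G : MvPolynomial (Fin (n + 1)) K) (Pi.single j 1) := by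
  let e : Fin (n + 1) → K := Pi.single j 1
  have he : e ∘ j.succAbove = 0 := funext fun k => Pi.single_eq_of_ne (Fin.succAbove_ne j k) _
  have key : ∀ k : Fin (d + 1), ∀ R : MvPolynomial (Fin n) K, R = pieces K d j G k →
      SingAt (rename j.succAbove R) e := by
    rintro k R hR
    by_cases hk : (k : ℕ) ≤ 1
    · have : R = 0 := by
        rcases Nat.le_one_iff_eq_zero_or_eq_one.1 hk with h | h
        · rw [hR, show k = 0 from Fin.ext h, h0]
          rfl
        · rw [hR, show k = ⟨1, by omega⟩ from Fin.ext h, h1]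
          rfl
      simp [this, SingAt]
    · have hhom : R.IsHomogeneous k := by
        rw [hR]
        exact (pieces K d j G k).2
      refine ⟨?_, fun a => ?_⟩
      · rw [eval_rename, he, eval_zero_of_isHomogeneous hhom (by omega)]
      · refine Fin.succAboveCases j ?_ (fun b => ?_) a
        · rw [pderiv_rename_eq_zero (fun ⟨b, hb⟩ => Fin.succAbove_ne j b hb), map_zero]
        · rw [pderiv_rename Fin.succAbove_right_injective, eval_rename, he,
            eval_zero_of_isHomogeneous hhom.pderiv (by omega)]
  have hG := congrArg Subtype.val (ofPieces_pieces j G)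
  rw [ofPieces_coe] at hG
  rw [← hG]
  refine ⟨?_, fun a => ?_⟩
  · rw [map_sum]
    refine Finset.sum_eq_zero fun k _ => ?_
    rw [map_mul, (key k _ rfl).1, mul_zero]
  · rw [map_sum, map_sum]
    refine Finset.sum_eq_zero fun k _ => ?_
    rw [pderiv_mul, map_add, map_mul, map_mul, (key k _ rfl).1, (key k _ rfl).2, mul_zero, mul_zero,
      add_zero]

end Pieces

/-! ### Counting the tuples with too many common zeros -/

section ExcessTuples

variable {K : Type*} [Field K]

/-- Binomial coefficients increase up to the middle; the other half follows by symmetry. -/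
theorem choose_two_le_choose {n i : ℕ} (hi : 2 ≤ i) (hin : i + 2 ≤ n) :
    n.choose 2 ≤ n.choose i := by
  have key : ∀ k, 2 ≤ k → k ≤ n / 2 → n.choose 2 ≤ n.choose k := by
    intro k hk
    induction k, hk using Nat.le_induction with
    | base => exact fun _ => le_rfl
    | succ k _ ih => exact fun h => (ih (by omega)).trans (Nat.choose_le_succ_of_lt_half_left h)
  by_cases h : i ≤ n / 2
  · exact key i hi h
  · rw [← Nat.choose_symm (show i ≤ n by omega)]
    exact key (n - i) (by omega) (by omega)

/-- The tuples of forms `F` of degrees `1, …, d` such that the dimension of the common zeros of all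
the forms exceeds the expected one by more than it does for the linear form. -/
def excessTuples (K : Type*) [Field K] (n d t : ℕ) : Set (FormTuple K (Fin n) d) :=
  {F | F 0 = 0 ∧ AvoidsLE (F.zeros 1) (n - 1 + t) ∧ ¬ AvoidsLE (F.zeros d) (n - d + t)}

/-- The dimension is as allowed after degree `1` and too large after degree `d`, so some degree `i ≥
2` is the first to fail. There `sizeLE_badForms` applies with `s = n - i + t`, and forms of degree
`i` in `s + 1` variables have dimension `(n + t choose i)`. -/
theorem sizeLE_excessTuples [IsAlgClosed K] {n d t e : ℕ} (hd : 1 ≤ d) (hn : d + 2 ≤ n)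
    (he : finrank K (FormTuple K (Fin n) d) ≤ e + 1 + n.choose 2) :
    SizeLE K (excessTuples K n d t) e := by
  have h1 : ∀ i : {i : Fin (d + 1) // 2 ≤ (i : ℕ)},
      SizeLE K {F : FormTuple K (Fin n) d | F 0 = 0 ∧
        AvoidsLE (F.zeros ((i : Fin (d + 1)) - 1 : ℕ)) (n - (i : Fin (d + 1)) + t + 1) ∧
        ¬ AvoidsLE (F.zeros ((i : Fin (d + 1)) : ℕ)) (n - (i : Fin (d + 1)) + t)} e := by
    rintro ⟨⟨i, hid⟩, hi⟩
    change 2 ≤ i at hi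
    refine sizeLE_badForms (i := i) (by omega) (by omega) ?_ he
    rw [finrank_homogeneousSubmodule]
    exact (choose_two_le_choose hi (by omega)).trans (Nat.choose_le_choose i (by simp only; omega))
  refine (SizeLE.iUnion h1).mono ?_
  rintro F ⟨h0, ha, hb⟩
  have key : ∀ m, 1 ≤ m → m ≤ d → ¬ AvoidsLE (F.zeros m) (n - m + t) → ∃ i, 2 ≤ i ∧ i ≤ d ∧
      AvoidsLE (F.zeros (i - 1)) (n - i + t + 1) ∧ ¬ AvoidsLE (F.zeros i) (n - i + t) := by
    intro m hm
    induction m, hm using Nat.le_induction with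
    | base => exact fun _ h => absurd ha h
    | succ m hm ih =>
      intro hmd h
      by_cases h' : AvoidsLE (F.zeros m) (n - m + t)
      · refine ⟨m + 1, by omega, hmd, ?_, h⟩
        rwa [Nat.add_sub_cancel, show n - (m + 1) + t + 1 = n - m + t by omega]
      · exact ih (by omega) h'
  obtain ⟨i, hi, hid, h⟩ := key d hd le_rfl hb
  exact Set.mem_iUnion.2 ⟨⟨⟨i, by omega⟩, hi⟩, h0, h⟩

/-- The additional `n` is the dimension of the space of shears that move the coordinate point. -/
theorem sizeLE_excessForms [IsAlgClosed K] {n d t e : ℕ} (hd : 1 ≤ d) (hn : d + 2 ≤ n)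
    (he : finrank K (homogeneousSubmodule (Fin (n + 1)) K d) ≤ e + 1 + n.choose 2) :
    SizeLE K {f : homogeneousSubmodule (Fin (n + 1)) K d | ∃ (y : Fin 1 ↪ Fin (n + 1))
      (h : Fin 1 → offCoords K y), pieces K d (y 0) (compForm (shear y h) f) ∈
        excessTuples K n d t} (e + n) := by
  have h1 : ∀ y : Fin 1 ↪ Fin (n + 1), SizeLE K {f : homogeneousSubmodule (Fin (n + 1)) K d |
      ∃ G ∈ ofPieces K d (y 0) '' excessTuples K n d t, ∃ h, f = compForm (shear y h) G}
      (e + n) := by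
    intro y
    have h2 : SizeLE K (ofPieces K d (y 0) '' excessTuples K n d t) e := by
      refine SizeLE.of_subset_range (v := fun F : excessTuples K n d t => ofPieces K d (y 0) F)
        (GrowthLE.mono (sizeLE_excessTuples hd hn (finrank_formTuple_eq.trans_le he))
          (coordAlg_linear_le Subtype.val (ofPieces K d (y 0)))) ?_
      rintro _ ⟨F, hF, rfl⟩
      exact ⟨⟨F, hF⟩, rfl⟩
    refine (h2.compForm (fun h : Fin 1 → offCoords K y => shear y h)
      (shear_eq_affine y)).mono_right ?_
    have h3 := finrank_offCoords (K := K) y.injective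
    rw [Fintype.card_fin] at h3
    rw [Module.finrank_pi_fintype, Finset.sum_const, Finset.card_univ, Fintype.card_fin,
      smul_eq_mul]
    omega
  refine (SizeLE.iUnion h1).mono ?_
  rintro f ⟨y, h, hf⟩
  exact Set.mem_iUnion.2 ⟨y, compForm (shear y h) f, ⟨_, hf, ofPieces_pieces _ _⟩, -h,
    compForm_shear_neg y h f⟩

theorem smul_mem_excessTuples {n d t : ℕ} {F : FormTuple K (Fin n) d}
    (hF : F ∈ excessTuples K n d t) {c : K} (hc : c ≠ 0) : c • F ∈ excessTuples K n d t := by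
  have h : ∀ i, (c • F).zeros i = F.zeros i := fun i => by
    ext w
    refine forall_congr' fun k => forall_congr' fun _ => forall_congr' fun _ => ?_
    simp [hc]
  refine ⟨?_, ?_, ?_⟩
  · rw [Pi.smul_apply, hF.1, smul_zero]
  · rw [h]
    exact hF.2.1
  · rw [h]
    exact hF.2.2

end ExcessTuples

/-! ### Lines through a point as common zeros of the pieces -/

section LinesThrough

variable {K : Type*} [Field K] {n d : ℕ} {X : Hypersurface K n d} {p : ℙ K (Fin (n + 1) → K)}

theorem eqn_isHomogeneous (X : Hypersurface K n d) : X.eqn.IsHomogeneous d := X.rep.2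

/-- Equations on the quotient by `p` come from a linear section `s`: for every functional `φ`, `u ↦
f (s u + φ u p)` is homogeneous in `u`. Varying `φ` reaches, up to scalars, every vector of the line
outside `p`. -/
theorem isClosed_linesThrough (hp : X.HasPoint p) : IsClosed (X.linesThrough p) := by
  obtain ⟨s, hs⟩ := LinearMap.exists_rightInverse_of_surjective p.submodule.mkQ
    (LinearMap.range_eq_top.2 (Submodule.mkQ_surjective _))
  replace hs : ∀ u, p.submodule.mkQ (s u) = u := fun u => DFunLike.congr_fun hs u
  let q : Dual K ((Fin (n + 1) → K) ⧸ p.submodule) → PolyOn K ((Fin (n + 1) → K) ⧸ p.submodule) :=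
    fun φ => aeval (fun i => MvPolynomial.X (LinearMap.proj i ∘ₗ (s + φ.smulRight p.rep))) X.eqn
  have hq : ∀ φ u, (q φ).value u = eval (s u + φ u • p.rep) X.eqn := by
    intro φ u
    have : (aeval (R := K) fun ψ : Dual K ((Fin (n + 1) → K) ⧸ p.submodule) => ψ u).comp
        (aeval (fun i => MvPolynomial.X (LinearMap.proj i ∘ₗ (s + φ.smulRight p.rep)))) =
        aeval (s u + φ u • p.rep) := by
      refine algHom_ext fun j => ?_
      rw [AlgHom.comp_apply, aeval_X, aeval_X, aeval_X]
      rfl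
    exact DFunLike.congr_fun this X.eqn
  refine isClosed_iff_zeroLocus.2 ⟨Set.range q, ?_, ?_⟩
  · rintro _ ⟨φ, rfl⟩
    have := IsHomogeneous.aeval (eqn_isHomogeneous X)
      (fun i => MvPolynomial.X (R := K) (LinearMap.proj i ∘ₗ (s + φ.smulRight p.rep)))
      (fun i => isHomogeneous_X _ _)
    exact ⟨_, this⟩
  have hprep : p.submodule.mkQ p.rep = 0 := by
    rw [Submodule.mkQ_apply, Submodule.Quotient.mk_eq_zero, Projectivization.submodule_eq]
    exact Submodule.mem_span_singleton_self _
  ext ℓ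
  constructor
  · rintro hℓ _ ⟨φ, rfl⟩
    rw [hq]
    refine hℓ _ ?_
    rw [map_add, hs, map_smul, hprep, smul_zero, add_zero, ℓ.submodule_eq]
    exact Submodule.mem_span_singleton_self _
  · intro hℓ v hv
    rw [ℓ.submodule_eq] at hv
    obtain ⟨c, hc⟩ := Submodule.mem_span_singleton.1 hv
    have h1 : v - c • s ℓ.rep ∈ p.submodule := by
      rw [← Submodule.Quotient.mk_eq_zero, ← Submodule.mkQ_apply, map_sub, map_smul, hs, hc,
        sub_self]
    obtain ⟨a, ha⟩ := Submodule.mem_span_singleton.1 (p.submodule_eq.le h1)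
    by_cases hc0 : c = 0
    · rw [hc0, zero_smul, sub_zero] at ha
      rw [← ha]
      rw [Hypersurface.Vanishes, IsHomogeneous.eval_const_smul (eqn_isHomogeneous X),
        show eval p.rep X.eqn = 0 from hp, mul_zero]
    · obtain ⟨φ, hφ⟩ : ∃ φ : Dual K ((Fin (n + 1) → K) ⧸ p.submodule), φ ℓ.rep ≠ 0 := by
        by_contra! h
        exact ℓ.rep_nonzero ((Module.forall_dual_apply_eq_zero_iff K _).1 h)
      have h2 := hℓ _ ⟨(c⁻¹ * a * (φ ℓ.rep)⁻¹) • φ, rfl⟩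
      rw [hq, LinearMap.smul_apply, smul_eq_mul, inv_mul_cancel_right₀ hφ] at h2
      have h3 : v = c • (s ℓ.rep + (c⁻¹ * a) • p.rep) := by
        rw [smul_add, smul_smul, mul_inv_cancel_left₀ hc0, ha, add_sub_cancel]
      rw [h3, Hypersurface.Vanishes, IsHomogeneous.eval_const_smul (eqn_isHomogeneous X), h2,
        mul_zero]

theorem exists_shear_mem_point (p : ℙ K (Fin (n + 1) → K)) :
    ∃ (y : Fin 1 ↪ Fin (n + 1)) (h : Fin 1 → offCoords K y),
      ∀ a : K, shear y h (Pi.single (y 0) a) ∈ p.submodule := by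
  obtain ⟨y, h, hy⟩ := exists_shear_mem p.submodule p.finrank_submodule
  exact ⟨y, h, fun a => hy _ fun b hb => Pi.single_eq_of_ne (fun h => hb ⟨0, h.symm⟩) _⟩

variable {y : Fin 1 ↪ Fin (n + 1)} {h : Fin 1 → offCoords K y}

theorem eq_single_of_removeNth_eq_zero {j : Fin (n + 1)} {x : Fin (n + 1) → K}
    (hx : x ∘ j.succAbove = 0) : x = Pi.single j (x j) := by
  ext k
  refine Fin.succAboveCases j ?_ (fun b => ?_) k
  · rw [Pi.single_eq_same]
  · rw [Pi.single_eq_of_ne (Fin.succAbove_ne j b)]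
    exact congrFun hx b

/-- After the shear, dropping one coordinate identifies the quotient by `p` with `K ^ n`. On a line
contained in `X` all pieces vanish, so a projection avoiding their common zeros also avoids the cone
of lines. -/
theorem topologicalKrullDim_linesThrough_le [IsAlgClosed K] (hp : X.HasPoint p)
    (hy : ∀ a : K, shear y h (Pi.single (y 0) a) ∈ p.submodule) {k : ℕ}
    (hk : AvoidsLE ((pieces K d (y 0) (compForm (shear y h) X.rep)).zeros d) k) :
    topologicalKrullDim (X.linesThrough p) + 1 ≤ k := by
  obtain ⟨π, hπ⟩ := hk
  let θ : (Fin (n + 1) → K) →ₗ[K] (Fin n → K) :=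
    LinearMap.funLeft K K (y 0).succAbove ∘ₗ shear y (-h)
  have hker : p.submodule = LinearMap.ker θ := by
    have hle : LinearMap.ker θ ≤ p.submodule := by
      intro x hx
      have h1 := eq_single_of_removeNth_eq_zero (j := y 0) (x := shear y (-h) x)
        (LinearMap.mem_ker.1 hx)
      rw [← shear_shear_neg y h x, h1]
      exact hy _
    have hne : shear y h (Pi.single (y 0) 1) ≠ 0 := by
      intro h0
      have h1 := shear_neg_shear y h (Pi.single (y 0) 1)
      rw [h0, map_zero] at h1
      have h2 := congrFun h1 (y 0)
      rw [Pi.single_eq_same] at h2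
      exact zero_ne_one h2
    have hmem : shear y h (Pi.single (y 0) 1) ∈ LinearMap.ker θ := by
      rw [LinearMap.mem_ker, LinearMap.comp_apply, shear_neg_shear]
      exact funext fun b => Pi.single_eq_of_ne (Fin.succAbove_ne (y 0) b) _
    refine (Submodule.eq_of_le_of_finrank_le hle ?_).symm
    rw [p.finrank_submodule]
    exact Submodule.one_le_finrank_iff.2 fun h0 => hne ((Submodule.eq_bot_iff _).1 h0 _ hmem)
  refine topologicalKrullDim_add_one_le (isClosed_linesThrough hp)
    (π ∘ₗ p.submodule.liftQ θ hker.le) ?_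
  rintro u ⟨hu, hℓ⟩ h0
  obtain ⟨x, rfl⟩ := p.submodule.mkQ_surjective u
  apply hu
  rw [LinearMap.comp_apply, Submodule.mkQ_apply, Submodule.liftQ_apply] at h0
  rw [Submodule.mkQ_apply, Submodule.Quotient.mk_eq_zero, hker, LinearMap.mem_ker]
  refine hπ _ (fun k _ _ => eval_pieces_eq_zero (fun c => ?_) k) h0
  rw [eval_compForm]
  refine hℓ _ ?_
  rw [Projectivization.submodule_mk, Submodule.mem_span_singleton]
  refine ⟨c, ?_⟩
  -- The two vectors differ only in the coordinate `y 0`, that is, by a vector which the shear sends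
  -- into `p`.
  have h1 := eq_single_of_removeNth_eq_zero (j := y 0) (x := (y 0).insertNth (α := fun _ => K) 1
    (c • θ x) - c • shear y (-h) x) (by
      ext b
      simp [θ, LinearMap.funLeft_apply])
  have h2 : shear y h ((y 0).insertNth (α := fun _ => K) 1 (c • θ x)) - c • x ∈ p.submodule := by
    have h3 := hy (((y 0).insertNth (α := fun _ => K) 1 (c • θ x) - c • shear y (-h) x) (y 0))
    rwa [← h1, map_sub, map_smul, shear_shear_neg] at h3
  rw [← map_smul, eq_comm, ← sub_eq_zero, ← map_sub, Submodule.mkQ_apply,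
    Submodule.Quotient.mk_eq_zero]
  exact h2

end LinesThrough

/-! ### Sharp hypersurfaces and the codimension bound -/

section Sharp

variable {K : Type*} [Field K] {n d : ℕ}

theorem AvoidsLE.of_forall (W : Set (Fin n → K)) {r : ℕ} (hr : n = r) : AvoidsLE W r := by
  subst hr
  exact ⟨LinearMap.id, fun w _ hw => hw⟩

/-- Projection from a vector outside the hyperplane of the linear form is injective on that
hyperplane. -/
theorem avoidsLE_of_ne_zero [Infinite K] {F : FormTuple K (Fin n) d} (hd : 1 ≤ d)
    (hF : F ⟨1, by omega⟩ ≠ 0) : AvoidsLE (F.zeros 1) (n - 1) := by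
  obtain ⟨w, hw⟩ : ∃ w, eval w (F ⟨1, by omega⟩ : MvPolynomial (Fin n) K) ≠ 0 := by
    by_contra! h
    exact hF (Subtype.ext (MvPolynomial.funext fun w => by
      rw [h w, ZeroMemClass.coe_zero, map_zero]))
  have hw0 : w ≠ 0 := by
    rintro rfl
    exact hw (eval_zero_of_isHomogeneous (F ⟨1, by omega⟩).2 le_rfl)
  have hfr : finrank K ((Fin n → K) ⧸ (K ∙ w)) = finrank K (Fin (n - 1) → K) := by
    have h1 := Submodule.finrank_quotient_add_finrank (K ∙ w)
    rw [finrank_span_singleton hw0] at h1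
    simp only [finrank_fin_fun] at h1 ⊢
    omega
  refine ⟨(LinearEquiv.ofFinrankEq _ _ hfr : _ →ₗ[K] _) ∘ₗ (K ∙ w).mkQ, fun v hv h0 => ?_⟩
  have h1 : v ∈ K ∙ w := by simpa using h0
  obtain ⟨c, rfl⟩ := Submodule.mem_span_singleton.1 h1
  have h2 := hv ⟨1, by omega⟩ le_rfl le_rfl
  rw [IsHomogeneous.eval_const_smul (F ⟨1, by omega⟩).2] at h2
  have hc : c = 0 := by simpa using (mul_eq_zero.1 h2).resolve_right hw
  rw [hc, zero_smul]

theorem SingAt.smul {σ : Type*} {f : MvPolynomial σ K} (hf : f.IsHomogeneous d) {v : σ → K}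
    (h : SingAt f v) (c : K) : SingAt f (c • v) :=
  ⟨by rw [hf.eval_const_smul, h.1, mul_zero], fun i => by
    rw [hf.pderiv.eval_const_smul, h.2, mul_zero]⟩

theorem add_natCast_le_of_add_one_le {D : WithBot ℕ∞} {k m n : ℕ} (h : D + 1 ≤ k)
    (hn : k + m ≤ n + 1) : D + m ≤ n := by
  induction D with
  | bot => simp
  | coe D =>
    induction D with
    | top => exact absurd (WithBot.coe_le_coe.1 h : (⊤ : ℕ∞) + 1 ≤ k) (by simp)
    | coe D =>
      have h1 : D + 1 ≤ k := by exact_mod_cast h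
      have h2 : D + m ≤ n := by omega
      exact_mod_cast h2

/-- At a smooth point the linear piece is nonzero, and its zeros have dimension `n - 1`, so `t = 0`.
At a singular point `t = 1`: the allowed dimension is one larger throughout, and the condition on
the linear piece is vacuous. -/
theorem exists_mem_excessTuples_of_not_levelPoint [IsAlgClosed K] (hd : 1 ≤ d) (hn : d ≤ n)
    {X : Hypersurface K n d} {p : ℙ K (Fin (n + 1) → K)} (hp : X.HasPoint p)
    (hlev : ¬ X.LevelPoint p) : ∃ (t : Fin 2) (y : Fin 1 ↪ Fin (n + 1))
      (h : Fin 1 → offCoords K y),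
      pieces K d (y 0) (compForm (shear y h) X.rep) ∈ excessTuples K n d t := by
  obtain ⟨y, h, hy⟩ := exists_shear_mem_point p
  have hspan := fun a => Submodule.mem_span_singleton.1
    (p.submodule_eq ▸ hy a : shear y h (Pi.single (y 0) a) ∈ K ∙ p.rep)
  have h0 : pieces K d (y 0) (compForm (shear y h) X.rep) 0 = 0 := by
    refine pieces_zero ?_
    obtain ⟨c, hc⟩ := hspan 1
    rw [eval_compForm, ← hc, IsHomogeneous.eval_const_smul X.rep.2]
    rw [show eval p.rep (X.rep : MvPolynomial (Fin (n + 1)) K) = 0 from hp, mul_zero]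
  by_cases hs : X.SingularAt p
  · refine ⟨1, y, h, h0, AvoidsLE.of_forall _ (by simp; omega), fun hk => hlev (Or.inr ⟨hs, ?_⟩)⟩
    exact add_natCast_le_of_add_one_le (topologicalKrullDim_linesThrough_le hp hy hk)
      (by simp; omega)
  · refine ⟨0, y, h, h0, avoidsLE_of_ne_zero hd fun h1 => hs ?_, fun hk => hlev (Or.inl ⟨hs, ?_⟩)⟩
    · have h2 := singAt_of_pieces_eq_zero hd h0 h1
      obtain ⟨c, hc⟩ := hspan 1
      have h3 : SingAt X.eqn (c • p.rep) := by
        rw [hc]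
        change SingAt (X.rep : MvPolynomial (Fin (n + 1)) K) _
        rw [compForm_shear_neg y h X.rep]
        refine ⟨?_, fun a => eval_pderiv_compForm _ _ _ a fun b => ?_⟩
        · rw [eval_compForm, shear_neg_shear]
          exact h2.1
        · rw [shear_neg_shear]
          exact h2.2 b
      have hc0 : c ≠ 0 := by
        rintro rfl
        have h4 := shear_neg_shear y h (Pi.single (y 0) 1)
        rw [← hc, zero_smul, map_zero] at h4
        have h5 := congrFun h4 (y 0)
        rw [Pi.single_eq_same] at h5
        exact zero_ne_one h5
      have h4 := h3.smul (eqn_isHomogeneous X) c⁻¹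
      rwa [smul_smul, inv_mul_cancel₀ hc0, one_smul] at h4
    · exact add_natCast_le_of_add_one_le (topologicalKrullDim_linesThrough_le hp hy hk)
        (by simp; omega)

/-- The equations of sharp hypersurfaces. -/
theorem cone_sharp_subset [IsAlgClosed K] (hd : 1 ≤ d) (hn : d ≤ n) :
    cone {X : Hypersurface K n d | X.Sharp} ⊆
      {f : homogeneousSubmodule (Fin (n + 1)) K d | ∃ L : Submodule K (Fin (n + 1) → K),
        finrank K L = 2 ∧ ∀ v ∈ L, v ≠ 0 → SingAt (f : MvPolynomial (Fin (n + 1)) K) v} ∪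
      ⋃ t : Fin 2, {f : homogeneousSubmodule (Fin (n + 1)) K d | ∃ (y : Fin 1 ↪ Fin (n + 1))
        (h : Fin 1 → offCoords K y), pieces K d (y 0) (compForm (shear y h) f) ∈
          excessTuples K n d t} := by
  rintro f ⟨hf, hX⟩
  obtain ⟨X, hX', a, ha⟩ : ∃ X : Hypersurface K n d, X.Sharp ∧ ∃ a : Kˣ, a • f = X.rep :=
    ⟨_, hX, Projectivization.exists_smul_eq_mk_rep K f hf⟩
  have hfX : f = (a⁻¹ : K) • X.rep := by
    rw [← ha, Units.smul_def, smul_smul, inv_mul_cancel₀ a.ne_zero, one_smul]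
  have ha0 : (a⁻¹ : K) ≠ 0 := inv_ne_zero a.ne_zero
  by_cases hL : X.SingularAlongLine
  · obtain ⟨L, hL, h⟩ := hL
    refine Or.inl ⟨L, hL, fun v hv hv0 => ?_⟩
    obtain ⟨h1, h2⟩ := h v hv hv0
    change eval v (X.rep : MvPolynomial (Fin (n + 1)) K) = 0 at h1
    change ∀ i, eval v (pderiv i (X.rep : MvPolynomial (Fin (n + 1)) K)) = 0 at h2
    rw [hfX]
    simp [SingAt, h1, h2]
  · have h1 : ¬ (¬ X.SingularAlongLine ∧ ∀ p, X.HasPoint p → X.LevelPoint p) := hX'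
    push Not at h1
    obtain ⟨p, hp, hlev⟩ := h1 hL
    obtain ⟨t, y, h, hmem⟩ := exists_mem_excessTuples_of_not_levelPoint hd hn hp hlev
    refine Or.inr (Set.mem_iUnion.2 ⟨t, y, h, ?_⟩)
    have h2 : compForm (shear y h) f = (a⁻¹ : K) • compForm (shear y h) X.rep := by
      rw [hfX]
      exact Subtype.ext (map_smul (aeval (linForm (shear y h))) _ _)
    rw [h2, map_smul]
    exact smul_mem_excessTuples hmem ha0

theorem le_codim_sharpLocus [IsAlgClosed K] (hd : 1 ≤ d) (hn : d + 2 ≤ n) {c : ℕ}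
    (hc₁ : c + 2 * n ≤ n * d + 3) (hc₂ : c + n ≤ n.choose 2 + 1) :
    (c : ℕ∞) ≤ codim (sharpLocus K n d) := by
  -- Besides the first count, this bounds the dimension of the space of forms below by `n d + 1`, so
  -- that the truncated subtractions below are harmless.
  have h1 := finrank_singularForms_add_le (K := K) hd
    (Fin.castLEEmb (show 2 ≤ n + 1 by omega))
  have h2 : (n - 1) * d = n * d - d := Nat.sub_one_mul n d
  have h3 : d ≤ n * d := Nat.le_mul_of_pos_left d (by omega)
  have h4 := sizeLE_singularAlongLine (K := K) (n := n) (d := d)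
    (e := finrank K (homogeneousSubmodule (Fin (n + 1)) K d) - c) hd (by omega)
  have h5 : ∀ t : Fin 2, _ := fun t => (sizeLE_excessForms (K := K) (n := n) (d := d) (t := t)
    (e := finrank K (homogeneousSubmodule (Fin (n + 1)) K d) - (1 + n.choose 2)) hd hn
    (by omega)).mono_right
    (show _ ≤ finrank K (homogeneousSubmodule (Fin (n + 1)) K d) - c by omega)
  exact le_codim_of_sizeLE ((h4.union (SizeLE.iUnion h5)).mono (cone_sharp_subset hd (by omega)))
    (by omega)

end Sharp

end OneLevel

end

/-- If `n ≥ d + 2`, the codimension of `S₁` in `ℙ^N` is at least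
`min {n (d - 2) + 3, (n choose 2) - n + 1}`. The minimum is taken in `ℤ`; when it is negative the
bound says nothing, and `Int.toNat` replaces it by `0`. -/
theorem mainTheorem6 (K : Type*) [Field K] [IsAlgClosed K] (n d : ℕ) (hd : 1 ≤ d)
    (hn : d + 2 ≤ n) :
    ((min ((n : ℤ) * ((d : ℤ) - 2) + 3) ((n.choose 2 : ℤ) - (n : ℤ) + 1)).toNat : ℕ∞) ≤
      OneLevel.codim (OneLevel.sharpLocus K n d) := by
  by_cases hc : min ((n : ℤ) * ((d : ℤ) - 2) + 3) ((n.choose 2 : ℤ) - (n : ℤ) + 1) ≤ 0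
  · rw [Int.toNat_of_nonpos hc]
    exact zero_le
  · have h1 : (n : ℤ) * ((d : ℤ) - 2) + 3 = ((n * d : ℕ) : ℤ) - 2 * n + 3 := by
      push_cast
      ring
    rw [h1] at hc ⊢
    exact OneLevel.le_codim_sharpLocus hd hn (by omega) (by omega)
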